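/- **Setting.** Let $F$ be a non-archimedean local field of characteristic $0$ with ring of integers $\mathfrak o$, maximal ideal $\mathfrak p=\varpi\mathfrak o$ and residue field of cardinality $q$. Let $\psi$ be a character of $F$ that is trivial on $\mathfrak o$ and non-trivial on $\mathfrak p^{-1}$. Let $\mathbf a,\mathbf b,\mathbf c\in F$ with $\mathbf d=\mathbf b^2-4\mathbf a\mathbf c\neq0$, and put $S=\begin{bmatrix}\mathbf a&\mathbf b/2\\\mathbf b/2&\mathbf c\end{bmatrix}$ and $\xi=\begin{bmatrix}\mathbf b/2&\mathbf c\\-\mathbf a&-\mathbf b/2\end{bmatrix}$. Let $L=F(\sqrt{\mathbf d})$ if $\mathbf d$ is not a square in $F$, and $L=F\oplus F$ (with $\sqrt{\mathbf d}\in F$ corresponding to the element $(\sqrt{\mathbf d},-\sqrt{\mathbf d})$) if $\mathbf d$ is a square. Let $\mathfrak o_L$ be the integral closure of $\mathfrak o$ in $L$, so $\mathfrak o_L=\mathfrak o\oplus\mathfrak o$ if $L=F\oplus F$. Assume that $\mathbf a,\mathbf b\in\mathfrak o$ and $\mathbf c\in\mathfrak o^\times$; that $\mathbf d$ generates the discriminant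 of $L/F$ if $\mathbf d$ is not a square in $F$; and that $\mathbf d\in\mathfrak o^\times$ if $\mathbf d$ is a square. We are in the *inert*, *ramified* or *split* case according to whether $L/F$ is an unramified field extension, a ramified field extension, or $L=F\oplus F$. Let $\varpi_L$ be a uniformizer of $\mathfrak o_L$ if $L$ is a field, and $\varpi_L=(\varpi,1)$ in the split case. Let $T(F)=\{g\in\mathrm{GL}_2(F):{}^tgSg=\det(g)S\}=F(\xi)^\times$, identified with $L^\times$ via $x+y\xi\mapsto x+y\sqrt{\mathbf d}/2$. Let $\Lambda$ be a continuous homomorphism $T(F)\cong L^\times\to\mathbb C^\times$, and let $m_0=\min\{m\ge0:\Lambda|_{(1+\mathfrak p^m\mathfrak o_L)\cap\mathfrak o_L^\times}=1\}$. Let $\mathrm{GSp}_4(F)=\{g\in\mathrm{GL}_4(F):{}^tgJg=\nu J\text{ for some }\nu\in F^\times\}$, where $J=\begin{bmatrix}&1_2\\-1_2&\end{bmatrix}$, and embed $T(F)$ in it by $g\mapsto\begin{bmatrix}g&\\&\det(g)\,{}^tg^{-1}\end{bmatrix}$. Let $P_1$ be the group of all elements of $\mathrm{GSp}_4(\mathfrak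 o)$ whose lower left $2\times2$ block has entries in $\mathfrak p$. Let $\mathcal S(\Lambda,\theta,P_1)$ be the space of all locally constant functions $B:\mathrm{GSp}_4(F)\to\mathbb C$ that are right invariant under $P_1$ and satisfy $$B\Big(t\begin{bmatrix}1&X\\&1\end{bmatrix}g\Big)=\Lambda(t)\,\psi(\mathrm{tr}(SX))\,B(g)$$ for all $t\in T(F)$, all symmetric $X\in M_2(F)$ and all $g\in\mathrm{GSp}_4(F)$. For $l,m\in\mathbb Z$ let $h(l,m)=\mathrm{diag}(\varpi^{l+2m},\varpi^{l+m},1,\varpi^m)$. Define $$(T_{i,j}B)(g)=\frac1{\mathrm{vol}(P_1)}\int_{P_1h(i,j)P_1}B(gx)\,dx\qquad\text{for }(i,j)\in\{(1,0),(0,1)\},$$ where $dx$ is a Haar measure on $\mathrm{GSp}_4(F)$. **Proposition.** Let $B\in\mathcal S(\Lambda,\theta,P_1)$ and $\lambda,\mu\in\mathbb C$ be such that $T_{1,0}B=\lambda B$ and $T_{0,1}B=\mu B$. Then $$B(h(l+1,m))=\lambda q^{-3}B(h(l,m))\qquad\text{for all }l,m\ge0.$$ Furthermore, for every $l\ge0$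 there is an identity of formal power series $$\sum_{m=m_0}^\infty B(h(l,m))Y^{m-m_0}=\frac{1-\kappa q^{-4}Y}{1-\mu q^{-4}Y+\lambda^2q^{-7}\Lambda(\varpi)Y^2}\,B(h(l,m_0)),$$ where $$\kappa=\begin{cases}0&\text{if }m_0>0,\\(q+1)^{-1}\mu&\text{if }m_0=0\text{, in the inert case},\\\Lambda(\varpi_L)\lambda&\text{if }m_0=0\text{, in the ramified case},\\(q-1)^{-1}\big(q\lambda(\Lambda(\varpi,1)+\Lambda(1,\varpi))-\mu\big)&\text{if }m_0=0\text{, in the split case}.\end{cases}$$ -/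

import Mathlib

open MeasureTheory
open scoped Matrix ValuativeRel

noncomputable section

namespace BesselGSp4

/-! ### The group `GSp₄` in block form -/

section Symplectic

variable {F : Type*} [Field F]

/-- The symplectic form `J = [0, 1₂; -1₂, 0]`. Rows and columns `1, 2 | 3, 4` of `4 × 4` matrices
are indexed by `Fin 2 ⊕ Fin 2`. -/
def symplJ (F : Type*) [Field F] : Matrix (Fin 2 ⊕ Fin 2) (Fin 2 ⊕ Fin 2) F :=
  Matrix.fromBlocks 0 1 (-1) 0

theorem symplJ_mul_symplJ : symplJ F * symplJ F = -1 := by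
  rw [symplJ, Matrix.fromBlocks_multiply, ← Matrix.fromBlocks_one, Matrix.fromBlocks_neg]
  simp

/-- `GSp₄(F) = {g ∈ GL₄(F) : ᵗg J g = ν J for some ν ∈ Fˣ}`. -/
def GSp4 (F : Type*) [Field F] : Subgroup (GL (Fin 2 ⊕ Fin 2) F) where
  carrier := {g | ∃ ν : Fˣ, (g.1)ᵀ * symplJ F * g.1 = (ν : F) • symplJ F}
  one_mem' := ⟨1, by simp⟩
  mul_mem' := by
    rintro g h ⟨ν, hg⟩ ⟨ρ, hh⟩
    refine ⟨ν * ρ, ?_⟩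
    have e : ((g * h).1)ᵀ * symplJ F * (g * h).1
        = (h.1)ᵀ * ((g.1)ᵀ * symplJ F * g.1) * h.1 := by
      simp only [Units.val_mul, Matrix.transpose_mul, Matrix.mul_assoc]
    rw [e, hg, Matrix.mul_smul, Matrix.smul_mul, hh, smul_smul, Units.val_mul]
  inv_mem' := by
    rintro g ⟨ν, hg⟩
    refine ⟨ν⁻¹, ?_⟩
    have hgi : g.1 * (g⁻¹).1 = 1 := by rw [← Units.val_mul]; simp
    have e : ((g⁻¹).1)ᵀ * ((g.1)ᵀ * symplJ F * g.1) * (g⁻¹).1 = symplJ F := by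
      have h2 : ((g⁻¹).1)ᵀ * (g.1)ᵀ = 1 := by
        rw [← Matrix.transpose_mul, hgi, Matrix.transpose_one]
      calc ((g⁻¹).1)ᵀ * ((g.1)ᵀ * symplJ F * g.1) * (g⁻¹).1
          = (((g⁻¹).1)ᵀ * (g.1)ᵀ) * symplJ F * (g.1 * (g⁻¹).1) := by
            simp only [Matrix.mul_assoc]
        _ = symplJ F := by rw [h2, hgi]; simp
    rw [hg, Matrix.mul_smul, Matrix.smul_mul] at e
    have := congrArg (fun M => ((ν⁻¹ : Fˣ) : F) • M) e
    simpa [smul_smul] using this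

/-- A matrix `A` with `ᵗA J A = ν J`, `ν ≠ 0`, as an element of `GSp₄(F)`. -/
def GSp4.ofMatrix (A : Matrix (Fin 2 ⊕ Fin 2) (Fin 2 ⊕ Fin 2) F) (ν : Fˣ)
    (h : Aᵀ * symplJ F * A = (ν : F) • symplJ F) : GSp4 F :=
  have hl : (((ν⁻¹ : Fˣ) : F) • (-(symplJ F) * Aᵀ * symplJ F)) * A = 1 := by
    rw [Matrix.smul_mul, Matrix.mul_assoc, Matrix.mul_assoc, ← Matrix.mul_assoc Aᵀ, h,
      Matrix.mul_smul, smul_smul, Matrix.neg_mul, symplJ_mul_symplJ]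
    simp
  ⟨⟨A, ((ν⁻¹ : Fˣ) : F) • (-(symplJ F) * Aᵀ * symplJ F), mul_eq_one_comm.mp hl, hl⟩, ν, h⟩

/-- The element `[1, X; 0, 1]` of the unipotent radical of the Siegel parabolic subgroup, for a
symmetric matrix `X`. -/
def unip (X : Matrix (Fin 2) (Fin 2) F) (hX : X.IsSymm) : GSp4 F :=
  GSp4.ofMatrix (Matrix.fromBlocks 1 X 0 1) 1 (by
    simp [symplJ, Matrix.fromBlocks_transpose, Matrix.fromBlocks_multiply, hX.eq])

/-- The embedding `g ↦ [g, 0; 0, det(g) ᵗg⁻¹]` of `GL₂(F)` into `GSp₄(F)`. -/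
def levi (g : GL (Fin 2) F) : GSp4 F :=
  GSp4.ofMatrix (Matrix.fromBlocks g.1 0 0 (g.1.det • ((g⁻¹).1)ᵀ)) (Matrix.GeneralLinearGroup.det g)
    (by
      have h1 : (g.1)ᵀ * ((g⁻¹).1)ᵀ = 1 := by
        rw [← Matrix.transpose_mul, ← Units.val_mul]; simp
      have h2 : (g⁻¹).1 * g.1 = 1 := by rw [← Units.val_mul]; simp
      simp only [symplJ, Matrix.fromBlocks_transpose, Matrix.fromBlocks_multiply,
        Matrix.fromBlocks_smul]
      simp only [Matrix.transpose_smul, Matrix.transpose_transpose, Matrix.mul_zero,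
        Matrix.zero_mul, Matrix.mul_one, Matrix.mul_neg, Matrix.neg_mul, Matrix.mul_smul,
        Matrix.smul_mul, Matrix.transpose_zero, add_zero, zero_add, smul_zero, h1, h2, neg_zero,
        smul_neg, Matrix.GeneralLinearGroup.val_det_apply])

/-- `h(l,m) = diag(ϖ^(l+2m), ϖ^(l+m), 1, ϖ^m)`. -/
def hElt (ϖ : Fˣ) (l m : ℤ) : GSp4 F :=
  GSp4.ofMatrix
    (Matrix.fromBlocks (Matrix.diagonal ![(ϖ : F) ^ (l + 2 * m), (ϖ : F) ^ (l + m)]) 0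
      0 (Matrix.diagonal ![1, (ϖ : F) ^ m]))
    (ϖ ^ (l + 2 * m)) (by
      have e : (ϖ : F) ^ (l + m) * (ϖ : F) ^ m = (ϖ : F) ^ (l + 2 * m) := by
        rw [← zpow_add₀ ϖ.ne_zero]; congr 1; ring
      have e' : (ϖ : F) ^ m * (ϖ : F) ^ (l + m) = (ϖ : F) ^ (l + 2 * m) := by
        rw [mul_comm, e]
      simp only [symplJ, Matrix.fromBlocks_transpose, Matrix.fromBlocks_multiply,
        Matrix.fromBlocks_smul]
      congr 1 <;> ext i j <;> fin_cases i <;> fin_cases j <;> simp [e, e'])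

end Symplectic

/-! ### The binary quadratic form, the quadratic algebra `L` and the torus `T(F)` -/

section Torus

variable {F : Type*} [Field F]

/-- `S = [a, b/2; b/2, c]`. -/
def matS (a b c : F) : Matrix (Fin 2) (Fin 2) F := !![a, b / 2; b / 2, c]

/-- `ξ = [b/2, c; -a, -b/2]`. -/
def matXi (a b c : F) : Matrix (Fin 2) (Fin 2) F := !![b / 2, c; -a, -b / 2]

/-- `d = b² - 4ac`. -/
def disc (a b c : F) : F := b ^ 2 - 4 * a * c

/-- `T(F) = {g ∈ GL₂(F) : ᵗg S g = det(g) S}`. -/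
def torus (a b c : F) : Subgroup (GL (Fin 2) F) where
  carrier := {g | (g.1)ᵀ * matS a b c * g.1 = g.1.det • matS a b c}
  one_mem' := by simp
  mul_mem' := by
    intro g h hg hh
    simp only [Set.mem_ofPred_eq] at hg hh ⊢
    have e : ((g * h).1)ᵀ * matS a b c * (g * h).1
        = (h.1)ᵀ * ((g.1)ᵀ * matS a b c * g.1) * h.1 := by
      simp only [Units.val_mul, Matrix.transpose_mul, Matrix.mul_assoc]
    rw [e, hg, Matrix.mul_smul, Matrix.smul_mul, hh, smul_smul, Units.val_mul, Matrix.det_mul]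
  inv_mem' := by
    intro g hg
    simp only [Set.mem_ofPred_eq] at hg ⊢
    have hgi : g.1 * (g⁻¹).1 = 1 := by rw [← Units.val_mul]; simp
    have hd : (g⁻¹).1.det * g.1.det = 1 := by
      rw [mul_comm, ← Matrix.det_mul, hgi, Matrix.det_one]
    have e : ((g⁻¹).1)ᵀ * ((g.1)ᵀ * matS a b c * g.1) * (g⁻¹).1 = matS a b c := by
      have h2 : ((g⁻¹).1)ᵀ * (g.1)ᵀ = 1 := by
        rw [← Matrix.transpose_mul, hgi, Matrix.transpose_one]
      calc ((g⁻¹).1)ᵀ * ((g.1)ᵀ * matS a b c * g.1) * (g⁻¹).1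
          = (((g⁻¹).1)ᵀ * (g.1)ᵀ) * matS a b c * (g.1 * (g⁻¹).1) := by
            simp only [Matrix.mul_assoc]
        _ = matS a b c := by rw [h2, hgi]; simp
    rw [hg, Matrix.mul_smul, Matrix.smul_mul] at e
    have := congrArg (fun M => (g⁻¹).1.det • M) e
    simpa only [smul_smul, hd, one_smul] using this

/-- The quadratic algebra `L = F[X]/(X² - d)`, with elements `x + y√d`. It is the field `F(√d)` if
`d` is not a square, and is isomorphic to `F ⊕ F` if `d` is a nonzero square (see `splitHom`). Its
involution `z ↦ z̄` is `star`. -/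
abbrev quadL (a b c : F) : Type _ := QuadraticAlgebra F (disc a b c) 0

/-- For a square root `r` of `d`, the homomorphism `L → F ⊕ F`, `x + y√d ↦ (x + yr, x - yr)`; it is
an isomorphism if `d ≠ 0` and `2 ≠ 0`. -/
def splitHom (a b c r : F) (hr : r ^ 2 = disc a b c) : quadL a b c →ₐ[F] F × F :=
  QuadraticAlgebra.lift ⟨(r, -r), by ext <;> simp [← hr, pow_two]⟩

theorem splitHom_apply (a b c r : F) (hr : r ^ 2 = disc a b c) (z : quadL a b c) :
    splitHom a b c r hr z = (z.re + z.im * r, z.re - z.im * r) := by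
  ext <;> simp [splitHom, QuadraticAlgebra.lift, sub_eq_add_neg]

/-- The involution of `L` corresponds to swapping the two components of `F ⊕ F`. -/
theorem splitHom_star (a b c r : F) (hr : r ^ 2 = disc a b c) (z : quadL a b c) :
    splitHom a b c r hr (star z) = (splitHom a b c r hr z).swap := by
  ext <;> simp [splitHom_apply, sub_eq_add_neg]

variable [CharZero F]

/-- The map `L → M₂(F)`, `x + y√d ↦ x + 2yξ`; it is an isomorphism onto `F + Fξ`, and inverse to
`x + yξ ↦ x + y√d/2`. -/
def quadHom (a b c : F) : quadL a b c →ₐ[F] Matrix (Fin 2) (Fin 2) F :=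
  QuadraticAlgebra.lift ⟨(2 : F) • matXi a b c, by
    ext i j
    fin_cases i <;> fin_cases j <;>
      simp [matXi, disc, Matrix.mul_apply, Fin.sum_univ_two] <;> ring⟩

theorem quadHom_apply (a b c : F) (z : quadL a b c) :
    quadHom a b c z = !![z.re + z.im * b, 2 * z.im * c; -(2 * z.im * a), z.re - z.im * b] := by
  ext i j
  fin_cases i <;> fin_cases j <;>
    simp [quadHom, QuadraticAlgebra.lift, matXi] <;> field_simp <;> first | (simp; done) | ring

/-- The isomorphism `Lˣ ≅ T(F)`, `x + y√d ↦ x + 2yξ`. -/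
def toTorus (a b c : F) : (quadL a b c)ˣ →* torus a b c :=
  (Units.map (quadHom a b c : quadL a b c →* Matrix (Fin 2) (Fin 2) F)).codRestrict (torus a b c)
    (by
      intro z
      change (quadHom a b c z.1)ᵀ * matS a b c * (quadHom a b c z.1)
        = (quadHom a b c z.1).det • matS a b c
      rw [quadHom_apply]
      ext i j
      fin_cases i <;> fin_cases j <;>
        simp [matS, Matrix.mul_apply, Fin.sum_univ_two, Matrix.det_fin_two] <;> ring)

/-- A character `Λ` of `T(F)`, considered as a character of `Lˣ`. -/
def charL (a b c : F) (Λ : torus a b c →* ℂˣ) : (quadL a b c)ˣ →* ℂˣ := Λ.comp (toTorus a b c)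

/-- The element `x ∈ Fˣ` as an element of `Lˣ`. -/
def scalarL (a b c : F) : Fˣ →* (quadL a b c)ˣ :=
  Units.map (algebraMap F (quadL a b c) : F →* quadL a b c)

end Torus

/-! ### Arithmetic of `F` and `L` -/

section Arithmetic

variable {F : Type*} [Field F] [ValuativeRel F]

/-- `ϖ` is a generator of the maximal ideal of the ring of integers of `F`. -/
def IsUniformizer (ϖ : Fˣ) : Prop :=
  ∃ h : (ϖ : F) ∈ 𝒪[F], 𝓂[F] = Ideal.span {(⟨ϖ, h⟩ : 𝒪[F])}

/-- `𝔬_L`, the integral closure of `𝔬` in `L`: it is the ring of integers of `L` if `L` is a field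
and corresponds to `𝔬 ⊕ 𝔬` if `L ≅ F ⊕ F`. -/
abbrev intL (a b c : F) : Subalgebra 𝒪[F] (quadL a b c) := integralClosure 𝒪[F] (quadL a b c)

/-- The discriminant of `L/F`: the ideal of `𝔬` (as a submodule of `F`) generated by the
discriminants of all pairs of elements of `𝔬_L`. -/
def discrL (a b c : F) : Submodule 𝒪[F] F :=
  Submodule.span 𝒪[F] {x | ∃ v : Fin 2 → quadL a b c,
    (∀ i, v i ∈ intL a b c) ∧ x = Algebra.discr F v}

/-- The standard assumptions on `a, b, c`: `d ≠ 0`; `a, b ∈ 𝔬` and `c ∈ 𝔬ˣ`; if `d` is not a square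
in `F`, then `d` generates the discriminant of `L/F`; if `d` is a square, then `d ∈ 𝔬ˣ`. -/
structure StandardAssumptions (a b c : F) : Prop where
  disc_ne_zero : disc a b c ≠ 0
  a_mem : a ∈ 𝒪[F]
  b_mem : b ∈ 𝒪[F]
  c_mem : c ∈ 𝒪[F]
  c_inv_mem : c ≠ 0 ∧ c⁻¹ ∈ 𝒪[F]
  nonsplit : ¬ IsSquare (disc a b c) → discrL a b c = Submodule.span 𝒪[F] {disc a b c}
  split : IsSquare (disc a b c) → disc a b c ∈ 𝒪[F] ∧ (disc a b c)⁻¹ ∈ 𝒪[F]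

open scoped Classical in
/-- The Legendre symbol `(L/𝔭)`: it is `1` in the split case `L ≅ F ⊕ F`, and if `L` is a field it
is `-1` or `0` according to whether `L/F` is unramified (i.e. `𝔭 𝔬_L` is the maximal ideal of `𝔬_L`)
or ramified. -/
def legendreL (a b c : F) : ℤ :=
  if IsSquare (disc a b c) then 1
  else if (Ideal.map (algebraMap 𝒪[F] (intL a b c)) 𝓂[F]).IsMaximal then -1
  else 0

/-- `ϖ_L` is a generator of the maximal ideal of `𝔬_L` if `L` is a field, and it corresponds to
`(ϖ, 1) ∈ F ⊕ F` in the split case. -/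
def IsUniformizerL (a b c : F) (ϖ : Fˣ) (ϖL : (quadL a b c)ˣ) : Prop :=
  (¬ IsSquare (disc a b c) →
    ∃ h : (ϖL : quadL a b c) ∈ intL a b c,
      (Ideal.span {(⟨ϖL, h⟩ : intL a b c)}).IsMaximal) ∧
  (IsSquare (disc a b c) →
    ∃ (r : F) (hr : r ^ 2 = disc a b c), splitHom a b c r hr ϖL = ((ϖ : F), 1))

variable [CharZero F]

/-- `m₀ = min {m ≥ 0 : Λ is trivial on (1 + 𝔭^m 𝔬_L) ∩ 𝔬_Lˣ}`. -/
def conductorExp (a b c : F) (ϖ : Fˣ) (Λ : torus a b c →* ℂˣ) : ℕ :=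
  sInf {m : ℕ | ∀ z : (quadL a b c)ˣ,
    (z : quadL a b c) ∈ intL a b c → ((z⁻¹ : (quadL a b c)ˣ) : quadL a b c) ∈ intL a b c →
    (∃ y ∈ intL a b c, (z : quadL a b c) = 1 + ((ϖ : F) ^ m) • y) →
    charL a b c Λ z = 1}

/-- The cardinality `q` of the residue field of `F`, as a complex number. -/
def resCard (F : Type*) [Field F] [ValuativeRel F] : ℂ := (Nat.card 𝓀[F] : ℂ)

/-- The number `κ`. In the split case `ϖ_L = (ϖ, 1)` and hence `star ϖ_L = (1, ϖ)`. -/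
def kappa (a b c : F) (ϖ : Fˣ) (ϖL : (quadL a b c)ˣ) (Λ : torus a b c →* ℂˣ) (lam mu : ℂ) : ℂ :=
  if 0 < conductorExp a b c ϖ Λ then 0
  else if legendreL a b c = -1 then (resCard F + 1)⁻¹ * mu
  else if legendreL a b c = 0 then (charL a b c Λ ϖL : ℂ) * lam
  else (resCard F - 1)⁻¹ *
    (resCard F * lam * ((charL a b c Λ ϖL : ℂ) + (charL a b c Λ (star ϖL) : ℂ)) - mu)

end Arithmetic

/-! ### The Siegel congruence subgroup, Bessel functions and Hecke operators -/

section Bessel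

variable {F : Type*} [Field F] [ValuativeRel F]

/-- `K = GSp₄(𝔬)`: the elements `g` of `GSp₄(F)` such that `g` and `g⁻¹` have integral entries. -/
def maxCompact (F : Type*) [Field F] [ValuativeRel F] : Subgroup (GSp4 F) where
  carrier := {g | (∀ i j, g.1.1 i j ∈ 𝒪[F]) ∧ ∀ i j, (g⁻¹).1.1 i j ∈ 𝒪[F]}
  one_mem' := by
    have h : ∀ i j, (1 : Matrix (Fin 2 ⊕ Fin 2) (Fin 2 ⊕ Fin 2) F) i j ∈ 𝒪[F] := by
      intro i j
      rw [Matrix.one_apply]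
      split_ifs
      · exact one_mem _
      · exact zero_mem _
    exact ⟨fun i j => by simpa using h i j, fun i j => by simpa using h i j⟩
  mul_mem' := by
    rintro g h ⟨hg, hg'⟩ ⟨hh, hh'⟩
    refine ⟨fun i j => ?_, fun i j => ?_⟩
    · change (g.1.1 * h.1.1) i j ∈ _
      rw [Matrix.mul_apply]
      exact sum_mem fun k _ => mul_mem (hg i k) (hh k j)
    · rw [mul_inv_rev]
      change ((h⁻¹).1.1 * (g⁻¹).1.1) i j ∈ _
      rw [Matrix.mul_apply]
      exact sum_mem fun k _ => mul_mem (hh' i k) (hg' k j)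
  inv_mem' := by
    rintro g ⟨hg, hg'⟩
    exact ⟨hg', by simpa using hg⟩

/-- The Siegel congruence subgroup `P₁` of level `𝔭`: the elements of `K` whose lower left `2 × 2`
block has entries in `𝔭 = {x : |x| < 1}`. -/
def siegelP1 (F : Type*) [Field F] [ValuativeRel F] : Subgroup (GSp4 F) where
  carrier := {g | g ∈ maxCompact F ∧
    ∀ i j : Fin 2, ValuativeRel.valuation F (g.1.1 (Sum.inr i) (Sum.inl j)) < 1}
  one_mem' := ⟨one_mem _, fun i j => by
    change ValuativeRel.valuation F ((1 : Matrix (Fin 2 ⊕ Fin 2) (Fin 2 ⊕ Fin 2) F) _ _) < 1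
    simp⟩
  mul_mem' := by
    rintro g h ⟨hg, hg'⟩ ⟨hh, hh'⟩
    refine ⟨mul_mem hg hh, fun i j => ?_⟩
    change ValuativeRel.valuation F ((g.1.1 * h.1.1) _ _) < 1
    rw [Matrix.mul_apply, Fintype.sum_sum_type]
    refine (Valuation.map_add _ _ _).trans_lt (max_lt ?_ ?_)
    · refine Valuation.map_sum_lt _ one_ne_zero fun k _ => ?_
      rw [map_mul]
      exact (mul_le_of_le_one_right' (hh.1 _ _)).trans_lt (hg' i k)
    · refine Valuation.map_sum_lt _ one_ne_zero fun k _ => ?_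
      rw [map_mul]
      exact (mul_le_of_le_one_left' (hg.1 _ _)).trans_lt (hh' k j)
  inv_mem' := by
    rintro g ⟨hg, hg'⟩
    refine ⟨inv_mem hg, fun i j => ?_⟩
    obtain ⟨ρ, hρ⟩ := (g⁻¹).2
    have hgi : (g⁻¹).1.1 * g.1.1 = 1 := by
      change ((g⁻¹).1 * g.1).1 = 1
      simp
    have hJ : ∀ i j, symplJ F i j ∈ 𝒪[F] := by
      rintro (i | i) (j | j) <;> simp only [symplJ, Matrix.fromBlocks_apply₁₁,
        Matrix.fromBlocks_apply₁₂, Matrix.fromBlocks_apply₂₁, Matrix.fromBlocks_apply₂₂,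
        Matrix.zero_apply, Matrix.neg_apply, Matrix.one_apply, zero_mem]
      · split_ifs
        · exact one_mem _
        · exact zero_mem _
      · split_ifs
        · exact neg_mem (one_mem _)
        · exact neg_mem (zero_mem _)
    have hρ1 : (ρ : F) ∈ 𝒪[F] := by
      have h := congrFun (congrFun hρ (Sum.inl 0)) (Sum.inr 0)
      have h' : ((ρ : F) • symplJ F) (Sum.inl 0) (Sum.inr 0) = ρ := by simp [symplJ]
      rw [h'] at h
      rw [← h, Matrix.mul_apply]
      refine sum_mem fun k _ => mul_mem ?_ (hg.2 _ _)
      rw [Matrix.mul_apply]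
      exact sum_mem fun k _ => mul_mem (hg.2 _ _) (hJ _ _)
    have e : ((g⁻¹).1.1)ᵀ * symplJ F = (ρ : F) • (symplJ F * g.1.1) := by
      have := congrArg (fun M => M * g.1.1) hρ
      simpa only [Matrix.mul_assoc, hgi, Matrix.mul_one, Matrix.smul_mul] using this
    have e' := congrFun (congrFun e (Sum.inl j)) (Sum.inl i)
    simp only [symplJ, Matrix.mul_apply, Matrix.smul_apply, Fintype.sum_sum_type,
      Matrix.fromBlocks_apply₁₁, Matrix.fromBlocks_apply₁₂, Matrix.fromBlocks_apply₂₁,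
      Matrix.zero_apply, Matrix.neg_apply, Matrix.one_apply, Matrix.transpose_apply] at e'
    simp only [mul_zero, zero_mul, Finset.sum_const_zero, zero_add, mul_neg, mul_ite, mul_one,
      ite_mul, one_mul, Finset.sum_neg_distrib, Finset.sum_ite_eq, Finset.sum_ite_eq',
      Finset.mem_univ, if_true, smul_eq_mul] at e'
    have e'' : (g⁻¹).1.1 (Sum.inr i) (Sum.inl j) = -(ρ * g.1.1 (Sum.inr j) (Sum.inl i)) := by
      rw [← e', neg_neg]
    rw [e'', Valuation.map_neg, map_mul]
    exact (mul_le_of_le_one_left' hρ1).trans_lt (hg' _ _)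

/-- `B ∈ S(Λ, θ, P₁)`: `B` is a locally constant function on `GSp₄(F)` with `B(tug) = Λ(t)θ(u)B(g)`
for `t ∈ T(F)` and `u = [1, X; 0, 1]`, where `θ(u) = ψ(tr(SX))`, and right invariant under `P₁`. -/
structure IsBesselFunction [TopologicalSpace F] (a b c : F) (ψ : AddChar F ℂ)
    (Λ : torus a b c →* ℂˣ) (B : GSp4 F → ℂ) : Prop where
  locallyConstant : IsLocallyConstant B
  bessel : ∀ (t : torus a b c) (X : Matrix (Fin 2) (Fin 2) F) (hX : X.IsSymm) (g : GSp4 F),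
    B (levi t.1 * unip X hX * g) = (Λ t : ℂ) * ψ (Matrix.trace (matS a b c * X)) * B g
  right_invariant : ∀ g : GSp4 F, ∀ p ∈ siegelP1 F, B (g * p) = B g

/-- The Hecke operator of the double coset `P₁ h P₁` acting by right translation:
`(T B)(g) = vol(P₁)⁻¹ ∫_{P₁ h P₁} B(gx) dx` for a Haar measure `dx = ν`. -/
def hecke [MeasurableSpace (GSp4 F)] (ν : Measure (GSp4 F)) (h : GSp4 F) (B : GSp4 F → ℂ) :
    GSp4 F → ℂ := fun g =>
  ((ν.real (siegelP1 F : Set (GSp4 F)) : ℝ) : ℂ)⁻¹ *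
    ∫ x in DoubleCoset.doubleCoset h (siegelP1 F : Set (GSp4 F)) (siegelP1 F : Set (GSp4 F)),
      B (g * x) ∂ν

end Bessel

end BesselGSp4

end

open BesselGSp4

/-! Each double coset P₁hP₁ is a finite disjoint union of cosets κhP₁, so both Hecke operators
become finite sums (`hecke_eq_sum`). For h(1,0) the κ are q³ unipotents. For h(0,1) each κ is a Levi
element, one for each of the q+1 lines in (𝔬/𝔭)², times one of q³ unipotents. If l, m ≥ 0,
conjugation by h(l,m) keeps integral unipotents integral, and ψ(tr(SX)) = 1 on these, so the
unipotents drop out at g = h(l,m). For h(1,0) this is already the relation between l+1 and l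
(`hecke_one_zero_apply_hElt`). For h(0,1) it leaves q³ times a sum over lines
(`hecke_zero_one_apply_hElt`).

That sum lives on GL₂. Since h(l,m) = h(l+m,0)·levi(diag(ϖ^m,1)) and h(n,0) commutes with the Levi
subgroup, everything is read off from g ↦ B(h(n,0) levi g) (`leviRestrict`). This function
transforms by Λ under T(F) on the left and is right invariant under GL₂(𝔬), so it is a function of
the lattice g𝔬². The sum runs over the q+1 sublattices of index q in diag(ϖ^m,1)𝔬².

For m ≥ 1 one sublattice is ϖ·diag(ϖ^(m-1),1)𝔬² and contributes Λ(ϖ). The other q are translates of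
diag(ϖ^(m+1),1)𝔬² by units in 1 + 𝔭^m 𝔬_L, on which Λ is trivial once m ≥ m₀
(`hecke_zero_one_recurrence`). For m = 0 the translates of 𝔬² itself occur exactly at the roots of
X² + bX + ac modulo 𝔭: none in the inert, one in the ramified and two in the split case. They
contribute Λ(ϖ_L) and, in the split case, also Λ of its conjugate
(`hecke_zero_one_apply_hElt_zero`). If m < m₀, some unit fixes diag(ϖ^m,1)𝔬² although Λ is not 1 on
it, so B(h(l,m)) = 0 (`apply_hElt_eq_zero`).

Replacing B(h(l+2,m)) by λ²q⁻⁶B(h(l,m)) turns this into a recurrence of order two in m. The number κ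
records the first step after m₀, and `mk_eq_mul_inv_of_recurrence` sums the series. All explicit
matrices rest on 𝔬_L = 𝔬 + 𝔬ω with ω = (b + √d)/2 (`exists_coordL_of_mem`), the one place where the
discriminant assumption enters. -/

namespace BesselGSp4

/-! ### Divisibility by a uniformizer and reduction to the residue field -/

section IntegerRing

variable {F : Type*} [Field F] [ValuativeRel F]

theorem algebraMap_mem_integer (x : 𝒪[F]) : algebraMap 𝒪[F] F x ∈ 𝒪[F] := x.2

theorem exists_algebraMap_eq {x : F} (hx : x ∈ 𝒪[F]) : ∃ y : 𝒪[F], algebraMap 𝒪[F] F y = x :=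
  ⟨⟨x, hx⟩, rfl⟩

theorem algebraMap_integer_injective : Function.Injective (algebraMap 𝒪[F] F) :=
  Subtype.val_injective

theorem isUnit_iff_valuation {x : 𝒪[F]} :
    IsUnit x ↔ ValuativeRel.valuation F (algebraMap 𝒪[F] F x) = 1 :=
  (Valuation.integer.integers _).isUnit_iff_valuation_eq_one

theorem valuation_lt_one_iff {π : 𝒪[F]} (hπ : 𝓂[F] = Ideal.span {π}) {x : 𝒪[F]} :
    ValuativeRel.valuation F (algebraMap 𝒪[F] F x) < 1 ↔ π ∣ x := by
  rw [← Ideal.mem_span_singleton, ← hπ, IsLocalRing.mem_maximalIdeal, mem_nonunits_iff,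
    isUnit_iff_valuation]
  exact ⟨ne_of_lt, lt_of_le_of_ne x.2⟩

theorem not_isUnit_iff_dvd {π : 𝒪[F]} (hπ : 𝓂[F] = Ideal.span {π}) {x : 𝒪[F]} :
    ¬ IsUnit x ↔ π ∣ x := by
  rw [← Ideal.mem_span_singleton, ← hπ, IsLocalRing.mem_maximalIdeal, mem_nonunits_iff]

theorem residue_eq_zero_iff_dvd {π : 𝒪[F]} (hπ : 𝓂[F] = Ideal.span {π}) {x : 𝒪[F]} :
    IsLocalRing.residue 𝒪[F] x = 0 ↔ π ∣ x := by
  rw [IsLocalRing.residue_eq_zero_iff, hπ, Ideal.mem_span_singleton]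

theorem residue_eq_iff_dvd {π : 𝒪[F]} (hπ : 𝓂[F] = Ideal.span {π}) {x y : 𝒪[F]} :
    IsLocalRing.residue 𝒪[F] x = IsLocalRing.residue 𝒪[F] y ↔ π ∣ x - y := by
  rw [← residue_eq_zero_iff_dvd hπ, map_sub, sub_eq_zero]

theorem isUnit_add_of_dvd {π : 𝒪[F]} (hπ : 𝓂[F] = Ideal.span {π}) {x y : 𝒪[F]}
    (hx : IsUnit x) (hy : π ∣ y) : IsUnit (x + y) := by
  by_contra h
  rw [not_isUnit_iff_dvd hπ] at h
  exact (not_isUnit_iff_dvd hπ).2 ((dvd_add_left hy).1 h) hx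

/-- A set-theoretic section of the reduction map `𝔬 → 𝔬/𝔭`. -/
noncomputable def residueLift (x : 𝓀[F]) : 𝒪[F] :=
  Function.surjInv IsLocalRing.residue_surjective x

@[simp] theorem residue_residueLift (x : 𝓀[F]) :
    IsLocalRing.residue 𝒪[F] (residueLift x) = x :=
  Function.surjInv_eq _ _

theorem exists_dvd_sub_residueLift {π : 𝒪[F]} (hπ : 𝓂[F] = Ideal.span {π}) (x : 𝒪[F]) :
    ∃ r : 𝓀[F], π ∣ x - residueLift r :=
  ⟨IsLocalRing.residue _ x, by rw [← residue_eq_iff_dvd hπ, residue_residueLift]⟩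

theorem residueLift_injective_mod {π : 𝒪[F]} (hπ : 𝓂[F] = Ideal.span {π}) {r s : 𝓀[F]}
    (h : π ∣ (residueLift r : 𝒪[F]) - residueLift s) : r = s := by
  rw [← residue_eq_iff_dvd hπ] at h
  simpa using h

end IntegerRing

/-! ### Block matrices over 𝔬 and membership in P₁ -/

section Symplectic

variable {F : Type*} [Field F]

theorem GSp4.ext_matrix {g h : GSp4 F} (e : g.1.1 = h.1.1) : g = h :=
  Subtype.ext (Units.ext e)

@[simp] theorem GSp4.coe_mul (g h : GSp4 F) : (g * h).1.1 = g.1.1 * h.1.1 := rfl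

@[simp] theorem unip_coe (X : Matrix (Fin 2) (Fin 2) F) (hX : X.IsSymm) :
    (unip X hX).1.1 = Matrix.fromBlocks 1 X 0 1 := rfl

@[simp] theorem levi_coe (g : GL (Fin 2) F) :
    (levi g).1.1 = Matrix.fromBlocks g.1 0 0 (g.1.det • ((g⁻¹).1)ᵀ) := rfl

@[simp] theorem hElt_coe (ϖ : Fˣ) (l m : ℤ) :
    (hElt ϖ l m).1.1 =
      Matrix.fromBlocks (Matrix.diagonal ![(ϖ : F) ^ (l + 2 * m), (ϖ : F) ^ (l + m)]) 0
      0 (Matrix.diagonal ![1, (ϖ : F) ^ m]) := rfl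

theorem levi_mul (g h : GL (Fin 2) F) : levi (g * h) = levi g * levi h := by
  apply GSp4.ext_matrix
  simp only [levi_coe, GSp4.coe_mul, Matrix.fromBlocks_multiply, mul_inv_rev, Units.val_mul,
    Matrix.transpose_mul, Matrix.det_mul]
  simp [smul_smul, mul_comm]

theorem levi_one : levi (1 : GL (Fin 2) F) = 1 := by
  apply GSp4.ext_matrix
  simp [← Matrix.fromBlocks_one]

theorem unip_mul (X Y : Matrix (Fin 2) (Fin 2) F) (hX : X.IsSymm) (hY : Y.IsSymm) :
    unip X hX * unip Y hY = unip (X + Y) (hX.add hY) := by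
  apply GSp4.ext_matrix
  simp [Matrix.fromBlocks_multiply, add_comm]

theorem unip_zero : unip (0 : Matrix (Fin 2) (Fin 2) F) Matrix.isSymm_zero = 1 := by
  apply GSp4.ext_matrix
  simp [← Matrix.fromBlocks_one]

/-- The inverse of an element of `GSp₄(F)` in terms of its similitude factor. -/
theorem GSp4.inv_coe_of_similitude (g : GSp4 F) (ν : Fˣ)
    (h : (g.1.1)ᵀ * symplJ F * g.1.1 = (ν : F) • symplJ F) :
    (g⁻¹).1.1 = ((ν⁻¹ : Fˣ) : F) • (-(symplJ F) * (g.1.1)ᵀ * symplJ F) := by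
  have : g = GSp4.ofMatrix g.1.1 ν h := GSp4.ext_matrix rfl
  conv_lhs => rw [this]
  rfl

theorem similitude_inv {g : GSp4 F} {ν : Fˣ}
    (h : (g.1.1)ᵀ * symplJ F * g.1.1 = (ν : F) • symplJ F) :
    ((g⁻¹).1.1)ᵀ * symplJ F * (g⁻¹).1.1 = ((ν⁻¹ : Fˣ) : F) • symplJ F := by
  have hgi : g.1.1 * (g⁻¹).1.1 = 1 := by rw [← GSp4.coe_mul]; simp
  have h2 : ((g⁻¹).1.1)ᵀ * (g.1.1)ᵀ = 1 := by
    rw [← Matrix.transpose_mul, hgi, Matrix.transpose_one]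
  have e : ((g⁻¹).1.1)ᵀ * ((g.1.1)ᵀ * symplJ F * g.1.1) * (g⁻¹).1.1 = symplJ F := by
    calc ((g⁻¹).1.1)ᵀ * ((g.1.1)ᵀ * symplJ F * g.1.1) * (g⁻¹).1.1
        = (((g⁻¹).1.1)ᵀ * (g.1.1)ᵀ) * symplJ F * (g.1.1 * (g⁻¹).1.1) := by
          simp only [Matrix.mul_assoc]
      _ = symplJ F := by rw [h2, hgi]; simp
  rw [h, Matrix.mul_smul, Matrix.smul_mul] at e
  have := congrArg (fun M => ((ν⁻¹ : Fˣ) : F) • M) e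
  simpa [smul_smul] using this

variable [ValuativeRel F]

theorem symplJ_mem_integer (i j) : symplJ F i j ∈ 𝒪[F] := by
  rcases i with i | i <;> rcases j with j | j <;> simp only [symplJ, Matrix.fromBlocks_apply₁₁,
    Matrix.fromBlocks_apply₁₂, Matrix.fromBlocks_apply₂₁, Matrix.fromBlocks_apply₂₂,
    Matrix.zero_apply, Matrix.neg_apply, Matrix.one_apply, zero_mem]
  · split_ifs
    · exact one_mem _
    · exact zero_mem _
  · split_ifs
    · exact neg_mem (one_mem _)
    · exact neg_mem (zero_mem _)

theorem mul_mem_integer {n m k : Type*} [Fintype m] {A : Matrix n m F} {B : Matrix m k F}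
    (hA : ∀ i j, A i j ∈ 𝒪[F]) (hB : ∀ i j, B i j ∈ 𝒪[F]) (i j) : (A * B) i j ∈ 𝒪[F] := by
  rw [Matrix.mul_apply]
  exact sum_mem fun l _ => mul_mem (hA _ _) (hB _ _)

/-- The similitude factor of an element of `GSp₄(𝔬)` is integral. -/
theorem similitude_mem_integer {g : GSp4 F} {ν : Fˣ} (hg : ∀ i j, g.1.1 i j ∈ 𝒪[F])
    (h : (g.1.1)ᵀ * symplJ F * g.1.1 = (ν : F) • symplJ F) : (ν : F) ∈ 𝒪[F] := by
  have e := congrFun (congrFun h (Sum.inl 0)) (Sum.inr 0)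
  have e' : ((ν : F) • symplJ F) (Sum.inl 0) (Sum.inr 0) = ν := by simp [symplJ]
  rw [e'] at e
  rw [← e]
  exact mul_mem_integer (mul_mem_integer (fun i j => hg j i) symplJ_mem_integer) hg _ _

/-- An integral element of `GSp₄(F)` whose similitude factor is a unit lies in `GSp₄(𝔬)`. -/
theorem mem_maxCompact_of_similitude {g : GSp4 F} {ν : Fˣ} (hg : ∀ i j, g.1.1 i j ∈ 𝒪[F])
    (h : (g.1.1)ᵀ * symplJ F * g.1.1 = (ν : F) • symplJ F) (hν : ((ν⁻¹ : Fˣ) : F) ∈ 𝒪[F]) :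
    g ∈ maxCompact F := by
  refine ⟨hg, fun i j => ?_⟩
  rw [GSp4.inv_coe_of_similitude g ν h, Matrix.smul_apply, smul_eq_mul]
  exact mul_mem hν (mul_mem_integer
    (mul_mem_integer (fun i j => neg_mem (symplJ_mem_integer i j)) (fun i j => hg j i))
    symplJ_mem_integer _ _)

/-- If `k ∈ P₁` and `h⁻¹ k h` is integral with lower left block in `𝔭`, then `h⁻¹ k h ∈ P₁`. -/
theorem conj_mem_siegelP1 {π : 𝒪[F]} (hπ : 𝓂[F] = Ideal.span {π}) {h k : GSp4 F}
    (hk : k ∈ siegelP1 F) {A B C D : Matrix (Fin 2) (Fin 2) 𝒪[F]}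
    (e : h.1.1 * Matrix.fromBlocks (A.map (algebraMap 𝒪[F] F)) (B.map (algebraMap 𝒪[F] F))
      ((π • C).map (algebraMap 𝒪[F] F)) (D.map (algebraMap 𝒪[F] F)) = k.1.1 * h.1.1) :
    h⁻¹ * k * h ∈ siegelP1 F := by
  have e' : (h⁻¹ * k * h).1.1 = Matrix.fromBlocks (A.map (algebraMap 𝒪[F] F))
      (B.map (algebraMap 𝒪[F] F)) ((π • C).map (algebraMap 𝒪[F] F))
      (D.map (algebraMap 𝒪[F] F)) := by
    rw [mul_assoc, GSp4.coe_mul, GSp4.coe_mul, ← e, ← Matrix.mul_assoc, ← GSp4.coe_mul,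
      inv_mul_cancel]
    exact Matrix.one_mul _
  obtain ⟨ρ, hρ⟩ := h.2
  obtain ⟨ν, hν⟩ := k.2
  have hν' : ((ν⁻¹ : Fˣ) : F) ∈ 𝒪[F] := similitude_mem_integer hk.1.2 (similitude_inv hν)
  have hs : ((h⁻¹ * k * h).1.1)ᵀ * symplJ F * (h⁻¹ * k * h).1.1 = (ν : F) • symplJ F := by
    simp only [GSp4.coe_mul, Matrix.transpose_mul]
    calc _ = (h.1.1)ᵀ * ((k.1.1)ᵀ * (((h⁻¹).1.1)ᵀ * symplJ F * (h⁻¹).1.1) * k.1.1) * h.1.1 := by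
          simp only [Matrix.mul_assoc]
      _ = _ := by
        rw [similitude_inv hρ, Matrix.mul_smul, Matrix.smul_mul, hν, smul_smul, Matrix.mul_smul,
          Matrix.smul_mul, hρ, smul_smul]
        congr 1
        rw [mul_right_comm]; simp
  refine ⟨mem_maxCompact_of_similitude ?_ hs hν', fun i j => ?_⟩
  · rw [e']
    rintro (i | i) (j | j) <;> simp only [Matrix.fromBlocks_apply₁₁,
      Matrix.fromBlocks_apply₁₂, Matrix.fromBlocks_apply₂₁, Matrix.fromBlocks_apply₂₂,
      Matrix.map_apply] <;> exact algebraMap_mem_integer _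
  · rw [e', Matrix.fromBlocks_apply₂₁, Matrix.map_apply, valuation_lt_one_iff hπ,
      Matrix.smul_apply, smul_eq_mul]
    exact dvd_mul_right _ _

theorem mem_siegelP1_of_blocks {π : 𝒪[F]} (hπ : 𝓂[F] = Ideal.span {π}) {g : GSp4 F} {ν : 𝒪[F]}
    (hν : IsUnit ν) {A B C D : Matrix (Fin 2) (Fin 2) 𝒪[F]}
    (e : g.1.1 = Matrix.fromBlocks (A.map (algebraMap 𝒪[F] F)) (B.map (algebraMap 𝒪[F] F))
      ((π • C).map (algebraMap 𝒪[F] F)) (D.map (algebraMap 𝒪[F] F)))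
    (h : (g.1.1)ᵀ * symplJ F * g.1.1 = algebraMap 𝒪[F] F ν • symplJ F) :
    g ∈ siegelP1 F := by
  obtain ⟨ν, rfl⟩ := hν
  refine ⟨mem_maxCompact_of_similitude (ν := Units.map (algebraMap 𝒪[F] F : 𝒪[F] →* F) ν) ?_ h
    (algebraMap_mem_integer _), fun i j => ?_⟩
  · rw [e]
    rintro (i | i) (j | j) <;> simp only [Matrix.fromBlocks_apply₁₁,
      Matrix.fromBlocks_apply₁₂, Matrix.fromBlocks_apply₂₁, Matrix.fromBlocks_apply₂₂,
      Matrix.map_apply] <;> exact algebraMap_mem_integer _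
  · rw [e, Matrix.fromBlocks_apply₂₁, Matrix.map_apply, valuation_lt_one_iff hπ,
      Matrix.smul_apply, smul_eq_mul]
    exact dvd_mul_right _ _

theorem exists_map_eq {M : Matrix (Fin 2) (Fin 2) F} (h : ∀ i j, M i j ∈ 𝒪[F]) :
    ∃ A : Matrix (Fin 2) (Fin 2) 𝒪[F], M = A.map (algebraMap 𝒪[F] F) :=
  ⟨fun i j => ⟨M i j, h i j⟩, rfl⟩

/-- The block form of an element of `P₁`. -/
theorem exists_blocks {π : 𝒪[F]} (hπ : 𝓂[F] = Ideal.span {π}) {k : GSp4 F}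
    (hk : k ∈ siegelP1 F) : ∃ (A B C D : Matrix (Fin 2) (Fin 2) 𝒪[F]) (ν : 𝒪[F]),
    IsUnit ν ∧ k.1.1 = Matrix.fromBlocks (A.map (algebraMap 𝒪[F] F)) (B.map (algebraMap 𝒪[F] F))
      ((π • C).map (algebraMap 𝒪[F] F)) (D.map (algebraMap 𝒪[F] F)) ∧
    Aᵀ * D - π • (Cᵀ * B) = ν • (1 : Matrix (Fin 2) (Fin 2) 𝒪[F]) ∧ Bᵀ * D = Dᵀ * B := by
  obtain ⟨A, hA⟩ := exists_map_eq (M := k.1.1.toBlocks₁₁) fun i j => hk.1.1 _ _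
  obtain ⟨B, hB⟩ := exists_map_eq (M := k.1.1.toBlocks₁₂) fun i j => hk.1.1 _ _
  obtain ⟨C', hC'⟩ := exists_map_eq (M := k.1.1.toBlocks₂₁) fun i j => hk.1.1 _ _
  obtain ⟨D, hD⟩ := exists_map_eq (M := k.1.1.toBlocks₂₂) fun i j => hk.1.1 _ _
  have hd : ∀ i j, π ∣ C' i j := fun i j => by
    rw [← valuation_lt_one_iff hπ]
    have := congrFun (congrFun hC' i) j
    rw [Matrix.map_apply] at this
    rw [← this]
    exact hk.2 i j
  choose C hC using hd
  obtain rfl : C' = π • (Matrix.of C) := by ext i j; simp [hC]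
  obtain ⟨ν, hν⟩ := k.2
  have hν1 := similitude_mem_integer hk.1.1 hν
  have hν2 := similitude_mem_integer hk.1.2 (similitude_inv hν)
  have e : k.1.1 = Matrix.fromBlocks (A.map (algebraMap 𝒪[F] F)) (B.map (algebraMap 𝒪[F] F))
      ((π • Matrix.of C).map (algebraMap 𝒪[F] F)) (D.map (algebraMap 𝒪[F] F)) := by
    rw [← hA, ← hB, ← hC', ← hD, Matrix.fromBlocks_toBlocks]
  refine ⟨A, B, Matrix.of C, D, ⟨ν, hν1⟩, ?_, e, ?_⟩
  · exact .of_mul_eq_one ⟨_, hν2⟩ (Subtype.ext (by simp))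
  rw [e] at hν
  simp only [symplJ, Matrix.fromBlocks_transpose, Matrix.fromBlocks_multiply,
    Matrix.fromBlocks_smul, Matrix.fromBlocks_inj] at hν
  obtain ⟨-, h12, -, h22⟩ := hν
  have hinj : Function.Injective fun M : Matrix (Fin 2) (Fin 2) 𝒪[F] => M.map (algebraMap 𝒪[F] F) :=
    Matrix.map_injective algebraMap_integer_injective
  constructor
  · apply hinj
    have : (ν : F) = algebraMap 𝒪[F] F ⟨ν, hν1⟩ := rfl
    rw [this] at h12
    ext i j
    have := congrFun (congrFun h12 i) j
    simp only [Matrix.add_apply, Matrix.mul_apply, Fin.sum_univ_two, Matrix.transpose_apply,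
      Matrix.map_apply, Matrix.smul_apply, Matrix.sub_apply, map_sub, map_add, map_mul,
      smul_eq_mul, Matrix.neg_apply, mul_zero, zero_add, add_zero, Matrix.of_apply] at this ⊢
    have o : ∀ i j : Fin 2, algebraMap 𝒪[F] F ((1 : Matrix (Fin 2) (Fin 2) 𝒪[F]) i j)
      = (1 : Matrix (Fin 2) (Fin 2) F) i j := fun i j => by
        rw [Matrix.one_apply, Matrix.one_apply]; split_ifs <;> simp
    rw [o, ← this]
    fin_cases i <;> fin_cases j <;> simp <;> ring
  · apply hinj
    ext i j
    have := congrFun (congrFun h22 i) j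
    simp only [Matrix.add_apply, Matrix.mul_apply, Fin.sum_univ_two, Matrix.transpose_apply,
      Matrix.map_apply, Matrix.smul_apply, map_add, map_mul,
      smul_eq_mul, Matrix.neg_apply, Matrix.zero_apply, mul_zero, zero_add, add_zero] at this ⊢
    fin_cases i <;> fin_cases j <;> simp at this ⊢ <;> linear_combination this

end Symplectic

/-! ### P₁ is compact and open; Hecke operators as finite sums -/

section Topology

theorem continuous_entry {F : Type*} [Field F] [TopologicalSpace F] (i j) :
    Continuous fun g : GSp4 F => g.1.1 i j :=
  have h : Continuous fun g : GSp4 F => g.1.1 := Units.continuous_val.comp continuous_subtype_val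
  h.matrix_elem i j

variable {F : Type*} [Field F] [ValuativeRel F] [TopologicalSpace F]
  [IsNonarchimedeanLocalField F]

theorem t2Space_of_isNonarchimedeanLocalField (F : Type*) [Field F] [ValuativeRel F]
    [TopologicalSpace F] [IsNonarchimedeanLocalField F] : T2Space F := by
  let := IsTopologicalAddGroup.rightUniformSpace F
  have := isUniformAddGroup_of_addCommGroup (G := F)
  infer_instance

theorem isOpen_integer : IsOpen (𝒪[F] : Set F) := by
  let := IsTopologicalAddGroup.rightUniformSpace F
  have := isUniformAddGroup_of_addCommGroup (G := F)
  exact Valued.isOpen_integer F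

theorem isCompact_integer : IsCompact (𝒪[F] : Set F) :=
  IsNonarchimedeanLocalField.isCompact_closedBall F 1

theorem isOpen_valuation_lt_one : IsOpen {x : F | ValuativeRel.valuation F x < 1} := by
  rw [isOpen_iff_mem_nhds]
  intro x hx
  have := (IsNonarchimedeanLocalField.toIsValuativeTopology (K := F)).mem_nhds_iff
    (s := {x : F | ValuativeRel.valuation F x < 1}) (x := x)
  rw [this]
  refine ⟨1, ?_⟩
  rintro _ ⟨y, hy, rfl⟩
  exact (Valuation.map_add _ _ _).trans_lt (max_lt hx (by simpa using hy))

theorem isOpen_siegelP1 : IsOpen (siegelP1 F : Set (GSp4 F)) := by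
  have : (siegelP1 F : Set (GSp4 F)) =
      ((⋂ i, ⋂ j, {g : GSp4 F | g.1.1 i j ∈ (𝒪[F] : Set F)}) ∩
        ⋂ i, ⋂ j, {g : GSp4 F | (g⁻¹).1.1 i j ∈ (𝒪[F] : Set F)}) ∩
      ⋂ i : Fin 2, ⋂ j : Fin 2, {g : GSp4 F | g.1.1 (Sum.inr i) (Sum.inl j) ∈
        {x : F | ValuativeRel.valuation F x < 1}} := by
    ext g
    simp only [Set.mem_inter_iff, Set.mem_iInter]
    rfl
  rw [this]
  refine .inter (.inter ?_ ?_) ?_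
  · exact isOpen_iInter_of_finite fun i => isOpen_iInter_of_finite fun j =>
      isOpen_integer.preimage (continuous_entry i j)
  · exact isOpen_iInter_of_finite fun i => isOpen_iInter_of_finite fun j =>
      isOpen_integer.preimage ((continuous_entry i j).comp continuous_inv)
  · exact isOpen_iInter_of_finite fun i => isOpen_iInter_of_finite fun j =>
      isOpen_valuation_lt_one.preimage (continuous_entry _ _)

/-- The similitude factor is an entry of ᵗgJg, so the existential condition is an equation between
continuous functions of g. The factor is automatically nonzero because ᵗgJg is invertible. -/
theorem isClosed_GSp4 : IsClosed (GSp4 F : Set (GL (Fin 2 ⊕ Fin 2) F)) := by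
  have := t2Space_of_isNonarchimedeanLocalField F
  have h : (GSp4 F : Set (GL (Fin 2 ⊕ Fin 2) F)) =
      {g | (g.1)ᵀ * symplJ F * g.1 =
        (((g.1)ᵀ * symplJ F * g.1) (Sum.inl 0) (Sum.inr 0)) • symplJ F} := by
    ext g
    constructor
    · rintro ⟨ν, h⟩
      simp only [Set.mem_ofPred_eq]
      rw [h]
      simp [symplJ]
    · intro h
      refine ⟨Units.mk0 (((g.1)ᵀ * symplJ F * g.1) (Sum.inl 0) (Sum.inr 0)) fun h0 => ?_, h⟩
      simp only [Set.mem_ofPred_eq] at h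
      rw [h0, zero_smul] at h
      have hd := congrArg Matrix.det h
      have hJ : (symplJ F).det ≠ 0 := by
        intro h1
        have := congrArg Matrix.det (symplJ_mul_symplJ (F := F))
        rw [Matrix.det_mul, h1, Matrix.det_neg] at this
        norm_num at this
      rw [Matrix.det_mul, Matrix.det_mul, Matrix.det_transpose, Matrix.det_zero] at hd
      have hg : g.1.det ≠ 0 := (Matrix.isUnit_iff_isUnit_det _).1 g.isUnit |>.ne_zero
      exact mul_ne_zero (mul_ne_zero hg hJ) hg hd
  rw [h]
  have hc : Continuous fun g : GL (Fin 2 ⊕ Fin 2) F => (g.1)ᵀ * symplJ F * g.1 :=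
    ((Units.continuous_val.matrix_transpose).mul continuous_const).mul Units.continuous_val
  exact isClosed_eq hc (((continuous_apply_apply _ _).comp hc).smul continuous_const)

/-- Under the closed embedding g ↦ (g, g⁻¹), P₁ lands in a product of compact sets of integral
matrices, and an open subgroup is closed. This makes vol(P₁) finite, so that dividing by it is
harmless. -/
theorem isCompact_siegelP1 : IsCompact (siegelP1 F : Set (GSp4 F)) := by
  have := t2Space_of_isNonarchimedeanLocalField F
  have h1 : Topology.IsClosedEmbedding
      (Units.embedProduct (Matrix (Fin 2 ⊕ Fin 2) (Fin 2 ⊕ Fin 2) F)) :=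
    Units.isClosedEmbedding_embedProduct
  have h2 : Topology.IsClosedEmbedding fun g : GSp4 F => Units.embedProduct _ g.1 :=
    h1.comp isClosed_GSp4.isClosedEmbedding_subtypeVal
  have hM : IsCompact {A : Matrix (Fin 2 ⊕ Fin 2) (Fin 2 ⊕ Fin 2) F |
      ∀ i, A i ∈ {v : Fin 2 ⊕ Fin 2 → F | ∀ j, v j ∈ (𝒪[F] : Set F)}} :=
    isCompact_pi_infinite fun _ => isCompact_pi_infinite fun _ => isCompact_integer
  have hc := h2.isCompact_preimage
    (hM.prod (hM.image MulOpposite.continuous_op))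
  refine hc.of_isClosed_subset ((siegelP1 F).isClosed_of_isOpen isOpen_siegelP1) ?_
  rintro g ⟨⟨hg, hg'⟩, -⟩
  exact ⟨fun i j => hg i j, ⟨(g⁻¹).1.1, fun i j => hg' i j, rfl⟩⟩

variable [MeasurableSpace (GSp4 F)] [BorelSpace (GSp4 F)]

/-- The Hecke operator of `P₁ h P₁`, expressed by representatives `κ i` of `P₁/(P₁ ∩ h P₁ h⁻¹)`. -/
theorem hecke_eq_sum (ν : Measure (GSp4 F)) [ν.IsHaarMeasure] {ι : Type*} [Fintype ι]
    (h : GSp4 F) (κ : ι → GSp4 F) (hκ : ∀ i, κ i ∈ siegelP1 F)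
    (hsurj : ∀ k ∈ siegelP1 F, ∃ i, h⁻¹ * ((κ i)⁻¹ * k) * h ∈ siegelP1 F)
    (hinj : ∀ i j, h⁻¹ * ((κ i)⁻¹ * κ j) * h ∈ siegelP1 F → i = j)
    (B : GSp4 F → ℂ) (hB : ∀ g : GSp4 F, ∀ p ∈ siegelP1 F, B (g * p) = B g) (g : GSp4 F) :
    hecke ν h B g = ∑ i, B (g * κ i * h) := by
  -- `U i` is the coset κᵢhP₁. The cosets partition P₁hP₁, each has the volume of P₁ by left
  -- invariance, and x ↦ B(gx) is constant on each.
  let U : ι → Set (GSp4 F) := fun i => (fun x => (κ i * h)⁻¹ * x) ⁻¹' (siegelP1 F : Set (GSp4 F))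
  have hUmem : ∀ i x, x ∈ U i ↔ (κ i * h)⁻¹ * x ∈ siegelP1 F := fun i x => Iff.rfl
  have hU : DoubleCoset.doubleCoset h (siegelP1 F : Set (GSp4 F)) (siegelP1 F : Set (GSp4 F))
      = ⋃ i, U i := by
    ext x
    rw [DoubleCoset.mem_doubleCoset, Set.mem_iUnion]
    constructor
    · rintro ⟨k, hk, p, hp, rfl⟩
      obtain ⟨i, hi⟩ := hsurj k hk
      refine ⟨i, ?_⟩
      rw [hUmem]
      have := mul_mem hi hp
      convert this using 1
      group
    · rintro ⟨i, hi⟩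
      exact ⟨κ i, hκ i, _, hi, by group⟩
  have hdisj : Pairwise (Function.onFun Disjoint U) := by
    intro i j hij
    rw [Function.onFun, Set.disjoint_left]
    intro x hxi hxj
    apply hij
    apply hinj
    have := mul_mem ((hUmem _ _).1 hxi) (inv_mem ((hUmem _ _).1 hxj))
    convert this using 1
    group
  have hmeas : ∀ i, MeasurableSet (U i) := fun i =>
    (isOpen_siegelP1.preimage (continuous_const.mul continuous_id)).measurableSet
  have hvol : ∀ i, ν (U i) = ν (siegelP1 F : Set (GSp4 F)) := fun i =>
    measure_preimage_mul ν _ _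
  have hfin : ν (siegelP1 F : Set (GSp4 F)) ≠ ⊤ := isCompact_siegelP1.measure_lt_top.ne
  have hpos : ν (siegelP1 F : Set (GSp4 F)) ≠ 0 :=
    (isOpen_siegelP1.measure_pos ν ⟨1, one_mem _⟩).ne'
  have hconst : ∀ i, Set.EqOn (fun x => B (g * x)) (fun _ => B (g * κ i * h)) (U i) := by
    intro i x hx
    have := hB (g * κ i * h) _ hx
    simp only
    rw [← this]
    congr 1
    group
  have hint : ∀ i, IntegrableOn (fun x => B (g * x)) (U i) ν := fun i =>
    (integrableOn_const (by rw [hvol]; exact hfin)).congr_fun (hconst i).symm (hmeas i)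
  rw [hecke, hU, integral_iUnion_fintype hmeas hdisj hint]
  have : ∀ i, ∫ x in U i, B (g * x) ∂ν =
      ((ν.real (siegelP1 F : Set (GSp4 F)) : ℝ) : ℂ) * B (g * κ i * h) := fun i => by
    rw [setIntegral_congr_fun (hmeas i) (hconst i), setIntegral_const, Measure.real, hvol]
    simp [Measure.real]
  rw [Finset.sum_congr rfl fun i _ => this i, ← Finset.mul_sum, ← mul_assoc, inv_mul_cancel₀,
    one_mul]
  simpa [Measure.real, ENNReal.toReal_eq_zero_iff] using ⟨hpos, hfin⟩

end Topology

/-! ### Coset representatives for the double cosets of h(1,0) and h(0,1) -/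

section Cosets

variable {F : Type*} [Field F] [ValuativeRel F]

/-- Modulo π the relation reads ᵗA D = ν, hence det A · det D ≡ ν² is a unit. The witness in the
proof comes from expanding det(ν + πE). -/
theorem det_isUnit_of_mul_sub {π : 𝒪[F]} (hπ : 𝓂[F] = Ideal.span {π})
    {A D E : Matrix (Fin 2) (Fin 2) 𝒪[F]} {ν : 𝒪[F]} (hν : IsUnit ν)
    (h : Aᵀ * D - π • E = ν • (1 : Matrix (Fin 2) (Fin 2) 𝒪[F])) :
    IsUnit A.det ∧ IsUnit D.det := by
  have h00 := congrFun (congrFun h 0) 0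
  have h01 := congrFun (congrFun h 0) 1
  have h10 := congrFun (congrFun h 1) 0
  have h11 := congrFun (congrFun h 1) 1
  simp [Matrix.mul_apply, Fin.sum_univ_two] at h00 h01 h10 h11
  rw [← IsUnit.mul_iff, Matrix.det_fin_two, Matrix.det_fin_two]
  have hu := isUnit_add_of_dvd hπ (hν.pow 2) (y := (A 0 0 * A 1 1 - A 0 1 * A 1 0) *
    (D 0 0 * D 1 1 - D 0 1 * D 1 0) - ν ^ 2)
    ⟨ν * (E 0 0 + E 1 1) + π * (E 0 0 * E 1 1 - E 0 1 * E 1 0), by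
      linear_combination (A 0 1 * D 0 1 + A 1 1 * D 1 1) * h00 + (ν + π * E 0 0) * h11
        - (A 0 1 * D 0 0 + A 1 1 * D 1 0) * h01 - (π * E 0 1) * h10⟩
  rwa [add_sub_cancel] at hu

/-- The matrix `[x, y; y, z]` over `𝔬`. -/
noncomputable def symO (x y z : 𝒪[F]) : Matrix (Fin 2) (Fin 2) 𝒪[F] := !![x, y; y, z]

theorem symO_map_isSymm (x y z : 𝒪[F]) : ((symO x y z).map (algebraMap 𝒪[F] F)).IsSymm := by
  ext i j
  fin_cases i <;> fin_cases j <;> simp [symO]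

/-- The element `[1, X; 0, 1]` with `X = [x, y; y, z]` over `𝔬`. -/
noncomputable def unipO (x y z : 𝒪[F]) : GSp4 F :=
  unip ((symO x y z).map (algebraMap 𝒪[F] F)) (symO_map_isSymm x y z)

theorem unipO_mul (x y z x' y' z' : 𝒪[F]) :
    unipO x y z * unipO x' y' z' = unipO (x + x') (y + y') (z + z') := by
  apply GSp4.ext_matrix
  rw [unipO, unipO, unip_mul, unipO, unip_coe, unip_coe]
  congr 1
  ext i j
  fin_cases i <;> fin_cases j <;> simp [symO]

theorem unipO_zero : unipO (0 : 𝒪[F]) 0 0 = 1 := by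
  rw [← unip_zero]
  apply GSp4.ext_matrix
  rw [unipO, unip_coe, unip_coe]
  congr 1
  ext i j
  fin_cases i <;> fin_cases j <;> simp [symO]

theorem unipO_inv (x y z : 𝒪[F]) : (unipO x y z)⁻¹ = unipO (-x) (-y) (-z) := by
  rw [inv_eq_iff_mul_eq_one, unipO_mul]
  simp [unipO_zero]

theorem unipO_mem {π : 𝒪[F]} (hπ : 𝓂[F] = Ideal.span {π}) (x y z : 𝒪[F]) :
    unipO x y z ∈ siegelP1 F := by
  refine mem_siegelP1_of_blocks hπ (ν := 1) isUnit_one (A := 1) (B := symO x y z) (C := 0) (D := 1)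
    ?_ ?_
  · simp [unipO, Matrix.map_one]
  · simp [unipO, symplJ, Matrix.fromBlocks_transpose, Matrix.fromBlocks_multiply,
      (symO_map_isSymm x y z).eq]

theorem levi_map_mem {π : 𝒪[F]} (hπ : 𝓂[F] = Ideal.span {π}) (k : GL (Fin 2) 𝒪[F]) :
    levi (Matrix.GeneralLinearGroup.map (algebraMap 𝒪[F] F) k) ∈ siegelP1 F := by
  have hd : ((Matrix.GeneralLinearGroup.map (algebraMap 𝒪[F] F) k).1).det =
      algebraMap 𝒪[F] F k.1.det := ((algebraMap 𝒪[F] F).map_det _).symm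
  refine mem_siegelP1_of_blocks hπ (ν := k.1.det) ((Matrix.isUnit_iff_isUnit_det _).1 k.isUnit)
    (A := k.1) (B := 0) (C := 0) (D := k.1.det • ((k⁻¹).1)ᵀ) ?_ ?_
  · rw [levi_coe, hd]
    congr 1
    ext i j
    simp
  · rw [← hd]
    have := (levi (Matrix.GeneralLinearGroup.map (algebraMap 𝒪[F] F) k)).2
    have h1 : (((Matrix.GeneralLinearGroup.map (algebraMap 𝒪[F] F) k)).1)ᵀ *
        ((((Matrix.GeneralLinearGroup.map (algebraMap 𝒪[F] F) k))⁻¹).1)ᵀ = 1 := by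
      rw [← Matrix.transpose_mul, ← Units.val_mul]; simp
    have h2 : ((Matrix.GeneralLinearGroup.map (algebraMap 𝒪[F] F) k)⁻¹).1 *
        (Matrix.GeneralLinearGroup.map (algebraMap 𝒪[F] F) k).1 = 1 := by
      rw [← Units.val_mul]; simp
    rw [levi_coe]
    simp only [symplJ, Matrix.fromBlocks_transpose, Matrix.fromBlocks_multiply,
      Matrix.fromBlocks_smul]
    simp only [Matrix.transpose_smul, Matrix.transpose_transpose, Matrix.mul_zero,
      Matrix.zero_mul, Matrix.mul_one, Matrix.mul_neg, Matrix.neg_mul, Matrix.mul_smul,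
      Matrix.smul_mul, Matrix.transpose_zero, add_zero, zero_add, smul_zero, h1, h2, neg_zero,
      smul_neg]

theorem levi_map_inv (k : GL (Fin 2) 𝒪[F]) :
    (levi (Matrix.GeneralLinearGroup.map (algebraMap 𝒪[F] F) k))⁻¹ =
      levi (Matrix.GeneralLinearGroup.map (algebraMap 𝒪[F] F) k⁻¹) := by
  rw [inv_eq_iff_mul_eq_one, ← levi_mul, ← map_mul, mul_inv_cancel, map_one, levi_one]

/-- For `k = [A, B; C, D] ∈ P₁`, the matrix `B D⁻¹` is integral and symmetric. -/
theorem exists_symO_mul {π : 𝒪[F]} (hπ : 𝓂[F] = Ideal.span {π})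
    {A B C D : Matrix (Fin 2) (Fin 2) 𝒪[F]} {ν : 𝒪[F]} (hν : IsUnit ν)
    (h : Aᵀ * D - π • (Cᵀ * B) = ν • (1 : Matrix (Fin 2) (Fin 2) 𝒪[F])) (h' : Bᵀ * D = Dᵀ * B) :
    ∃ x y z : 𝒪[F], B = symO x y z * D := by
  have hD : IsUnit D.det := (det_isUnit_of_mul_sub hπ hν h).2
  have hs : (B * D⁻¹)ᵀ = B * D⁻¹ := by
    have hD' : IsUnit (Dᵀ).det := by rwa [Matrix.det_transpose]
    rw [Matrix.transpose_mul, Matrix.transpose_nonsing_inv]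
    calc (Dᵀ)⁻¹ * Bᵀ = (Dᵀ)⁻¹ * Bᵀ * (D * D⁻¹) := by
          rw [Matrix.mul_nonsing_inv _ hD, Matrix.mul_one]
      _ = (Dᵀ)⁻¹ * (Bᵀ * D) * D⁻¹ := by simp only [Matrix.mul_assoc]
      _ = ((Dᵀ)⁻¹ * Dᵀ) * (B * D⁻¹) := by rw [h']; simp only [Matrix.mul_assoc]
      _ = _ := by rw [Matrix.nonsing_inv_mul _ hD', Matrix.one_mul]
  refine ⟨(B * D⁻¹) 0 0, (B * D⁻¹) 0 1, (B * D⁻¹) 1 1, ?_⟩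
  have : symO ((B * D⁻¹) 0 0) ((B * D⁻¹) 0 1) ((B * D⁻¹) 1 1) = B * D⁻¹ := by
    ext i j
    fin_cases i <;> fin_cases j <;> simp [symO]
    exact congrFun (congrFun hs 1) 0
  rw [this, Matrix.mul_assoc, Matrix.nonsing_inv_mul _ hD, Matrix.mul_one]

/-- Left multiplication of a block matrix by `[1, X; 0, 1]`. -/
theorem unipO_mul_coe {π : 𝒪[F]} {k : GSp4 F} {A B C D : Matrix (Fin 2) (Fin 2) 𝒪[F]}
    (e : k.1.1 = Matrix.fromBlocks (A.map (algebraMap 𝒪[F] F)) (B.map (algebraMap 𝒪[F] F))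
      ((π • C).map (algebraMap 𝒪[F] F)) (D.map (algebraMap 𝒪[F] F))) (x y z : 𝒪[F]) :
    (unipO x y z * k).1.1 = Matrix.fromBlocks
      ((A + π • (symO x y z * C)).map (algebraMap 𝒪[F] F))
      ((B + symO x y z * D).map (algebraMap 𝒪[F] F))
      ((π • C).map (algebraMap 𝒪[F] F)) (D.map (algebraMap 𝒪[F] F)) := by
  rw [GSp4.coe_mul, e, unipO, unip_coe, Matrix.fromBlocks_multiply]
  congr 1
  · ext i j
    simp [Matrix.mul_apply, Fin.sum_univ_two]; ring
  · ext i j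
    simp [Matrix.mul_apply, Fin.sum_univ_two]
  · simp
  · simp

theorem symO_add (x y z x' y' z' : 𝒪[F]) :
    symO x y z + symO x' y' z' = symO (x + x') (y + y') (z + z') := by
  ext i j
  fin_cases i <;> fin_cases j <;> simp [symO]

/-- Conjugation divides the upper right block by ϖ and multiplies the lower left one by ϖ, so only B
can obstruct integrality. -/
theorem hElt_conj_mem_one_zero {π : 𝒪[F]} (hπ : 𝓂[F] = Ideal.span {π}) {ϖ : Fˣ}
    (hϖ : algebraMap 𝒪[F] F π = ϖ) {k : GSp4 F} (hk : k ∈ siegelP1 F)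
    {A B C D : Matrix (Fin 2) (Fin 2) 𝒪[F]}
    (e : k.1.1 = Matrix.fromBlocks (A.map (algebraMap 𝒪[F] F)) (B.map (algebraMap 𝒪[F] F))
      ((π • C).map (algebraMap 𝒪[F] F)) (D.map (algebraMap 𝒪[F] F)))
    (hB : ∀ i j, π ∣ B i j) : (hElt ϖ 1 0)⁻¹ * k * hElt ϖ 1 0 ∈ siegelP1 F := by
  choose B' hB' using hB
  refine conj_mem_siegelP1 hπ hk (A := A) (B := Matrix.of B') (C := π • C) (D := D) ?_
  rw [e, hElt_coe, Matrix.fromBlocks_multiply, Matrix.fromBlocks_multiply]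
  congr 1 <;> ext i j <;> fin_cases i <;> fin_cases j <;>
    simp [Matrix.mul_apply, Fin.sum_univ_two, hB', ← hϖ] <;> ring

/-- With e = (2,1,0,1) the exponents of h(0,1), conjugation multiplies the (i,j) entry by ϖ^(eⱼ-eᵢ).
The five divisibility hypotheses cover exactly the entries with negative exponent. -/
theorem hElt_conj_mem_zero_one {π : 𝒪[F]} (hπ : 𝓂[F] = Ideal.span {π}) {ϖ : Fˣ}
    (hϖ : algebraMap 𝒪[F] F π = ϖ) {k : GSp4 F} (hk : k ∈ siegelP1 F)
    {A B C D : Matrix (Fin 2) (Fin 2) 𝒪[F]}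
    (e : k.1.1 = Matrix.fromBlocks (A.map (algebraMap 𝒪[F] F)) (B.map (algebraMap 𝒪[F] F))
      ((π • C).map (algebraMap 𝒪[F] F)) (D.map (algebraMap 𝒪[F] F)))
    (hA : π ∣ A 0 1) (hB00 : π ^ 2 ∣ B 0 0) (hB01 : π ∣ B 0 1) (hB10 : π ∣ B 1 0)
    (hD : π ∣ D 1 0) : (hElt ϖ 0 1)⁻¹ * k * hElt ϖ 0 1 ∈ siegelP1 F := by
  obtain ⟨a, ha⟩ := hA
  obtain ⟨b, hb⟩ := hB00
  obtain ⟨b', hb'⟩ := hB01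
  obtain ⟨b'', hb''⟩ := hB10
  obtain ⟨d, hd⟩ := hD
  refine conj_mem_siegelP1 hπ hk (A := !![A 0 0, a; π * A 1 0, A 1 1])
    (B := !![b, b'; b'', B 1 1])
    (C := !![π ^ 2 * C 0 0, π * C 0 1; π * C 1 0, C 1 1])
    (D := !![D 0 0, π * D 0 1; d, D 1 1]) ?_
  rw [e, hElt_coe, Matrix.fromBlocks_multiply, Matrix.fromBlocks_multiply]
  congr 1 <;> ext i j <;> fin_cases i <;> fin_cases j <;>
    simp [Matrix.mul_apply, Fin.sum_univ_two, ha, hb, hb', hb'', hd, ← hϖ, zpow_ofNat] <;> ring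

/-- The converse direction: it yields the divisibilities that show the chosen representatives to be
pairwise inequivalent. -/
theorem entry_of_hElt_conj_mem {ϖ : Fˣ} {l m : ℤ} {k : GSp4 F}
    (h : (hElt ϖ l m)⁻¹ * k * hElt ϖ l m ∈ siegelP1 F) :
    ∃ A B : Matrix (Fin 2) (Fin 2) 𝒪[F], ∀ i j,
      k.1.1 (Sum.inl i) (Sum.inl j) * ![(ϖ : F) ^ (l + 2 * m), (ϖ : F) ^ (l + m)] j =
        ![(ϖ : F) ^ (l + 2 * m), (ϖ : F) ^ (l + m)] i * algebraMap 𝒪[F] F (A i j) ∧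
      k.1.1 (Sum.inl i) (Sum.inr j) * ![1, (ϖ : F) ^ m] j =
        ![(ϖ : F) ^ (l + 2 * m), (ϖ : F) ^ (l + m)] i * algebraMap 𝒪[F] F (B i j) := by
  set u := (hElt ϖ l m)⁻¹ * k * hElt ϖ l m with hu
  have e : k * hElt ϖ l m = hElt ϖ l m * u := by rw [hu]; group
  refine ⟨fun i j => ⟨_, h.1.1 (Sum.inl i) (Sum.inl j)⟩,
    fun i j => ⟨_, h.1.1 (Sum.inl i) (Sum.inr j)⟩, fun i j => ?_⟩
  have e1 : k.1.1 * (hElt ϖ l m).1.1 = (hElt ϖ l m).1.1 * u.1.1 :=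
    congrArg (fun g : GSp4 F => g.1.1) e
  rw [hElt_coe, Matrix.fromBlocks_diagonal] at e1
  have hl := congrFun (congrFun e1 (Sum.inl i)) (Sum.inl j)
  have hr := congrFun (congrFun e1 (Sum.inl i)) (Sum.inr j)
  rw [Matrix.mul_diagonal, Matrix.diagonal_mul] at hl hr
  exact ⟨hl, hr⟩

theorem dvd_of_entry_eq {π : 𝒪[F]} {x y : 𝒪[F]} {n : ℕ}
    (h : algebraMap 𝒪[F] F x = algebraMap 𝒪[F] F π ^ n * algebraMap 𝒪[F] F y) : π ^ n ∣ x :=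
  ⟨y, algebraMap_integer_injective (by rw [h, map_mul, map_pow])⟩

/-- Representatives of `GL₂(𝔬)` modulo the matrices that are lower triangular mod `𝔭`; they
correspond to the lines in `(𝔬/𝔭)²`. -/
noncomputable def lineRep (c : 𝒪[F]ˣ) : Option 𝓀[F] → GL (Fin 2) 𝒪[F]
  | none => 1
  | some r =>
    { val := !![0, (c : 𝒪[F]); 1, residueLift r]
      inv := !![-residueLift r * ((c⁻¹ : 𝒪[F]ˣ) : 𝒪[F]), 1; ((c⁻¹ : 𝒪[F]ˣ) : 𝒪[F]), 0]
      val_inv := by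
        rw [Matrix.mul_fin_two, Matrix.one_fin_two]
        simp
      inv_val := by
        rw [Matrix.mul_fin_two, Matrix.one_fin_two]
        simp [mul_assoc] }

/-- The line is the one containing the second column of M modulo 𝔭: `none` stands for the line of
(0,1) and `some r` for that of (c,r). With c the entry of S, the vector (c,r) can be compared
directly with the second column (yc,x) of the matrix of x + yω. -/
theorem exists_lineRep {π : 𝒪[F]} (hπ : 𝓂[F] = Ideal.span {π}) (c : 𝒪[F]ˣ)
    (M : Matrix (Fin 2) (Fin 2) 𝒪[F]) :
    ∃ i, π ∣ (((lineRep c i)⁻¹).1 * M) 0 1 := by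
  by_cases h : IsUnit (M 0 1)
  · obtain ⟨u, hu⟩ := h
    -- Proportionality of (M₀₁, M₁₁) and (c, r) modulo 𝔭 forces r ≡ M₁₁c/M₀₁.
    obtain ⟨r, hr⟩ := exists_dvd_sub_residueLift hπ (M 1 1 * c * (u⁻¹ : 𝒪[F]ˣ))
    refine ⟨some r, ?_⟩
    have e : (((lineRep c (some r))⁻¹).1 * M) 0 1 =
        (M 1 1 * c * (u⁻¹ : 𝒪[F]ˣ) - residueLift r) * ((c⁻¹ : 𝒪[F]ˣ) * u) := by
      have : ((lineRep c (some r))⁻¹).1 =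
        !![-residueLift r * ((c⁻¹ : 𝒪[F]ˣ) : 𝒪[F]), 1; ((c⁻¹ : 𝒪[F]ˣ) : 𝒪[F]), 0] := rfl
      rw [this, Matrix.mul_apply, Fin.sum_univ_two, ← hu]
      have h1 : (c : 𝒪[F]) * ((c⁻¹ : 𝒪[F]ˣ) : 𝒪[F]) = 1 := c.mul_inv
      have h2 : (u : 𝒪[F]) * ((u⁻¹ : 𝒪[F]ˣ) : 𝒪[F]) = 1 := u.mul_inv
      simp only [Matrix.of_apply, Matrix.cons_val', Matrix.cons_val_zero, Matrix.cons_val_one,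
        Matrix.cons_val_fin_one]
      linear_combination (-M 1 1) * h1 - (M 1 1 * c * ((c⁻¹ : 𝒪[F]ˣ) : 𝒪[F])) * h2
    rw [e]
    exact hr.mul_right _
  · refine ⟨none, ?_⟩
    rw [not_isUnit_iff_dvd hπ] at h
    simpa [lineRep] using h

theorem lineRep_injective_mod {π : 𝒪[F]} (hπ : 𝓂[F] = Ideal.span {π}) (c : 𝒪[F]ˣ)
    {i j : Option 𝓀[F]} (h : π ∣ ((lineRep c i)⁻¹ * lineRep c j).1 0 1) : i = j := by
  have hi : ∀ r, ((lineRep c (some r))⁻¹).1 =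
    !![-residueLift r * ((c⁻¹ : 𝒪[F]ˣ) : 𝒪[F]), 1; ((c⁻¹ : 𝒪[F]ˣ) : 𝒪[F]), 0] := fun r => rfl
  have hs : ∀ r, (lineRep c (some r)).1 = !![0, (c : 𝒪[F]); 1, residueLift r] := fun r => rfl
  have h0 : lineRep c none = 1 := rfl
  rcases i with _ | r <;> rcases j with _ | s
  · rfl
  · rw [h0, inv_one, one_mul, hs] at h
    exact absurd c.isUnit ((not_isUnit_iff_dvd hπ).2 (by simpa using h))
  · rw [h0, mul_one, hi] at h
    exact absurd isUnit_one ((not_isUnit_iff_dvd hπ).2 (by simpa using h))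
  · rw [Units.val_mul, hs, hi, Matrix.mul_fin_two] at h
    simp [mul_assoc] at h
    rw [residueLift_injective_mod hπ (r := s) (s := r)]
    convert h using 1
    ring

variable [TopologicalSpace F] [IsNonarchimedeanLocalField F]
  [MeasurableSpace (GSp4 F)] [BorelSpace (GSp4 F)]

/-- Writing the upper right block of k ∈ P₁ as XD with X symmetric, the coset of k depends only on X
modulo 𝔭. -/
theorem hecke_one_zero {π : 𝒪[F]} (hπ : 𝓂[F] = Ideal.span {π}) {ϖ : Fˣ}
    (hϖ : algebraMap 𝒪[F] F π = ϖ) (ν : Measure (GSp4 F)) [ν.IsHaarMeasure] [Fintype 𝓀[F]]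
    (B : GSp4 F → ℂ) (hB : ∀ g : GSp4 F, ∀ p ∈ siegelP1 F, B (g * p) = B g) (g : GSp4 F) :
    hecke ν (hElt ϖ 1 0) B g = ∑ r : 𝓀[F] × 𝓀[F] × 𝓀[F],
      B (g * unipO (residueLift r.1) (residueLift r.2.1) (residueLift r.2.2) * hElt ϖ 1 0) := by
  refine hecke_eq_sum ν _ (fun r : 𝓀[F] × 𝓀[F] × 𝓀[F] =>
    unipO (residueLift r.1) (residueLift r.2.1) (residueLift r.2.2))
    (fun r => unipO_mem hπ _ _ _) ?_ ?_ B hB g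
  · intro k hk
    obtain ⟨A, B, C, D, ν, hν, e, h1, h2⟩ := exists_blocks hπ hk
    obtain ⟨x, y, z, rfl⟩ := exists_symO_mul hπ hν h1 h2
    obtain ⟨r, hr⟩ := exists_dvd_sub_residueLift hπ x
    obtain ⟨s, hs⟩ := exists_dvd_sub_residueLift hπ y
    obtain ⟨t, ht⟩ := exists_dvd_sub_residueLift hπ z
    refine ⟨(r, s, t), ?_⟩
    rw [unipO_inv]
    refine hElt_conj_mem_one_zero hπ hϖ (mul_mem (unipO_mem hπ _ _ _) hk)
      (unipO_mul_coe e _ _ _) ?_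
    rw [← Matrix.add_mul, symO_add]
    simp only [← sub_eq_add_neg]
    intro i j
    rw [Matrix.mul_apply, Fin.sum_univ_two]
    fin_cases i
    · exact dvd_add (hr.mul_right _) (hs.mul_right _)
    · exact dvd_add (hs.mul_right _) (ht.mul_right _)
  · rintro ⟨r, s, t⟩ ⟨r', s', t'⟩ h
    rw [unipO_inv, unipO_mul] at h
    obtain ⟨_, M, hM⟩ := entry_of_hElt_conj_mem h
    have h00 := (hM 0 0).2
    have h01 := (hM 0 1).2
    have h11 := (hM 1 1).2
    simp [unipO, symO, ← hϖ] at h00 h01 h11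
    have e1 : r' = r := residueLift_injective_mod hπ (by
      simpa using dvd_of_entry_eq (π := π) (n := 1) (x := residueLift r' - residueLift r)
        (y := M 0 0) (by rw [map_sub, sub_eq_neg_add]; simpa using h00))
    have e2 : s' = s := residueLift_injective_mod hπ (by
      simpa using dvd_of_entry_eq (π := π) (n := 1) (x := residueLift s' - residueLift s)
        (y := M 0 1) (by rw [map_sub, sub_eq_neg_add]; simpa using h01))
    have e3 : t' = t := residueLift_injective_mod hπ (by
      simpa using dvd_of_entry_eq (π := π) (n := 1) (x := residueLift t' - residueLift t)
        (y := M 1 1) (by rw [map_sub, sub_eq_neg_add]; simpa using h11))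
    rw [e1, e2, e3]

/-- A Levi element first moves the line of the A-block into standard position. Of the remaining X =
[x, y; y, z] only x modulo 𝔭² and y modulo 𝔭 matter, which gives the digits x = r + πs and y = t. -/
theorem hecke_zero_one {π : 𝒪[F]} (hπ : 𝓂[F] = Ideal.span {π}) {ϖ : Fˣ}
    (hϖ : algebraMap 𝒪[F] F π = ϖ) (ν : Measure (GSp4 F)) [ν.IsHaarMeasure] [Fintype 𝓀[F]]
    (B : GSp4 F → ℂ) (hB : ∀ g : GSp4 F, ∀ p ∈ siegelP1 F, B (g * p) = B g) (c : 𝒪[F]ˣ)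
    (g : GSp4 F) :
    hecke ν (hElt ϖ 0 1) B g = ∑ r : Option 𝓀[F] × 𝓀[F] × 𝓀[F] × 𝓀[F],
      B (g * (levi (Matrix.GeneralLinearGroup.map (algebraMap 𝒪[F] F) (lineRep c r.1)) *
        unipO (residueLift r.2.1 + π * residueLift r.2.2.1) (residueLift r.2.2.2) 0)
          * hElt ϖ 0 1) := by
  refine hecke_eq_sum ν _ (fun r : Option 𝓀[F] × 𝓀[F] × 𝓀[F] × 𝓀[F] =>
    levi (Matrix.GeneralLinearGroup.map (algebraMap 𝒪[F] F) (lineRep c r.1)) *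
        unipO (residueLift r.2.1 + π * residueLift r.2.2.1) (residueLift r.2.2.2) 0)
    (fun r => mul_mem (levi_map_mem hπ _) (unipO_mem hπ _ _ _)) ?_ ?_ B hB g
  · intro k hk
    obtain ⟨A₀, B₀, C₀, D₀, ν₀, -, e₀, -, -⟩ := exists_blocks hπ hk
    obtain ⟨i, hi⟩ := exists_lineRep hπ c A₀
    have hu := mul_mem (levi_map_mem hπ (lineRep c i)⁻¹) hk
    obtain ⟨A, B, C, D, ν, hν, e, h1, h2⟩ := exists_blocks hπ hu
    have hA : A = ((lineRep c i)⁻¹).1 * A₀ := by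
      rw [GSp4.coe_mul, e₀, levi_coe, Matrix.fromBlocks_multiply, Matrix.fromBlocks_inj] at e
      apply Matrix.map_injective algebraMap_integer_injective
      change A.map (algebraMap 𝒪[F] F) = (((lineRep c i)⁻¹).1 * A₀).map (algebraMap 𝒪[F] F)
      rw [← e.1, Matrix.map_mul, Matrix.zero_mul, add_zero]
      rfl
    have hA01 : π ∣ A 0 1 := by rwa [hA]
    -- Modulo 𝔭, ᵗA D is scalar and A is lower triangular and invertible, so D is upper triangular.
    have hD10 : π ∣ D 1 0 := by
      have hd := (det_isUnit_of_mul_sub hπ hν h1).1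
      have hA11 : IsUnit (A 1 1) := by
        by_contra h11
        rw [not_isUnit_iff_dvd hπ] at h11
        refine (not_isUnit_iff_dvd hπ).2 ?_ hd
        rw [Matrix.det_fin_two]
        exact dvd_sub (h11.mul_left _) (hA01.mul_right _)
      have h10 := congrFun (congrFun h1 1) 0
      simp [Matrix.mul_apply, Fin.sum_univ_two] at h10
      have : π ∣ A 1 1 * D 1 0 := by
        have : A 1 1 * D 1 0 = π * (C 0 1 * B 0 0 + C 1 1 * B 1 0) - A 0 1 * D 0 0 := by
          linear_combination h10
        rw [this]
        exact dvd_sub (dvd_mul_right _ _) (hA01.mul_right _)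
      exact (hA11.dvd_mul_left).1 this
    obtain ⟨x, y, z, rfl⟩ := exists_symO_mul hπ hν h1 h2
    obtain ⟨r, x', hr⟩ := exists_dvd_sub_residueLift hπ x
    obtain ⟨s, hs⟩ := exists_dvd_sub_residueLift hπ x'
    obtain ⟨t, ht⟩ := exists_dvd_sub_residueLift hπ y
    refine ⟨(i, r, s, t), ?_⟩
    rw [mul_inv_rev, unipO_inv, mul_assoc _ _ k, levi_map_inv]
    have hx2 : π ^ 2 ∣ x - (residueLift r + π * residueLift s) := by
      have : x - (residueLift r + π * residueLift s) = π * (x' - residueLift s) := by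
        linear_combination hr
      rw [this, pow_two]
      exact mul_dvd_mul_left _ hs
    refine hElt_conj_mem_zero_one hπ hϖ (mul_mem (unipO_mem hπ _ _ _) hu)
      (unipO_mul_coe e _ _ _) ?_ ?_ ?_ ?_ hD10
    · exact dvd_add hA01 (Dvd.intro _ rfl)
    all_goals
      rw [← Matrix.add_mul, symO_add]
      simp only [← sub_eq_add_neg]
      rw [Matrix.mul_apply, Fin.sum_univ_two]
    · refine dvd_add (hx2.mul_right _) ?_
      rw [pow_two]
      exact mul_dvd_mul ht hD10
    · exact dvd_add (((dvd_pow_self π two_ne_zero).trans hx2).mul_right _) (ht.mul_right _)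
    · exact dvd_add (ht.mul_right _) (hD10.mul_left _)
  · rintro ⟨i, r, s, t⟩ ⟨j, r', s', t'⟩ h
    obtain rfl : i = j := by
      apply lineRep_injective_mod hπ c
      obtain ⟨M, _, hM⟩ := entry_of_hElt_conj_mem h
      have h01 := (hM 0 1).1
      have e : ((levi (Matrix.GeneralLinearGroup.map (algebraMap 𝒪[F] F) (lineRep c i)) *
        unipO (residueLift r + π * residueLift s) (residueLift t) 0)⁻¹ *
        (levi (Matrix.GeneralLinearGroup.map (algebraMap 𝒪[F] F) (lineRep c j)) *
        unipO (residueLift r' + π * residueLift s') (residueLift t') 0)).1.1 (Sum.inl 0) (Sum.inl 1)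
        = algebraMap 𝒪[F] F (((lineRep c i)⁻¹ * lineRep c j).1 0 1) := by
        rw [mul_inv_rev, unipO_inv, levi_map_inv, mul_assoc, ← mul_assoc (levi _), ← levi_mul, ← map_mul,
          GSp4.coe_mul, GSp4.coe_mul, levi_coe, unipO, unipO, unip_coe, unip_coe,
          Matrix.fromBlocks_multiply, Matrix.fromBlocks_multiply, Matrix.fromBlocks_apply₁₁]
        simp only [Matrix.one_mul, Matrix.mul_one, Matrix.mul_zero, add_zero]
        rfl
      rw [e] at h01
      have h01' := dvd_of_entry_eq (π := π) (n := 1) (x := ((lineRep c i)⁻¹ * lineRep c j).1 0 1)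
        (y := M 0 1) (by
          rw [hϖ, pow_one]
          refine mul_right_cancel₀ ϖ.ne_zero ?_
          simp only [Matrix.cons_val_zero, Matrix.cons_val_one, Matrix.cons_val_fin_one, zero_add,
            mul_one, zpow_ofNat] at h01
          linear_combination h01)
      simpa using h01'
    have e : (levi (Matrix.GeneralLinearGroup.map (algebraMap 𝒪[F] F) (lineRep c i)) *
        unipO (residueLift r + π * residueLift s) (residueLift t) 0)⁻¹ *
        (levi (Matrix.GeneralLinearGroup.map (algebraMap 𝒪[F] F) (lineRep c i)) *
        unipO (residueLift r' + π * residueLift s') (residueLift t') 0) =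
        unipO ((residueLift r' + π * residueLift s') - (residueLift r + π * residueLift s))
          (residueLift t' - residueLift t) 0 := by
      rw [mul_inv_rev, mul_assoc, inv_mul_cancel_left, unipO_inv, unipO_mul]
      congr 1 <;> ring
    simp only [e] at h
    obtain ⟨_, M, hM⟩ := entry_of_hElt_conj_mem h
    have h00 := (hM 0 0).2
    have h01 := (hM 0 1).2
    have hx := dvd_of_entry_eq (π := π) (n := 2)
      (x := (residueLift r' + π * residueLift s') - (residueLift r + π * residueLift s))
      (y := M 0 0) (by simpa [unipO, symO, hϖ, zpow_ofNat] using h00)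
    have hy := dvd_of_entry_eq (π := π) (n := 1) (x := residueLift t' - residueLift t)
      (y := M 0 1) (by
        refine mul_right_cancel₀ ϖ.ne_zero ?_
        simp [unipO, symO, zpow_ofNat] at h01
        rw [map_sub, hϖ]
        linear_combination h01)
    rw [pow_one] at hy
    obtain rfl := residueLift_injective_mod hπ hy
    obtain rfl : r' = r := by
      apply residueLift_injective_mod hπ
      have h1 := (dvd_pow_self π two_ne_zero).trans hx
      have : residueLift r' - residueLift r =
        ((residueLift r' + π * residueLift s') - (residueLift r + π * residueLift s)) -
          π * (residueLift s' - residueLift s) := by ring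
      rw [this]
      exact dvd_sub h1 (dvd_mul_right _ _)
    obtain rfl : s' = s := by
      apply residueLift_injective_mod hπ
      have hπ0 : π ≠ 0 := by
        rintro rfl
        rw [map_zero] at hϖ
        exact ϖ.ne_zero hϖ.symm
      refine (mul_dvd_mul_iff_left hπ0).1 ?_
      rw [← pow_two]
      convert hx using 1
      ring
    rfl

end Cosets

/-! ### Diagonal elements and the Levi subgroup -/

section DiagonalElements

variable {F : Type*} [Field F]

/-- The matrix `diag(ϖ^m, 1)`. -/
noncomputable def diagGL (ϖ : Fˣ) (m : ℕ) : GL (Fin 2) F :=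
  Matrix.GeneralLinearGroup.mkOfDetNeZero !![(ϖ : F) ^ m, 0; 0, 1] (by simp)

@[simp] theorem diagGL_coe (ϖ : Fˣ) (m : ℕ) : (diagGL ϖ m).1 = !![(ϖ : F) ^ m, 0; 0, 1] := rfl

theorem diagGL_inv_coe (ϖ : Fˣ) (m : ℕ) :
    ((diagGL ϖ m)⁻¹).1 = !![((ϖ : F) ^ m)⁻¹, 0; 0, 1] := by
  rw [Matrix.coe_units_inv]
  apply Matrix.inv_eq_right_inv
  rw [diagGL_coe, Matrix.mul_fin_two, Matrix.one_fin_two]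
  simp

theorem diagGL_mul (ϖ : Fˣ) (m n : ℕ) : diagGL ϖ m * diagGL ϖ n = diagGL ϖ (m + n) := by
  apply Units.ext
  rw [Units.val_mul, diagGL_coe, diagGL_coe, diagGL_coe, Matrix.mul_fin_two]
  simp [pow_add]

/-- h(n,0) is scalar on each block and so commutes with the Levi subgroup. Splitting it off, with n
= l + m, moves the dependence on m into GL₂. -/
theorem hElt_eq_mul_levi (ϖ : Fˣ) (l m : ℕ) :
    hElt ϖ l m = hElt ϖ ((l + m : ℕ) : ℤ) 0 * levi (diagGL ϖ m) := by
  apply GSp4.ext_matrix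
  rw [GSp4.coe_mul, hElt_coe, hElt_coe, levi_coe, Matrix.fromBlocks_multiply, diagGL_inv_coe]
  have h1 : (ϖ : F) ^ ((l : ℤ) + 2 * m) = (ϖ : F) ^ (l + 2 * m) := by norm_cast
  have h2 : (ϖ : F) ^ ((l : ℤ) + m) = (ϖ : F) ^ (l + m) := by norm_cast
  congr 1 <;> ext i j <;> fin_cases i <;> fin_cases j <;>
    simp [Matrix.mul_apply, Fin.sum_univ_two, h1, h2]
  ring

theorem hElt_mul_levi_comm (ϖ : Fˣ) (n : ℤ) (g : GL (Fin 2) F) :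
    hElt ϖ n 0 * levi g = levi g * hElt ϖ n 0 := by
  apply GSp4.ext_matrix
  rw [GSp4.coe_mul, GSp4.coe_mul, hElt_coe, levi_coe, Matrix.fromBlocks_multiply,
    Matrix.fromBlocks_multiply]
  congr 1 <;> ext i j <;> fin_cases i <;> fin_cases j <;>
    simp [Matrix.mul_apply, Fin.sum_univ_two, mul_comm]

theorem hElt_mul_hElt (ϖ : Fˣ) (l m l' m' : ℤ) :
    hElt ϖ l m * hElt ϖ l' m' = hElt ϖ (l + l') (m + m') := by
  apply GSp4.ext_matrix
  have h0 := ϖ.ne_zero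
  rw [GSp4.coe_mul, hElt_coe, hElt_coe, hElt_coe, Matrix.fromBlocks_multiply]
  congr 1 <;> ext i j <;> fin_cases i <;> fin_cases j <;>
    simp [← zpow_add₀ h0] <;> congr 1 <;> ring

theorem levi_mul_unip (g : GL (Fin 2) F) (X Y : Matrix (Fin 2) (Fin 2) F) (hX : X.IsSymm)
    (hY : Y.IsSymm) (e : g.1.det • Y = g.1 * X * (g.1)ᵀ) :
    levi g * unip X hX = unip Y hY * levi g := by
  apply GSp4.ext_matrix
  rw [GSp4.coe_mul, GSp4.coe_mul, levi_coe, unip_coe, unip_coe, Matrix.fromBlocks_multiply,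
    Matrix.fromBlocks_multiply]
  have h1 : (g.1)ᵀ * ((g⁻¹).1)ᵀ = 1 := by
    rw [← Matrix.transpose_mul, ← Units.val_mul]; simp
  have h2 : Y * (g.1.det • ((g⁻¹).1)ᵀ) = g.1 * X := by
    rw [Matrix.mul_smul, ← Matrix.smul_mul, e, Matrix.mul_assoc, h1, Matrix.mul_one]
  rw [h2]
  simp

end DiagonalElements

/-! ### Transformation of B on the Levi subgroup; the unipotents drop out -/

section BesselValues

/-- The function `g ↦ B(h(n,0) · diag(g, det(g) ᵗg⁻¹))` on `GL₂(F)`. -/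
noncomputable def leviRestrict {F : Type*} [Field F] (ϖ : Fˣ) (B : GSp4 F → ℂ) (n : ℕ)
    (g : GL (Fin 2) F) : ℂ :=
  B (hElt ϖ n 0 * levi g)

theorem apply_hElt_eq {F : Type*} [Field F] (ϖ : Fˣ) (B : GSp4 F → ℂ) (l m : ℕ) :
    B (hElt ϖ l m) = leviRestrict ϖ B (l + m) (diagGL ϖ m) := by
  rw [hElt_eq_mul_levi, leviRestrict]

variable {F : Type*} [Field F] [ValuativeRel F]

/-- Here l, m ≥ 0 is essential: the conjugated unipotent is again integral. -/
theorem hElt_mul_unipO {π : 𝒪[F]} {ϖ : Fˣ} (hϖ : algebraMap 𝒪[F] F π = ϖ) (l m : ℕ)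
    (x y z : 𝒪[F]) : hElt ϖ l m * unipO x y z =
      unipO (π ^ (l + 2 * m) * x) (π ^ (l + m) * y) (π ^ l * z) * hElt ϖ l m := by
  apply GSp4.ext_matrix
  have h1 : (ϖ : F) ^ ((l : ℤ) + 2 * m) = (ϖ : F) ^ (l + 2 * m) := by norm_cast
  have h2 : (ϖ : F) ^ ((l : ℤ) + m) = (ϖ : F) ^ (l + m) := by norm_cast
  rw [GSp4.coe_mul, GSp4.coe_mul, hElt_coe, unipO, unipO, unip_coe, unip_coe,
    Matrix.fromBlocks_multiply, Matrix.fromBlocks_multiply]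
  congr 1 <;> ext i j <;> fin_cases i <;> fin_cases j <;>
    simp [Matrix.mul_apply, Fin.sum_univ_two, symO, h1, h2, hϖ] <;> ring

theorem exists_levi_map_mul_unipO (k : GL (Fin 2) 𝒪[F]) (x y z : 𝒪[F]) :
    ∃ x' y' z' : 𝒪[F], levi (Matrix.GeneralLinearGroup.map (algebraMap 𝒪[F] F) k) * unipO x y z =
      unipO x' y' z' * levi (Matrix.GeneralLinearGroup.map (algebraMap 𝒪[F] F) k) := by
  obtain ⟨δ, hδ⟩ := (Matrix.isUnit_iff_isUnit_det _).1 k.isUnit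
  set Y : Matrix (Fin 2) (Fin 2) 𝒪[F] := ((δ⁻¹ : 𝒪[F]ˣ) : 𝒪[F]) • (k.1 * symO x y z * (k.1)ᵀ)
    with hY
  have hs : (symO x y z)ᵀ = symO x y z := by
    ext i j
    fin_cases i <;> fin_cases j <;> simp [symO]
  have hYs : Yᵀ = Y := by
    rw [hY, Matrix.transpose_smul, Matrix.transpose_mul, Matrix.transpose_mul,
      Matrix.transpose_transpose, hs, Matrix.mul_assoc]
  have hYe : symO (Y 0 0) (Y 0 1) (Y 1 1) = Y := by
    ext i j
    fin_cases i <;> fin_cases j <;> simp [symO]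
    exact congrFun (congrFun hYs 1) 0
  refine ⟨Y 0 0, Y 0 1, Y 1 1, levi_mul_unip _ _ _ _ _ ?_⟩
  rw [hYe, hY]
  have hd : ((Matrix.GeneralLinearGroup.map (algebraMap 𝒪[F] F) k).1).det =
      algebraMap 𝒪[F] F k.1.det := ((algebraMap 𝒪[F] F).map_det _).symm
  have hm : (Matrix.GeneralLinearGroup.map (algebraMap 𝒪[F] F) k).1 =
    k.1.map (algebraMap 𝒪[F] F) := rfl
  rw [hd, ← hδ, hm, ← Matrix.transpose_map, ← Matrix.map_mul, ← Matrix.map_mul]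
  ext i j
  rw [Matrix.smul_apply, Matrix.map_apply, Matrix.map_apply, Matrix.smul_apply, smul_eq_mul,
    smul_eq_mul, ← map_mul, Units.mul_inv_cancel_left]

variable [TopologicalSpace F] {a b c : 𝒪[F]} {ψ : AddChar F ℂ}
  {Λ : torus (algebraMap 𝒪[F] F a) (algebraMap 𝒪[F] F b) (algebraMap 𝒪[F] F c) →* ℂˣ}
  {B : GSp4 F → ℂ}

theorem leviRestrict_torus_mul (hB : IsBesselFunction _ _ _ ψ Λ B) (ϖ : Fˣ) (n : ℕ)
    (t : torus (algebraMap 𝒪[F] F a) (algebraMap 𝒪[F] F b) (algebraMap 𝒪[F] F c))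
    (g : GL (Fin 2) F) :
    leviRestrict ϖ B n (t.1 * g) = (Λ t : ℂ) * leviRestrict ϖ B n g := by
  have := hB.bessel t 0 Matrix.isSymm_zero (hElt ϖ n 0 * levi g)
  rw [unip_zero, mul_one, Matrix.mul_zero, Matrix.trace_zero, AddChar.map_zero_eq_one,
    mul_one] at this
  rw [leviRestrict, leviRestrict, ← this, levi_mul, ← mul_assoc, hElt_mul_levi_comm, mul_assoc]

theorem leviRestrict_mul_map (hB : IsBesselFunction _ _ _ ψ Λ B) {π : 𝒪[F]}
    (hπ : 𝓂[F] = Ideal.span {π}) (ϖ : Fˣ) (n : ℕ) (g : GL (Fin 2) F) (k : GL (Fin 2) 𝒪[F]) :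
    leviRestrict ϖ B n (g * Matrix.GeneralLinearGroup.map (algebraMap 𝒪[F] F) k) =
      leviRestrict ϖ B n g := by
  rw [leviRestrict, leviRestrict, levi_mul, ← mul_assoc, hB.right_invariant _ _ (levi_map_mem hπ k)]

variable [CharZero F]

/-- The off-diagonal entries b/2 of S occur twice in the trace, so tr(SX) = ax + by + cz is integral
even in residue characteristic 2. -/
theorem IsBesselFunction.unipO_mul (hB : IsBesselFunction _ _ _ ψ Λ B)
    (hψ : ∀ x ∈ 𝒪[F], ψ x = 1) (x y z : 𝒪[F]) (g : GSp4 F) : B (unipO x y z * g) = B g := by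
  have := hB.bessel 1 _ (symO_map_isSymm x y z) g
  rw [OneMemClass.coe_one, levi_one, one_mul, map_one, Units.val_one, one_mul] at this
  rw [unipO, this, hψ, one_mul]
  have : Matrix.trace (matS (algebraMap 𝒪[F] F a) (algebraMap 𝒪[F] F b) (algebraMap 𝒪[F] F c) *
      (symO x y z).map (algebraMap 𝒪[F] F)) = algebraMap 𝒪[F] F (a * x + b * y + c * z) := by
    rw [Matrix.trace_fin_two, Matrix.mul_apply, Matrix.mul_apply, Fin.sum_univ_two,
      Fin.sum_univ_two]
    simp [matS, symO]
    ring
  rw [this]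
  exact algebraMap_mem_integer _

theorem IsBesselFunction.hElt_unipO_mul (hB : IsBesselFunction _ _ _ ψ Λ B)
    (hψ : ∀ x ∈ 𝒪[F], ψ x = 1) {π : 𝒪[F]} {ϖ : Fˣ} (hϖ : algebraMap 𝒪[F] F π = ϖ) (l m : ℕ)
    (x y z : 𝒪[F]) (g : GSp4 F) : B (hElt ϖ l m * unipO x y z * g) = B (hElt ϖ l m * g) := by
  rw [hElt_mul_unipO hϖ, mul_assoc, hB.unipO_mul hψ]

/-- If `g' = z g k` with `z ∈ Lˣ` and `k ∈ GL₂(𝔬)`, then the values at `g'` and `g` differ by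
`Λ(z)`. -/
theorem leviRestrict_eq_charL_mul (hB : IsBesselFunction _ _ _ ψ Λ B) {π : 𝒪[F]}
    (hπ : 𝓂[F] = Ideal.span {π}) (ϖ : Fˣ) (n : ℕ)
    (z : (quadL (algebraMap 𝒪[F] F a) (algebraMap 𝒪[F] F b) (algebraMap 𝒪[F] F c))ˣ)
    {g g' : GL (Fin 2) F} {k : Matrix (Fin 2) (Fin 2) 𝒪[F]} (hk : IsUnit k.det)
    (e : g'.1 = quadHom _ _ _ z.1 * g.1 * k.map (algebraMap 𝒪[F] F)) :
    leviRestrict ϖ B n g' = (charL _ _ _ Λ z : ℂ) * leviRestrict ϖ B n g := by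
  obtain ⟨k, rfl⟩ := (Matrix.isUnit_iff_isUnit_det _).2 hk
  have : g' = (toTorus _ _ _ z).1 * g * Matrix.GeneralLinearGroup.map (algebraMap 𝒪[F] F) k :=
    Units.ext e
  rw [this, leviRestrict_mul_map hB hπ, leviRestrict_torus_mul hB]
  rfl

variable [IsNonarchimedeanLocalField F] [MeasurableSpace (GSp4 F)] [BorelSpace (GSp4 F)]

theorem hecke_one_zero_apply_hElt (hB : IsBesselFunction _ _ _ ψ Λ B)
    (hψ : ∀ x ∈ 𝒪[F], ψ x = 1) {π : 𝒪[F]} (hπ : 𝓂[F] = Ideal.span {π}) {ϖ : Fˣ}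
    (hϖ : algebraMap 𝒪[F] F π = ϖ) (ν : Measure (GSp4 F)) [ν.IsHaarMeasure] (l m : ℕ) :
    hecke ν (hElt ϖ 1 0) B (hElt ϖ l m) = resCard F ^ 3 * B (hElt ϖ (l + 1) m) := by
  have := Fintype.ofFinite 𝓀[F]
  rw [hecke_one_zero hπ hϖ ν B hB.right_invariant]
  simp only [hB.hElt_unipO_mul hψ hϖ, hElt_mul_hElt, add_zero]
  rw [Finset.sum_const, Finset.card_univ, Fintype.card_prod, Fintype.card_prod, resCard,
    Nat.card_eq_fintype_card, nsmul_eq_mul]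
  push_cast
  ring

/-- The unipotent moves left past the Levi element and past h(l,m), staying integral, and is
absorbed. The q³ unipotents thus give equal terms for each line. -/
theorem hecke_zero_one_apply_hElt (hB : IsBesselFunction _ _ _ ψ Λ B)
    (hψ : ∀ x ∈ 𝒪[F], ψ x = 1) {π : 𝒪[F]} (hπ : 𝓂[F] = Ideal.span {π}) {ϖ : Fˣ}
    (hϖ : algebraMap 𝒪[F] F π = ϖ) (ν : Measure (GSp4 F)) [ν.IsHaarMeasure] [Fintype 𝓀[F]]
    (u : 𝒪[F]ˣ) (l m : ℕ) :
    hecke ν (hElt ϖ 0 1) B (hElt ϖ l m) = resCard F ^ 3 * ∑ i : Option 𝓀[F],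
      leviRestrict ϖ B (l + m + 1) (diagGL ϖ m *
        Matrix.GeneralLinearGroup.map (algebraMap 𝒪[F] F) (lineRep u i) * diagGL ϖ 1) := by
  rw [hecke_zero_one hπ hϖ ν B hB.right_invariant u]
  have h : ∀ r : Option 𝓀[F] × 𝓀[F] × 𝓀[F] × 𝓀[F], B (hElt ϖ l m *
      (levi (Matrix.GeneralLinearGroup.map (algebraMap 𝒪[F] F) (lineRep u r.1)) *
        unipO (residueLift r.2.1 + π * residueLift r.2.2.1) (residueLift r.2.2.2) 0)
          * hElt ϖ 0 1) = leviRestrict ϖ B (l + m + 1) (diagGL ϖ m *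
        Matrix.GeneralLinearGroup.map (algebraMap 𝒪[F] F) (lineRep u r.1) * diagGL ϖ 1) := by
    intro r
    obtain ⟨x, y, z, e⟩ := exists_levi_map_mul_unipO (lineRep u r.1)
      (residueLift r.2.1 + π * residueLift r.2.2.1) (residueLift r.2.2.2) 0
    have e1 := hElt_eq_mul_levi ϖ 0 1
    rw [e, mul_assoc, mul_assoc, ← mul_assoc, hB.hElt_unipO_mul hψ hϖ, leviRestrict, levi_mul,
      levi_mul, hElt_eq_mul_levi ϖ l m]
    simp only [Nat.cast_zero, Nat.cast_one, zero_add] at e1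
    rw [e1]
    congr 1
    have e2 : hElt ϖ ((l + m + 1 : ℕ) : ℤ) 0 = hElt ϖ ((l + m : ℕ) : ℤ) 0 * hElt ϖ 1 0 := by
      rw [hElt_mul_hElt]; simp
    rw [e2]
    simp only [mul_assoc]
    congr 1
    simp only [← levi_mul, hElt_mul_levi_comm, ← mul_assoc]
  rw [Finset.sum_congr rfl fun r _ => h r, Fintype.sum_prod_type]
  simp only [Finset.sum_const, Finset.card_univ, Fintype.card_prod, resCard,
    Nat.card_eq_fintype_card, nsmul_eq_mul]
  rw [Finset.mul_sum]
  refine Finset.sum_congr rfl fun i _ => ?_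
  push_cast
  ring

end BesselValues

/-! ### Traces and discriminants in the quadratic algebra -/

section Discriminant

variable {F : Type*} [Field F]

theorem trace_quadraticAlgebra (d : F) (z : QuadraticAlgebra F d 0) :
    Algebra.trace F (QuadraticAlgebra F d 0) z = 2 * z.re := by
  rw [Algebra.trace_eq_matrix_trace (QuadraticAlgebra.basis d 0), Matrix.trace_fin_two,
    Algebra.leftMulMatrix_eq_repr_mul, Algebra.leftMulMatrix_eq_repr_mul]
  have h0 : QuadraticAlgebra.basis d (0 : F) 0 = 1 := by
    apply (QuadraticAlgebra.basis d (0 : F)).repr.injective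
    rw [Module.Basis.repr_self]
    ext i
    fin_cases i <;> simp [QuadraticAlgebra.re_one, QuadraticAlgebra.im_one]
  have h1 : QuadraticAlgebra.basis d (0 : F) 1 = ⟨0, 1⟩ := by
    apply (QuadraticAlgebra.basis d (0 : F)).repr.injective
    rw [Module.Basis.repr_self]
    ext i
    fin_cases i <;> simp
  rw [h0, h1]
  simp
  ring

theorem discr_one_self (d : F) (z : QuadraticAlgebra F d 0) :
    Algebra.discr F ![1, z] = (2 * z.im) ^ 2 * d := by
  rw [Algebra.discr_def, Matrix.det_fin_two]
  simp [Algebra.traceMatrix_apply, Algebra.traceForm_apply, trace_quadraticAlgebra,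
    QuadraticAlgebra.re_one]
  ring

end Discriminant

/-! ### The order 𝔬 + 𝔬ω and the arithmetic of the three cases -/

section QuadraticOrder

variable {F : Type*} [Field F] [ValuativeRel F]

/-- The quadratic algebra `L` for integral `a, b, c`. -/
abbrev quadO (a b c : 𝒪[F]) : Type _ :=
  quadL (algebraMap 𝒪[F] F a) (algebraMap 𝒪[F] F b) (algebraMap 𝒪[F] F c)

/-- The element `x + yω` of `L`, where `ω = (b + √d)/2`. -/
noncomputable def coordL (a b c x y : 𝒪[F]) : quadO a b c :=
  ⟨algebraMap 𝒪[F] F x + algebraMap 𝒪[F] F y * algebraMap 𝒪[F] F b / 2, algebraMap 𝒪[F] F y / 2⟩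

@[simp] theorem coordL_re (a b c x y : 𝒪[F]) : (coordL a b c x y).re =
    algebraMap 𝒪[F] F x + algebraMap 𝒪[F] F y * algebraMap 𝒪[F] F b / 2 := rfl

@[simp] theorem coordL_im (a b c x y : 𝒪[F]) :
    (coordL a b c x y).im = algebraMap 𝒪[F] F y / 2 := rfl

/-- The norm of `x + yω`. -/
noncomputable def quadNorm (a b c x y : 𝒪[F]) : 𝒪[F] := x ^ 2 + b * x * y + a * c * y ^ 2

variable (a b c : 𝒪[F])

theorem coordL_star (x y : 𝒪[F]) [CharZero F] :
    star (coordL a b c x y) = coordL a b c (x + b * y) (-y) := by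
  ext <;> simp <;> ring

theorem algebraMap_eq_coordL (x : 𝒪[F]) :
    algebraMap 𝒪[F] (quadO a b c) x = coordL a b c x 0 := by
  ext
  · simp [IsScalarTower.algebraMap_apply 𝒪[F] F (quadO a b c),
      QuadraticAlgebra.algebraMap_eq]
  · simp [IsScalarTower.algebraMap_apply 𝒪[F] F (quadO a b c),
      QuadraticAlgebra.algebraMap_eq]

theorem mem_integer_of_isIntegral {x : F} (h : IsIntegral 𝒪[F] x) : x ∈ 𝒪[F] := by
  have : IsFractionRing 𝒪[F] F := inferInstance
  obtain ⟨y, rfl⟩ := IsIntegrallyClosed.isIntegral_iff.1 h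
  exact y.2

theorem mem_integer_of_sq_mem {x : F} (h : x ^ 2 ∈ 𝒪[F]) : x ∈ 𝒪[F] := by
  obtain ⟨y, hy⟩ := exists_algebraMap_eq h
  refine mem_integer_of_isIntegral ⟨Polynomial.X ^ 2 - Polynomial.C y, by monicity!, ?_⟩
  simp [hy]

theorem dvd_or_dvd_of_dvd_quadNorm {π : 𝒪[F]} (hπ : 𝓂[F] = Ideal.span {π}) {a b c s t : 𝒪[F]}
    (hs : π ∣ quadNorm a b c s 1) (ht : π ∣ quadNorm a b c t 1) : π ∣ s - t ∨ π ∣ s + t + b := by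
  have h := dvd_sub hs ht
  have e : quadNorm a b c s 1 - quadNorm a b c t 1 = (s - t) * (s + t + b) := by
    simp only [quadNorm]; ring
  rw [e] at h
  by_contra! hn
  rw [← not_isUnit_iff_dvd hπ, ← not_isUnit_iff_dvd hπ, not_not, not_not] at hn
  exact (not_isUnit_iff_dvd hπ).2 h (hn.1.mul hn.2)

/-- If `d` is not a square, the reduction of `X² + bX + ac` does not have two different roots. -/
theorem dvd_sub_of_dvd_quadNorm [TopologicalSpace F] [IsNonarchimedeanLocalField F] {π : 𝒪[F]}
    (hπ : 𝓂[F] = Ideal.span {π})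
    {a b c : 𝒪[F]} (hns : ¬ IsSquare
      (disc (algebraMap 𝒪[F] F a) (algebraMap 𝒪[F] F b) (algebraMap 𝒪[F] F c)))
    {s t : 𝒪[F]} (hs : π ∣ quadNorm a b c s 1) (ht : π ∣ quadNorm a b c t 1) : π ∣ s - t := by
  let := IsTopologicalAddGroup.rightUniformSpace F
  have := isUniformAddGroup_of_addCommGroup (G := F)
  by_contra hn
  have h2 := (dvd_or_dvd_of_dvd_quadNorm hπ hs ht).resolve_left hn
  rw [← not_isUnit_iff_dvd hπ, not_not] at hn
  have hu : IsUnit (2 * s + b) := by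
    have := isUnit_add_of_dvd hπ hn h2
    convert this using 1
    ring
  obtain ⟨r, hr, -⟩ := HenselianRing.is_henselian (I := 𝓂[F])
    (Polynomial.X ^ 2 + Polynomial.C b * Polynomial.X + Polynomial.C (a * c)) (by monicity!) s
    (by
      rw [hπ, Ideal.mem_span_singleton]
      convert hs using 1
      simp [quadNorm])
    (by
      apply IsUnit.map
      convert hu using 1
      simp
      norm_num)
  apply hns
  refine ⟨algebraMap 𝒪[F] F (2 * r + b), ?_⟩
  have hr' : r ^ 2 + b * r + a * c = 0 := by simpa using hr
  have e : b ^ 2 - 4 * a * c = (2 * r + b) * (2 * r + b) := by linear_combination (-4) * hr'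
  rw [← map_mul, ← e, disc]
  simp only [map_sub, map_mul, map_pow, map_ofNat]

variable [CharZero F]

theorem coordL_mul (x y x' y' : 𝒪[F]) : coordL a b c x y * coordL a b c x' y' =
    coordL a b c (x * x' - a * c * (y * y')) (x * y' + y * x' + b * (y * y')) := by
  ext
  · simp [disc]
    ring
  · simp [disc]
    ring

theorem coordL_injective {x y x' y' : 𝒪[F]} (h : coordL a b c x y = coordL a b c x' y') :
    x = x' ∧ y = y' := by
  have h2 := congrArg QuadraticAlgebra.im h
  have h1 := congrArg QuadraticAlgebra.re h
  simp only [coordL_re, coordL_im] at h1 h2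
  have hy : algebraMap 𝒪[F] F y = algebraMap 𝒪[F] F y' := by
    field_simp at h2
    exact h2
  rw [hy] at h1
  exact ⟨algebraMap_integer_injective (add_right_cancel h1), algebraMap_integer_injective hy⟩

/-- In the basis 1, ω all denominators 2 disappear, so 𝔬 + 𝔬ω acts on 𝔬² by integral matrices. -/
theorem quadHom_coordL (x y : 𝒪[F]) :
    quadHom _ _ _ (coordL a b c x y) = (!![x + y * b, y * c; -(y * a), x]).map
      (algebraMap 𝒪[F] F) := by
  rw [quadHom_apply]
  ext i j
  fin_cases i <;> fin_cases j <;>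
    simp [-mul_eq_mul_right_iff, -mul_eq_mul_left_iff] <;> ring

theorem coordL_mul_star (x y : 𝒪[F]) : coordL a b c x y * coordL a b c (x + b * y) (-y) =
    coordL a b c (quadNorm a b c x y) 0 := by
  rw [coordL_mul]
  congr 1
  · rw [quadNorm]; ring
  · ring

theorem norm_coordL (x y : 𝒪[F]) : QuadraticAlgebra.norm (coordL a b c x y) =
    algebraMap 𝒪[F] F (quadNorm a b c x y) := by
  rw [QuadraticAlgebra.norm_def]
  simp [quadNorm, disc]
  ring

theorem coordL_mem (x y : 𝒪[F]) : coordL a b c x y ∈ intL (algebraMap 𝒪[F] F a)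
    (algebraMap 𝒪[F] F b) (algebraMap 𝒪[F] F c) := by
  have h : coordL a b c x y = algebraMap 𝒪[F] (quadO a b c) x +
      algebraMap 𝒪[F] (quadO a b c) y * coordL a b c 0 1 := by
    rw [algebraMap_eq_coordL, algebraMap_eq_coordL, coordL_mul]
    ext <;> simp
  rw [h]
  refine add_mem (Subalgebra.algebraMap_mem _ _) (mul_mem (Subalgebra.algebraMap_mem _ _) ?_)
  refine ⟨Polynomial.X ^ 2 - Polynomial.C b * Polynomial.X + Polynomial.C (a * c), ?_, ?_⟩
  · monicity!
  · simp only [Polynomial.eval₂_add, Polynomial.eval₂_sub, Polynomial.eval₂_mul,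
      Polynomial.eval₂_X, Polynomial.eval₂_C, algebraMap_eq_coordL, pow_two,
      coordL_mul]
    ext <;> simp

theorem exists_unit_coordL {x y : 𝒪[F]} (h : IsUnit (quadNorm a b c x y)) :
    ∃ z : (quadO a b c)ˣ, z.1 = coordL a b c x y ∧
      z.1 ∈ intL (algebraMap 𝒪[F] F a) (algebraMap 𝒪[F] F b) (algebraMap 𝒪[F] F c) ∧
      (z⁻¹).1 ∈ intL (algebraMap 𝒪[F] F a) (algebraMap 𝒪[F] F b) (algebraMap 𝒪[F] F c) := by
  obtain ⟨u, hu⟩ := h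
  have e : coordL a b c x y *
      (coordL a b c (x + b * y) (-y) * coordL a b c ((u⁻¹ : 𝒪[F]ˣ) : 𝒪[F]) 0) = 1 := by
    rw [← mul_assoc, coordL_mul_star, ← hu, coordL_mul]
    ext <;> simp [QuadraticAlgebra.re_one, QuadraticAlgebra.im_one]
  refine ⟨⟨_, _, e, by rw [mul_comm]; exact e⟩, rfl, coordL_mem .., ?_⟩
  exact mul_mem (coordL_mem ..) (coordL_mem ..)

variable {a b c}

/-- Under the standard assumptions, `𝔬_L = 𝔬 + 𝔬ω`. -/
theorem exists_coordL_of_mem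
    (H : StandardAssumptions (algebraMap 𝒪[F] F a) (algebraMap 𝒪[F] F b) (algebraMap 𝒪[F] F c))
    {z : quadO a b c}
    (hz : z ∈ intL (algebraMap 𝒪[F] F a) (algebraMap 𝒪[F] F b) (algebraMap 𝒪[F] F c)) :
    ∃ x y, z = coordL a b c x y := by
  -- 2·im(z) is the ω-coordinate y of z. Once it is integral, z - yω lies in F and is integral over
  -- 𝔬, hence lies in 𝔬.
  suffices h : 2 * z.im ∈ 𝒪[F] by
    obtain ⟨y, hy⟩ := exists_algebraMap_eq h
    have hx : z.re - z.im * algebraMap 𝒪[F] F b ∈ 𝒪[F] := by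
      apply mem_integer_of_isIntegral
      rw [← isIntegral_algebraMap_iff (B := quadO a b c)
        (QuadraticAlgebra.algebraMap_injective)]
      have e : algebraMap F (quadO a b c) (z.re - z.im * algebraMap 𝒪[F] F b) =
          z - coordL a b c 0 y := by
        ext
        · simp [QuadraticAlgebra.algebraMap_eq, hy]
          ring
        · simp [QuadraticAlgebra.algebraMap_eq, hy]
      rw [e]
      exact sub_mem hz (coordL_mem a b c 0 y)
    obtain ⟨x, hx⟩ := exists_algebraMap_eq hx
    refine ⟨x, y, ?_⟩
    ext
    · simp [hx, hy]
      ring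
    · simp [hy]
  by_cases hs : IsSquare (disc (algebraMap 𝒪[F] F a) (algebraMap 𝒪[F] F b) (algebraMap 𝒪[F] F c))
  · obtain ⟨h1, h2⟩ := H.split hs
    obtain ⟨r, hr⟩ := hs
    rw [← pow_two] at hr
    have hr' : r⁻¹ ∈ 𝒪[F] := mem_integer_of_sq_mem (by rwa [inv_pow, ← hr])
    have hr0 : r ≠ 0 := by
      rintro rfl
      exact H.disc_ne_zero (by rw [hr]; ring)
    have hi := IsIntegral.map ((splitHom _ _ _ r hr.symm).restrictScalars 𝒪[F]) hz
    have hf : IsIntegral 𝒪[F] ((splitHom _ _ _ r hr.symm) z).1 :=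
      IsIntegral.map (AlgHom.fst 𝒪[F] F F) hi
    have hg : IsIntegral 𝒪[F] ((splitHom _ _ _ r hr.symm) z).2 :=
      IsIntegral.map (AlgHom.snd 𝒪[F] F F) hi
    rw [splitHom_apply] at hf hg
    have := mul_mem (sub_mem (mem_integer_of_isIntegral hf) (mem_integer_of_isIntegral hg)) hr'
    convert this using 1
    field_simp
    ring
  -- The pair (1, z) has discriminant (2·im z)²d, which lies in the discriminant ideal (d).
  -- Cancelling d leaves an integral square.
  · apply mem_integer_of_sq_mem
    have hd := H.nonsplit hs
    have hm : Algebra.discr F ![1, z] ∈ discrL (algebraMap 𝒪[F] F a) (algebraMap 𝒪[F] F b)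
        (algebraMap 𝒪[F] F c) := by
      refine Submodule.subset_span ⟨![1, z], fun i => ?_, rfl⟩
      fin_cases i
      · exact one_mem _
      · exact hz
    rw [hd, Submodule.mem_span_singleton] at hm
    obtain ⟨s, hs⟩ := hm
    rw [discr_one_self] at hs
    have : algebraMap 𝒪[F] F s = (2 * z.im) ^ 2 := mul_right_cancel₀ H.disc_ne_zero hs
    rw [← this]
    exact algebraMap_mem_integer _

/-- In the inert case, `x + ω` is a unit for all `x ∈ 𝔬`. -/
theorem isUnit_quadNorm_of_isMaximal
    (H : StandardAssumptions (algebraMap 𝒪[F] F a) (algebraMap 𝒪[F] F b)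
      (algebraMap 𝒪[F] F c)) {π : 𝒪[F]} (hπ : 𝓂[F] = Ideal.span {π})
    (hmax : (Ideal.map (algebraMap 𝒪[F] (intL (algebraMap 𝒪[F] F a) (algebraMap 𝒪[F] F b)
      (algebraMap 𝒪[F] F c))) 𝓂[F]).IsMaximal) (x : 𝒪[F]) : IsUnit (quadNorm a b c x 1) := by
  by_contra h
  rw [not_isUnit_iff_dvd hπ] at h
  obtain ⟨w, hw⟩ := h
  rw [hπ, Ideal.map_span, Set.image_singleton] at hmax
  -- If π divided N(x + ω), the prime ideal π𝔬_L would contain the product of x + ω and its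
  -- conjugate. It contains neither factor, since their ω-coordinates are ±1.
  have key : ∀ u v : 𝒪[F], IsUnit v → (⟨coordL a b c u v, coordL_mem a b c u v⟩ :
      intL (algebraMap 𝒪[F] F a) (algebraMap 𝒪[F] F b) (algebraMap 𝒪[F] F c)) ∉
      Ideal.span {algebraMap 𝒪[F] (intL (algebraMap 𝒪[F] F a) (algebraMap 𝒪[F] F b)
      (algebraMap 𝒪[F] F c)) π} := by
    intro u v hv hm
    obtain ⟨⟨s, hs⟩, e⟩ := Ideal.mem_span_singleton.1 hm
    have e' := congrArg Subtype.val e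
    obtain ⟨p, q, rfl⟩ := exists_coordL_of_mem H hs
    have e2 : coordL a b c u v = algebraMap 𝒪[F] (quadO a b c) π * coordL a b c p q := e'
    rw [algebraMap_eq_coordL, coordL_mul] at e2
    have := (coordL_injective a b c e2).2
    refine (not_isUnit_iff_dvd hπ).2 ⟨q, ?_⟩ hv
    rw [this]; ring
  have hprod : (⟨coordL a b c x 1, coordL_mem a b c x 1⟩ :
      intL (algebraMap 𝒪[F] F a) (algebraMap 𝒪[F] F b) (algebraMap 𝒪[F] F c)) *
      ⟨coordL a b c (x + b * 1) (-1), coordL_mem a b c _ _⟩ ∈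
      Ideal.span {algebraMap 𝒪[F] (intL (algebraMap 𝒪[F] F a) (algebraMap 𝒪[F] F b)
      (algebraMap 𝒪[F] F c)) π} := by
    rw [Ideal.mem_span_singleton]
    refine ⟨⟨coordL a b c w 0, coordL_mem a b c _ _⟩, Subtype.ext ?_⟩
    change coordL a b c x 1 * coordL a b c (x + b * 1) (-1) =
      algebraMap 𝒪[F] (quadO a b c) π * coordL a b c w 0
    rw [coordL_mul_star, hw, algebraMap_eq_coordL, coordL_mul]
    congr 1 <;> ring
  rcases hmax.isPrime.mem_or_mem hprod with h | h
  · exact key _ _ isUnit_one h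
  · exact key _ _ isUnit_one.neg h

/-- In the ramified case, a uniformizer of `𝔬_L` is of the form `x + yω` with `y ∈ 𝔬ˣ`, and its
norm is a uniformizer of `𝔬`. -/
theorem exists_coordL_of_uniformizer
    (H : StandardAssumptions (algebraMap 𝒪[F] F a) (algebraMap 𝒪[F] F b)
      (algebraMap 𝒪[F] F c)) {π : 𝒪[F]} (hπ : 𝓂[F] = Ideal.span {π}) (hπ0 : π ≠ 0)
    (hmax : ¬ (Ideal.map (algebraMap 𝒪[F] (intL (algebraMap 𝒪[F] F a) (algebraMap 𝒪[F] F b)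
      (algebraMap 𝒪[F] F c))) 𝓂[F]).IsMaximal)
    {z : quadO a b c}
    (hz : z ∈ intL (algebraMap 𝒪[F] F a) (algebraMap 𝒪[F] F b) (algebraMap 𝒪[F] F c))
    (hzmax : (Ideal.span {(⟨z, hz⟩ : intL (algebraMap 𝒪[F] F a) (algebraMap 𝒪[F] F b)
      (algebraMap 𝒪[F] F c))}).IsMaximal) :
    ∃ (x y : 𝒪[F]) (v : 𝒪[F]ˣ), z = coordL a b c x y ∧ IsUnit y ∧
      quadNorm a b c x y = π * v := by
  have hp : Prime π := by
    rw [← Ideal.span_singleton_prime hπ0, ← hπ]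
    exact (IsLocalRing.maximalIdeal.isMaximal _).isPrime
  obtain ⟨x, y, rfl⟩ := exists_coordL_of_mem H hz
  have hunit : ∀ (u v : 𝒪[F]) (hm : coordL a b c u v ∈ intL (algebraMap 𝒪[F] F a)
      (algebraMap 𝒪[F] F b) (algebraMap 𝒪[F] F c)), IsUnit (quadNorm a b c u v) →
      IsUnit (⟨coordL a b c u v, hm⟩ : intL (algebraMap 𝒪[F] F a)
      (algebraMap 𝒪[F] F b) (algebraMap 𝒪[F] F c)) := by
    intro u v hm h
    obtain ⟨t, ht, h1, h2⟩ := exists_unit_coordL a b c h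
    refine .of_mul_eq_one ⟨(t⁻¹).1, h2⟩ (Subtype.ext ?_)
    change coordL a b c u v * (t⁻¹).1 = 1
    rw [← ht, Units.mul_inv]
  have hcomap := Ideal.isMaximal_comap_of_isIntegral_of_isMaximal (R := 𝒪[F])
    (Ideal.span {(⟨coordL a b c x y, hz⟩ : intL (algebraMap 𝒪[F] F a) (algebraMap 𝒪[F] F b)
      (algebraMap 𝒪[F] F c))})
  have hmem : π ∈ Ideal.comap (algebraMap 𝒪[F] _)
    (Ideal.span {(⟨coordL a b c x y, hz⟩ : intL (algebraMap 𝒪[F] F a) (algebraMap 𝒪[F] F b)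
      (algebraMap 𝒪[F] F c))}) := by
    rw [IsLocalRing.eq_maximalIdeal hcomap, hπ]
    exact Ideal.mem_span_singleton_self _
  rw [Ideal.mem_comap, Ideal.mem_span_singleton] at hmem
  obtain ⟨⟨s, hs⟩, e⟩ := hmem
  obtain ⟨u, v, rfl⟩ := exists_coordL_of_mem H hs
  have e' : algebraMap 𝒪[F] (quadO a b c) π = coordL a b c x y * coordL a b c u v :=
    congrArg Subtype.val e
  -- The maximal ideal (z) lies over 𝔭, so z divides π and N(z) is associated to πⁱ with i ≤ 2.
  -- Exponent 0 would make z a unit. Exponent 2 would make π an associate of z, contradicting that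
  -- π𝔬_L is not maximal.
  have hN : π ^ 2 = quadNorm a b c x y * quadNorm a b c u v := by
    apply algebraMap_integer_injective
    rw [map_mul, ← norm_coordL, ← norm_coordL, ← map_mul, ← e', algebraMap_eq_coordL, norm_coordL]
    congr 1
    simp [quadNorm]
  obtain ⟨i, hi, hass⟩ := (dvd_prime_pow hp 2).1 (Dvd.intro _ hN.symm)
  obtain ⟨w, hw⟩ := hass.symm
  have hi1 : i = 1 := by
    have h0 : i ≠ 0 := by
      rintro rfl
      refine hzmax.ne_top (Ideal.span_singleton_eq_top.2 (hunit x y hz ?_))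
      rw [← hw, pow_zero, one_mul]
      exact w.isUnit
    have h2 : i ≠ 2 := by
      rintro rfl
      apply hmax
      have hu : IsUnit (quadNorm a b c u v) := by
        refine .of_mul_eq_one (w : 𝒪[F]) ?_
        rw [← hw] at hN
        apply mul_left_cancel₀ (pow_ne_zero 2 hπ0)
        linear_combination -hN
      rw [hπ, Ideal.map_span, Set.image_singleton, e,
        Ideal.span_singleton_mul_right_unit (hunit u v hs hu)]
      exact hzmax
    omega
  subst hi1
  rw [pow_one] at hw
  refine ⟨x, y, w, rfl, ?_, hw.symm⟩
  -- If π divided y, then N(z) = πv would force π ∣ x, and hence π² ∣ N(z).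
  by_contra hy
  rw [not_isUnit_iff_dvd hπ] at hy
  obtain ⟨y', rfl⟩ := hy
  have hx : π ∣ x := by
    apply hp.dvd_of_dvd_pow (n := 2)
    refine ⟨w - b * x * y' - a * c * π * y' ^ 2, ?_⟩
    rw [quadNorm] at hw
    linear_combination -hw
  obtain ⟨x', rfl⟩ := hx
  have : (w : 𝒪[F]) = π * quadNorm a b c x' y' := by
    apply mul_left_cancel₀ hπ0
    rw [hw]
    simp only [quadNorm]; ring
  exact (not_isUnit_iff_dvd hπ).2 ⟨_, this⟩ w.isUnit

/-- In the split case, the element `ϖ_L` corresponding to `(ϖ, 1)` is of the form `x + yω` with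
`y ∈ 𝔬ˣ`. -/
theorem exists_coordL_of_splitHom
    (H : StandardAssumptions (algebraMap 𝒪[F] F a) (algebraMap 𝒪[F] F b)
      (algebraMap 𝒪[F] F c)) {π : 𝒪[F]} (hπ : 𝓂[F] = Ideal.span {π}) {r : F}
    (hr : r ^ 2 = disc (algebraMap 𝒪[F] F a) (algebraMap 𝒪[F] F b) (algebraMap 𝒪[F] F c))
    {z : quadO a b c} (hz : splitHom _ _ _ r hr z = (algebraMap 𝒪[F] F π, 1)) :
    ∃ x y : 𝒪[F], z = coordL a b c x y ∧ IsUnit y ∧ quadNorm a b c x y = π ∧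
      IsUnit (2 * x + b * y) := by
  rw [splitHom_apply, Prod.mk.injEq] at hz
  obtain ⟨h1, h2⟩ := hz
  have htr : 2 * z.re = algebraMap 𝒪[F] F (π + 1) := by
    rw [map_add, map_one]
    linear_combination h1 + h2
  have hnm : z.re * z.re - disc (algebraMap 𝒪[F] F a) (algebraMap 𝒪[F] F b)
      (algebraMap 𝒪[F] F c) * z.im * z.im = algebraMap 𝒪[F] F π := by
    linear_combination (z.re + z.im * r) * h2 + z.im ^ 2 * hr + h1
  have hunit : ∀ e : 𝒪[F], IsUnit e → IsUnit (π + e) := fun e he => by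
    rw [add_comm]; exact isUnit_add_of_dvd hπ he dvd_rfl
  have hmem : z ∈ intL (algebraMap 𝒪[F] F a) (algebraMap 𝒪[F] F b) (algebraMap 𝒪[F] F c) := by
    refine ⟨Polynomial.X ^ 2 - Polynomial.C (π + 1) * Polynomial.X + Polynomial.C π, ?_, ?_⟩
    · monicity!
    · simp only [Polynomial.eval₂_add, Polynomial.eval₂_sub, Polynomial.eval₂_mul,
        Polynomial.eval₂_X, Polynomial.eval₂_C, IsScalarTower.algebraMap_apply 𝒪[F] F (quadO a b c), pow_two]
      rw [← htr, ← hnm]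
      ext
      · simp [QuadraticAlgebra.algebraMap_eq]
        ring
      · simp [QuadraticAlgebra.algebraMap_eq]
        ring
  obtain ⟨x, y, rfl⟩ := exists_coordL_of_mem H hmem
  have hN : quadNorm a b c x y = π := by
    apply algebraMap_integer_injective
    rw [← norm_coordL, QuadraticAlgebra.norm_def, ← hnm]
    ring
  have ht : 2 * x + b * y = π + 1 := by
    apply algebraMap_integer_injective
    rw [← htr, map_add, map_mul, map_mul, map_ofNat, coordL_re]
    ring
  refine ⟨x, y, rfl, ?_, hN, ?_⟩
  -- Trace π + 1 and norm π give y²d = (π + 1)² - 4π = (π - 1)², a unit.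
  · have e : y * (y * (b ^ 2 - 4 * a * c)) = (π + -1) ^ 2 := by
      rw [quadNorm] at hN
      linear_combination (2 * x + b * y + π + 1) * ht - 4 * hN
    exact isUnit_of_mul_isUnit_left (e ▸ (hunit _ isUnit_one.neg).pow 2)
  · rw [ht]
    exact hunit 1 isUnit_one

end QuadraticOrder

/-! ### Sublattices of index q as translates under Lˣ -/

section CosetValues

variable {F : Type*} [Field F] [ValuativeRel F]

theorem diagGL_mul_lineRep_none (ϖ : Fˣ) (c : 𝒪[F]ˣ) (m : ℕ) :
    diagGL ϖ m * Matrix.GeneralLinearGroup.map (algebraMap 𝒪[F] F) (lineRep c none) * diagGL ϖ 1 =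
      diagGL ϖ (m + 1) := by
  have : lineRep c none = 1 := rfl
  rw [this, map_one, mul_one, diagGL_mul]

theorem diagGL_coe_map {π : 𝒪[F]} {ϖ : Fˣ} (hϖ : algebraMap 𝒪[F] F π = ϖ) (m : ℕ) :
    (diagGL ϖ m).1 = (!![π ^ m, 0; 0, 1]).map (algebraMap 𝒪[F] F) := by
  rw [diagGL_coe]
  ext i j
  fin_cases i <;> fin_cases j <;> simp [← hϖ]

theorem diagGL_mul_lineRep_some_coe {π : 𝒪[F]} {ϖ : Fˣ} (hϖ : algebraMap 𝒪[F] F π = ϖ)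
    (c : 𝒪[F]ˣ) (m : ℕ) (r : 𝓀[F]) :
    (diagGL ϖ m * Matrix.GeneralLinearGroup.map (algebraMap 𝒪[F] F) (lineRep c (some r)) *
      diagGL ϖ 1).1 =
      (!![0, π ^ m * c; π, residueLift r]).map (algebraMap 𝒪[F] F) := by
  have : (Matrix.GeneralLinearGroup.map (algebraMap 𝒪[F] F) (lineRep c (some r))).1 =
    (!![0, (c : 𝒪[F]); 1, residueLift r]).map (algebraMap 𝒪[F] F) := rfl
  rw [Units.val_mul, Units.val_mul, this, diagGL_coe_map hϖ, diagGL_coe_map hϖ, ← Matrix.map_mul,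
    ← Matrix.map_mul]
  congr 1
  rw [Matrix.mul_fin_two, Matrix.mul_fin_two]
  simp

variable [TopologicalSpace F] [CharZero F] {a b : 𝒪[F]} {c : 𝒪[F]ˣ} {ψ : AddChar F ℂ}
  {Λ : torus (algebraMap 𝒪[F] F a) (algebraMap 𝒪[F] F b) (algebraMap 𝒪[F] F c) →* ℂˣ}
  {B : GSp4 F → ℂ}

/-- For r ≡ 0 every entry of [0, π^(m+1)c; π, r] is divisible by π, and the sublattice is
ϖ·diag(ϖ^m,1)𝔬². -/
theorem leviRestrict_lineRep_of_dvd (hB : IsBesselFunction _ _ _ ψ Λ B) {π : 𝒪[F]}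
    (hπ : 𝓂[F] = Ideal.span {π}) {ϖ : Fˣ} (hϖ : algebraMap 𝒪[F] F π = ϖ) (n m : ℕ) {r : 𝓀[F]}
    (hr : π ∣ (residueLift r : 𝒪[F])) :
    leviRestrict ϖ B n (diagGL ϖ (m + 1) *
      Matrix.GeneralLinearGroup.map (algebraMap 𝒪[F] F) (lineRep c (some r)) * diagGL ϖ 1) =
      (charL _ _ _ Λ (scalarL _ _ _ ϖ) : ℂ) * leviRestrict ϖ B n (diagGL ϖ m) := by
  obtain ⟨s, hs⟩ := hr
  refine leviRestrict_eq_charL_mul hB hπ ϖ n _ (k := !![0, (c : 𝒪[F]); 1, s]) ?_ ?_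
  · simp [Matrix.det_fin_two]
  · have hz : (scalarL (algebraMap 𝒪[F] F a) (algebraMap 𝒪[F] F b) (algebraMap 𝒪[F] F c) ϖ).1 =
        coordL a b (c : 𝒪[F]) π 0 := by
      ext <;> simp [scalarL, QuadraticAlgebra.algebraMap_eq, hϖ]
    rw [hz, quadHom_coordL, diagGL_mul_lineRep_some_coe hϖ, diagGL_coe_map hϖ, ← Matrix.map_mul,
      ← Matrix.map_mul, hs]
    congr 1
    rw [Matrix.mul_fin_two, Matrix.mul_fin_two]
    ext i j
    fin_cases i <;> fin_cases j <;> simp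
    ring

/-- The second column (π^m c, r) is u times the second column (yc, x) of the matrix of z = x + yω,
so k may be taken lower triangular with last entry u. The first column is then forced, and it is
integral because N(z) is a unit. -/
theorem leviRestrict_lineRep_of_isUnit (hB : IsBesselFunction _ _ _ ψ Λ B) {π : 𝒪[F]}
    (hπ : 𝓂[F] = Ideal.span {π}) {ϖ : Fˣ} (hϖ : algebraMap 𝒪[F] F π = ϖ) (n m : ℕ) {r : 𝓀[F]}
    {x y : 𝒪[F]} (u : 𝒪[F]ˣ) (hx : u * x = residueLift r) (hy : u * y = π ^ m)
    (hN : IsUnit (quadNorm a b (c : 𝒪[F]) x y))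
    (z : (quadO a b (c : 𝒪[F]))ˣ) (hz : z.1 = coordL a b (c : 𝒪[F]) x y) :
    leviRestrict ϖ B n (diagGL ϖ m *
      Matrix.GeneralLinearGroup.map (algebraMap 𝒪[F] F) (lineRep c (some r)) * diagGL ϖ 1) =
      (charL _ _ _ Λ z : ℂ) * leviRestrict ϖ B n (diagGL ϖ (m + 1)) := by
  obtain ⟨v, hv⟩ := hN
  have hv1 : (v : 𝒪[F]) * (v⁻¹ : 𝒪[F]ˣ) = 1 := v.mul_inv
  have hu1 : (u : 𝒪[F]) * (u⁻¹ : 𝒪[F]ˣ) = 1 := u.mul_inv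
  rw [quadNorm] at hv
  refine leviRestrict_eq_charL_mul hB hπ ϖ n _
    (k := !![-(c * (u⁻¹ : 𝒪[F]ˣ) * (v⁻¹ : 𝒪[F]ˣ)), 0; π * (x + y * b) * (v⁻¹ : 𝒪[F]ˣ), u]) ?_ ?_
  · rw [Matrix.det_fin_two_of, zero_mul, sub_zero]
    exact (((c.isUnit.mul (Units.isUnit _)).mul (Units.isUnit _)).neg).mul u.isUnit
  · rw [hz, quadHom_coordL, diagGL_mul_lineRep_some_coe hϖ, diagGL_coe_map hϖ, ← Matrix.map_mul,
      ← Matrix.map_mul]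
    congr 1
    rw [Matrix.mul_fin_two, Matrix.mul_fin_two, ← hx, pow_succ, ← hy]
    ext1 i j
    fin_cases i <;> fin_cases j <;> simp only [Fin.zero_eta, Fin.isValue, Matrix.of_apply,
      Matrix.cons_val', Matrix.cons_val_zero, Matrix.cons_val_fin_one, Fin.mk_one,
      Matrix.cons_val_one]
    · linear_combination ((x + y * b) * y * π * c * (v⁻¹ : 𝒪[F]ˣ)) * hu1
    · ring
    · linear_combination (-π) * hv1 + π * (v⁻¹ : 𝒪[F]ˣ) * hv -
        π * y ^ 2 * a * c * (v⁻¹ : 𝒪[F]ˣ) * hu1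
    · ring

/-- The matrix of z = x + yω and [0, c; π, r] both have determinant π up to a unit, and their second
columns (yc, x) and (c, r) span the same line modulo 𝔭. Hence they have the same column lattice. -/
theorem leviRestrict_lineRep_of_uniformizer (hB : IsBesselFunction _ _ _ ψ Λ B) {π : 𝒪[F]}
    (hπ : 𝓂[F] = Ideal.span {π}) {ϖ : Fˣ} (hϖ : algebraMap 𝒪[F] F π = ϖ) (n : ℕ)
    {r : 𝓀[F]} {x y : 𝒪[F]} (hy : IsUnit y) (v : 𝒪[F]ˣ)
    (hN : quadNorm a b (c : 𝒪[F]) x y = π * v) (hr : π ∣ x - y * residueLift r)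
    (z : (quadO a b (c : 𝒪[F]))ˣ) (hz : z.1 = coordL a b (c : 𝒪[F]) x y) :
    leviRestrict ϖ B n (diagGL ϖ 0 *
      Matrix.GeneralLinearGroup.map (algebraMap 𝒪[F] F) (lineRep c (some r)) * diagGL ϖ 1) =
      (charL _ _ _ Λ z : ℂ) * leviRestrict ϖ B n (diagGL ϖ 0) := by
  obtain ⟨u, rfl⟩ := hy
  obtain ⟨w, hw⟩ := hr
  have hv1 : (v : 𝒪[F]) * (v⁻¹ : 𝒪[F]ˣ) = 1 := v.mul_inv
  have hu1 : (u : 𝒪[F]) * (u⁻¹ : 𝒪[F]ˣ) = 1 := u.mul_inv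
  rw [quadNorm] at hN
  have hr' : residueLift r = (u⁻¹ : 𝒪[F]ˣ) * (x - π * w) := by
    linear_combination (-(u⁻¹ : 𝒪[F]ˣ) : 𝒪[F]) * hw - residueLift r * hu1
  have hN' : (v : 𝒪[F]) * π = x * (x + u * b) + u * u * a * c := by
    linear_combination -hN
  refine leviRestrict_eq_charL_mul hB hπ ϖ n _
    (k := !![-(u * c * (v⁻¹ : 𝒪[F]ˣ)), c * w * (v⁻¹ : 𝒪[F]ˣ); (x + u * b) * (v⁻¹ : 𝒪[F]ˣ),
      (u⁻¹ : 𝒪[F]ˣ) * (1 - (x + u * b) * w * (v⁻¹ : 𝒪[F]ˣ))]) ?_ ?_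
  · have : Matrix.det !![-((u : 𝒪[F]) * c * (v⁻¹ : 𝒪[F]ˣ)), c * w * (v⁻¹ : 𝒪[F]ˣ);
      (x + u * b) * (v⁻¹ : 𝒪[F]ˣ), (u⁻¹ : 𝒪[F]ˣ) * (1 - (x + u * b) * w * (v⁻¹ : 𝒪[F]ˣ))] =
      -((c : 𝒪[F]) * (v⁻¹ : 𝒪[F]ˣ)) := by
      rw [Matrix.det_fin_two_of]
      linear_combination (-(c : 𝒪[F]) * (v⁻¹ : 𝒪[F]ˣ) *
        (1 - (x + u * b) * w * (v⁻¹ : 𝒪[F]ˣ))) * hu1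
    rw [this]
    exact (c.isUnit.mul (Units.isUnit _)).neg
  · rw [hz, quadHom_coordL, diagGL_mul_lineRep_some_coe hϖ, diagGL_coe_map hϖ, ← Matrix.map_mul,
      ← Matrix.map_mul]
    congr 1
    rw [Matrix.mul_fin_two, Matrix.mul_fin_two, hr']
    ext1 i j
    fin_cases i <;> fin_cases j <;> simp only [Fin.zero_eta, Fin.isValue, Matrix.of_apply,
      Matrix.cons_val', Matrix.cons_val_zero, Matrix.cons_val_fin_one, Fin.mk_one,
      Matrix.cons_val_one, pow_zero]
    · ring
    · linear_combination (-(c : 𝒪[F]) * (1 - (x + u * b) * w * (v⁻¹ : 𝒪[F]ˣ))) * hu1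
    · linear_combination (-π) * hv1 + (v⁻¹ : 𝒪[F]ˣ) * hN'
    · linear_combination (π * w * (u⁻¹ : 𝒪[F]ˣ)) * hv1 -
        (w * (u⁻¹ : 𝒪[F]ˣ) * (v⁻¹ : 𝒪[F]ˣ)) * hN' - (u * a * c * w * (v⁻¹ : 𝒪[F]ˣ)) * hu1

/-- Conjugation by diag(ϖ^m,1) divides the upper right entry by ϖ^m. So units of 𝔬 + 𝔭^m ω stabilize
diag(ϖ^m,1)𝔬². -/
theorem leviRestrict_diagGL_eq (hB : IsBesselFunction _ _ _ ψ Λ B) {π : 𝒪[F]}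
    (hπ : 𝓂[F] = Ideal.span {π}) {ϖ : Fˣ} (hϖ : algebraMap 𝒪[F] F π = ϖ) (n m : ℕ)
    {x y : 𝒪[F]} (hN : IsUnit (quadNorm a b (c : 𝒪[F]) x (π ^ m * y)))
    (z : (quadO a b (c : 𝒪[F]))ˣ) (hz : z.1 = coordL a b (c : 𝒪[F]) x (π ^ m * y)) :
    leviRestrict ϖ B n (diagGL ϖ m) =
      (charL _ _ _ Λ z : ℂ) * leviRestrict ϖ B n (diagGL ϖ m) := by
  obtain ⟨v, hv⟩ := hN
  have hv1 : (v : 𝒪[F]) * (v⁻¹ : 𝒪[F]ˣ) = 1 := v.mul_inv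
  rw [quadNorm] at hv
  refine leviRestrict_eq_charL_mul hB hπ ϖ n _
    (k := (v⁻¹ : 𝒪[F]ˣ).1 • !![x, -(y * c); π ^ m * (π ^ m * y * a), x + π ^ m * y * b]) ?_ ?_
  · rw [Matrix.det_smul, Matrix.det_fin_two_of]
    refine ((Units.isUnit _).pow _).mul ?_
    convert v.isUnit using 1
    rw [hv]
    ring
  · rw [hz, quadHom_coordL, diagGL_coe_map hϖ, ← Matrix.map_mul, ← Matrix.map_mul]
    congr 1
    rw [Matrix.mul_smul, Matrix.mul_fin_two, Matrix.mul_fin_two]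
    ext1 i j
    fin_cases i <;> fin_cases j <;> simp only [Fin.zero_eta, Fin.isValue, Matrix.of_apply,
      Matrix.cons_val', Matrix.cons_val_zero, Matrix.cons_val_fin_one, Fin.mk_one,
      Matrix.cons_val_one, Matrix.smul_apply, smul_eq_mul]
    · linear_combination (-π ^ m) * hv1 + (π ^ m * (v⁻¹ : 𝒪[F]ˣ)) * hv
    · ring
    · ring
    · linear_combination (-1) * hv1 + ((v⁻¹ : 𝒪[F]ˣ) : 𝒪[F]) * hv

end CosetValues

/-! ### Existence of the conductor exponent m₀ -/

section Conductor

/-- The group `ℂˣ` has no small subgroups. -/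
theorem eq_one_of_norm_pow_sub_one_lt {w : ℂ} (h : ∀ k : ℕ, ‖w ^ 2 ^ k - 1‖ < 1 / 2) : w = 1 := by
  -- Within distance 1/2 of 1, squaring expands the distance to 1 by |w + 1| ≥ 3/2, so an orbit that
  -- stays there must start at 1.
  have hk : ∀ k : ℕ, (3 / 2 : ℝ) ^ k * ‖w - 1‖ ≤ ‖w ^ 2 ^ k - 1‖ := by
    intro k
    induction k with
    | zero => simp
    | succ k ih =>
      have e : w ^ 2 ^ (k + 1) - 1 = (w ^ 2 ^ k - 1) * (w ^ 2 ^ k + 1) := by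
        rw [pow_succ 2 k, pow_mul]; ring
      have h2 : 3 / 2 ≤ ‖w ^ 2 ^ k + 1‖ := by
        have h3 : ‖(2 : ℂ)‖ ≤ ‖w ^ 2 ^ k + 1‖ + ‖w ^ 2 ^ k - 1‖ := by
          have := norm_sub_le (w ^ 2 ^ k + 1) (w ^ 2 ^ k - 1)
          rwa [show w ^ 2 ^ k + 1 - (w ^ 2 ^ k - 1) = 2 by ring] at this
        rw [Complex.norm_ofNat] at h3
        linarith [h k]
      rw [e, norm_mul, pow_succ]
      calc (3 / 2 : ℝ) ^ k * (3 / 2) * ‖w - 1‖ = ((3 / 2 : ℝ) ^ k * ‖w - 1‖) * (3 / 2) := by ring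
        _ ≤ _ := by gcongr
  by_contra hw
  have hpos : 0 < ‖w - 1‖ := norm_pos_iff.2 (sub_ne_zero.2 hw)
  obtain ⟨k, hk'⟩ := pow_unbounded_of_one_lt (1 / ‖w - 1‖) (by norm_num : (1 : ℝ) < 3 / 2)
  rw [div_lt_iff₀ hpos] at hk'
  linarith [hk k, h k]

variable {F : Type*} [Field F] [ValuativeRel F]

/-- The group `(1 + 𝔭^m 𝔬_L) ∩ 𝔬_Lˣ`. -/
def unitFiltration (a b c : F) (ϖ : Fˣ) (m : ℕ) : Subgroup (quadL a b c)ˣ where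
  carrier := {z | z.1 ∈ intL a b c ∧ (z⁻¹).1 ∈ intL a b c ∧
    ∃ y ∈ intL a b c, z.1 = 1 + ((ϖ : F) ^ m) • y}
  one_mem' := ⟨one_mem _, by rw [inv_one]; exact one_mem _, 0, zero_mem _, by simp⟩
  mul_mem' := by
    rintro z w ⟨hz, hz', y, hy, e⟩ ⟨hw, hw', y', hy', e'⟩
    refine ⟨mul_mem hz hw, ?_, y + z.1 * y', add_mem hy (mul_mem hz hy'), ?_⟩
    · rw [mul_inv_rev]
      exact mul_mem hw' hz'
    · rw [Units.val_mul, e', mul_add, mul_one, mul_smul_comm, smul_add, ← add_assoc, ← e]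
  inv_mem' := by
    rintro z ⟨hz, hz', y, hy, e⟩
    refine ⟨hz', by rwa [inv_inv], -(y * (z⁻¹).1), neg_mem (mul_mem hy hz'), ?_⟩
    have h1 : z.1 * (z⁻¹).1 = 1 := z.mul_inv
    rw [e, add_mul, one_mul, smul_mul_assoc] at h1
    rw [smul_neg, ← h1]
    abel

theorem unitFiltration_anti {a b c : F} {π : 𝒪[F]} {ϖ : Fˣ} (hϖ : algebraMap 𝒪[F] F π = ϖ)
    {m n : ℕ} (h : m ≤ n) : unitFiltration a b c ϖ n ≤ unitFiltration a b c ϖ m := by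
  rintro z ⟨hz, hz', y, hy, e⟩
  refine ⟨hz, hz', (ϖ : F) ^ (n - m) • y, ?_, ?_⟩
  · have : (ϖ : F) ^ (n - m) • y = (π ^ (n - m)) • y := by
      rw [← IsScalarTower.algebraMap_smul F (π ^ (n - m)) y, map_pow, hϖ]
    rw [this]
    exact Subalgebra.smul_mem _ hy _
  · rw [e, smul_smul, ← pow_add, Nat.add_sub_cancel' h]

theorem tendsto_pow_mul_integer [TopologicalSpace F] [IsNonarchimedeanLocalField F] {π : 𝒪[F]}
    (hπ : 𝓂[F] = Ideal.span {π}) (u : ℕ → 𝒪[F]) :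
    Filter.Tendsto (fun m => algebraMap 𝒪[F] F (π ^ m * u m)) Filter.atTop (nhds 0) := by
  have hb := IsValuativeTopology.hasBasis_nhds_zero' F
  rw [hb.tendsto_right_iff]
  intro γ hγ
  have hlt : ValuativeRel.valuation F (algebraMap 𝒪[F] F π) < 1 :=
    (valuation_lt_one_iff hπ).2 dvd_rfl
  obtain ⟨N, hN⟩ := exists_pow_lt₀ hlt (Units.mk0 γ hγ)
  filter_upwards [Filter.eventually_ge_atTop N] with m hm
  rw [map_mul, map_mul, map_pow, map_pow]
  refine lt_of_le_of_lt (mul_le_of_le_one_right' (u m).2) ?_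
  exact (pow_le_pow_right_of_le_one' hlt.le hm).trans_lt hN

theorem tendsto_matrix_one_add [TopologicalSpace F] [IsNonarchimedeanLocalField F] {π : 𝒪[F]}
    (hπ : 𝓂[F] = Ideal.span {π}) (M : ℕ → Matrix (Fin 2) (Fin 2) F)
    (h : ∀ m, ∃ N : Matrix (Fin 2) (Fin 2) 𝒪[F],
      M m = 1 + (π ^ m • N).map (algebraMap 𝒪[F] F)) :
    Filter.Tendsto M Filter.atTop (nhds 1) := by
  choose N hN using h
  have : M = fun m => 1 + (π ^ m • N m).map (algebraMap 𝒪[F] F) := funext hN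
  rw [this]
  conv => rhs; rw [← add_zero (1 : Matrix (Fin 2) (Fin 2) F)]
  refine tendsto_const_nhds.add ?_
  refine tendsto_pi_nhds.2 fun i => tendsto_pi_nhds.2 fun j => ?_
  exact tendsto_pow_mul_integer hπ fun m => N m i j

variable [CharZero F]

theorem conductorExp_eq (a b c : F) (ϖ : Fˣ) (Λ : torus a b c →* ℂˣ) :
    conductorExp a b c ϖ Λ =
      sInf {m : ℕ | ∀ z ∈ unitFiltration a b c ϖ m, charL a b c Λ z = 1} := by
  rw [conductorExp]
  congr 1
  ext m
  exact ⟨fun h z hz => h z hz.1 hz.2.1 hz.2.2, fun h z h1 h2 h3 => h z ⟨h1, h2, h3⟩⟩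

theorem quadHom_eq_one_add {a b c : 𝒪[F]}
    (H : StandardAssumptions (algebraMap 𝒪[F] F a) (algebraMap 𝒪[F] F b) (algebraMap 𝒪[F] F c))
    {π : 𝒪[F]} {ϖ : Fˣ} (hϖ : algebraMap 𝒪[F] F π = ϖ) {m : ℕ} {z : (quadO a b c)ˣ}
    (hz : z ∈ unitFiltration _ _ _ ϖ m) : ∃ N : Matrix (Fin 2) (Fin 2) 𝒪[F],
      quadHom _ _ _ z.1 = 1 + (π ^ m • N).map (algebraMap 𝒪[F] F) := by
  obtain ⟨-, -, y, hy, e⟩ := hz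
  obtain ⟨p, q, rfl⟩ := exists_coordL_of_mem H hy
  refine ⟨!![p + q * b, q * c; -(q * a), p], ?_⟩
  rw [e, map_add, map_one, map_smul, quadHom_coordL]
  congr 1
  ext i j
  rw [Matrix.smul_apply, Matrix.map_apply, Matrix.map_apply, Matrix.smul_apply, smul_eq_mul,
    smul_eq_mul, map_mul, map_pow, hϖ]

variable [TopologicalSpace F] [IsNonarchimedeanLocalField F]

/-- A continuous character of `Lˣ` is trivial on some `(1 + 𝔭^m 𝔬_L) ∩ 𝔬_Lˣ`. -/
theorem exists_charL_eq_one {a b c : 𝒪[F]}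
    (H : StandardAssumptions (algebraMap 𝒪[F] F a) (algebraMap 𝒪[F] F b) (algebraMap 𝒪[F] F c))
    {π : 𝒪[F]} (hπ : 𝓂[F] = Ideal.span {π}) {ϖ : Fˣ} (hϖ : algebraMap 𝒪[F] F π = ϖ)
    {Λ : torus (algebraMap 𝒪[F] F a) (algebraMap 𝒪[F] F b) (algebraMap 𝒪[F] F c) →* ℂˣ}
    (hΛ : Continuous Λ) : ∃ m : ℕ, ∀ z ∈ unitFiltration (algebraMap 𝒪[F] F a) (algebraMap 𝒪[F] F b)
      (algebraMap 𝒪[F] F c) ϖ m, charL _ _ _ Λ z = 1 := by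
  by_contra! hcon
  have hz : ∀ m, ∃ z ∈ unitFiltration (algebraMap 𝒪[F] F a) (algebraMap 𝒪[F] F b)
      (algebraMap 𝒪[F] F c) ϖ m, 1 / 2 ≤ ‖(charL _ _ _ Λ z : ℂ) - 1‖ := by
    intro m
    obtain ⟨z, hz, hne⟩ := hcon m
    by_contra! hlt
    refine hne (Units.ext (eq_one_of_norm_pow_sub_one_lt fun k => ?_))
    have := hlt _ (pow_mem hz (2 ^ k))
    rwa [map_pow, Units.val_pow_eq_pow_val] at this
  choose z hz hn using hz
  -- Convergence in the unit group needs the inverses to converge too; they lie in the same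
  -- filtration groups.
  have ht : Filter.Tendsto (fun m => toTorus _ _ _ (z m)) Filter.atTop (nhds 1) := by
    rw [tendsto_subtype_rng, Units.isInducing_embedProduct.tendsto_nhds_iff]
    refine Filter.Tendsto.prodMk_nhds ?_ ?_
    · exact tendsto_matrix_one_add hπ _ fun m => quadHom_eq_one_add H hϖ (hz m)
    · refine (MulOpposite.continuous_op.tendsto _).comp (g := MulOpposite.op)
        (y := nhds ((1 : (Matrix (Fin 2) (Fin 2) F)ˣ)⁻¹).1) ?_
      have := tendsto_matrix_one_add hπ _ fun m => quadHom_eq_one_add H hϖ (inv_mem (hz m))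
      rw [inv_one]
      exact this
  have hc : Filter.Tendsto (fun m => ‖(charL _ _ _ Λ (z m) : ℂ) - 1‖) Filter.atTop (nhds 0) := by
    have h1 := (Units.continuous_val.comp hΛ).continuousAt.tendsto.comp ht
    have h2 := (h1.sub_const 1).norm
    simpa [charL] using h2
  obtain ⟨m, hm⟩ := (hc.eventually (gt_mem_nhds (by norm_num : (0 : ℝ) < 1 / 2))).exists
  exact absurd (hn m) (not_le.2 hm)

/-- By continuity of Λ the set defining m₀ is nonempty, so its infimum is attained and is not the
default value 0 of the empty set. The filtration is decreasing, which covers all m ≥ m₀. -/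
theorem charL_eq_one_of_mem {a b c : 𝒪[F]}
    (H : StandardAssumptions (algebraMap 𝒪[F] F a) (algebraMap 𝒪[F] F b) (algebraMap 𝒪[F] F c))
    {π : 𝒪[F]} (hπ : 𝓂[F] = Ideal.span {π}) {ϖ : Fˣ} (hϖ : algebraMap 𝒪[F] F π = ϖ)
    {Λ : torus (algebraMap 𝒪[F] F a) (algebraMap 𝒪[F] F b) (algebraMap 𝒪[F] F c) →* ℂˣ}
    (hΛ : Continuous Λ) {m : ℕ} (hm : conductorExp _ _ _ ϖ Λ ≤ m) {z : (quadO a b c)ˣ}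
    (hz : z ∈ unitFiltration _ _ _ ϖ m) : charL _ _ _ Λ z = 1 := by
  have h := Nat.sInf_mem (s := {m : ℕ | ∀ z ∈ unitFiltration (algebraMap 𝒪[F] F a)
    (algebraMap 𝒪[F] F b) (algebraMap 𝒪[F] F c) ϖ m, charL _ _ _ Λ z = 1})
    (exists_charL_eq_one H hπ hϖ hΛ)
  rw [← conductorExp_eq] at h
  exact h z (unitFiltration_anti hϖ hm hz)

end Conductor

/-! ### Vanishing below m₀ and the recurrence in m -/

section Recurrence

theorem sum_eq_card_mul_add {ι : Type*} [Fintype ι] [DecidableEq ι] (f : ι → ℂ) (C D : ℂ) (i : ι)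
    (hi : f i = D) (hf : ∀ j, j ≠ i → f j = C) : ∑ j, f j = (Fintype.card ι - 1) * C + D := by
  have : ∀ j, f j = C + if j = i then D - C else 0 := fun j => by
    split_ifs with h
    · rw [h, hi]; ring
    · rw [hf j h, add_zero]
  simp_rw [this, Finset.sum_add_distrib, Finset.sum_ite_eq', Finset.sum_const, Finset.card_univ]
  simp
  ring

theorem sum_eq_card_mul_add_add {ι : Type*} [Fintype ι] [DecidableEq ι] (f : ι → ℂ) (C D E : ℂ)
    {i j : ι} (hij : i ≠ j) (hi : f i = D) (hj : f j = E)
    (hf : ∀ k, k ≠ i → k ≠ j → f k = C) : ∑ k, f k = (Fintype.card ι - 2) * C + D + E := by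
  have : ∀ k, f k = C + (if k = i then D - C else 0) + if k = j then E - C else 0 := fun k => by
    by_cases h : k = i
    · subst h
      rw [if_pos rfl, if_neg hij, hi]; ring
    · by_cases h' : k = j
      · subst h'
        rw [if_neg h, if_pos rfl, hj]; ring
      · rw [if_neg h, if_neg h', hf k h h']; ring
  simp_rw [this, Finset.sum_add_distrib, Finset.sum_ite_eq', Finset.sum_const, Finset.card_univ]
  simp
  ring

variable {F : Type*} [Field F] [ValuativeRel F]

/-- From x ≡ ys follows N(x + yω) ≡ y²N(s + ω) modulo 𝔭. -/
theorem dvd_quadNorm_one {π : 𝒪[F]} {a b c x y s v : 𝒪[F]} (hy : IsUnit y)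
    (hN : quadNorm a b c x y = π * v) (hs : π ∣ x - y * s) : π ∣ quadNorm a b c s 1 := by
  obtain ⟨w, hw⟩ := hs
  have : π ∣ y ^ 2 * quadNorm a b c s 1 := by
    refine ⟨v - w * (x + y * s + b * y), ?_⟩
    simp only [quadNorm] at hN ⊢
    linear_combination hN - (x + y * s + b * y) * hw
  exact (hy.pow 2).dvd_mul_left.1 this

theorem exists_dvd_sub_mul_residueLift {π : 𝒪[F]} (hπ : 𝓂[F] = Ideal.span {π}) (x : 𝒪[F])
    {y : 𝒪[F]} (hy : IsUnit y) : ∃ r : 𝓀[F], π ∣ x - y * residueLift r := by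
  obtain ⟨u, rfl⟩ := hy
  obtain ⟨r, hr⟩ := exists_dvd_sub_residueLift hπ ((u⁻¹ : 𝒪[F]ˣ) * x)
  refine ⟨r, ?_⟩
  have : x - u * residueLift r = u * ((u⁻¹ : 𝒪[F]ˣ) * x - residueLift r) := by
    rw [mul_sub, Units.mul_inv_cancel_left]
  rw [this]
  exact hr.mul_left _

theorem mem_unitFiltration_of_eq_coordL [CharZero F] {a b c : 𝒪[F]} {π : 𝒪[F]} {ϖ : Fˣ}
    (hϖ : algebraMap 𝒪[F] F π = ϖ) {m : ℕ} {p q : 𝒪[F]}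
    (hN : IsUnit (quadNorm a b c (1 + π ^ m * p) (π ^ m * q))) {z : (quadO a b c)ˣ}
    (hz : z.1 = coordL a b c (1 + π ^ m * p) (π ^ m * q)) :
    z ∈ unitFiltration _ _ _ ϖ m := by
  obtain ⟨z', hz', h1, h2⟩ := exists_unit_coordL a b c hN
  obtain rfl : z = z' := Units.ext (hz.trans hz'.symm)
  refine ⟨h1, h2, coordL a b c p q, coordL_mem a b c p q, ?_⟩
  rw [hz]
  ext
  · simp [← hϖ, QuadraticAlgebra.re_one]
    ring
  · simp [← hϖ, QuadraticAlgebra.im_one]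
    ring

theorem exists_eq_coordL_of_mem_unitFiltration [CharZero F] {a b c : 𝒪[F]}
    (H : StandardAssumptions (algebraMap 𝒪[F] F a) (algebraMap 𝒪[F] F b) (algebraMap 𝒪[F] F c))
    {π : 𝒪[F]} {ϖ : Fˣ} (hϖ : algebraMap 𝒪[F] F π = ϖ) {m : ℕ} {z : (quadO a b c)ˣ}
    (hz : z ∈ unitFiltration _ _ _ ϖ m) : ∃ p q : 𝒪[F],
      z.1 = coordL a b c p (π ^ m * q) ∧ IsUnit (quadNorm a b c p (π ^ m * q)) := by
  obtain ⟨-, h2, y, hy, e⟩ := hz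
  obtain ⟨p, q, rfl⟩ := exists_coordL_of_mem H hy
  obtain ⟨s, t, hst⟩ := exists_coordL_of_mem H h2
  have e' : z.1 = coordL a b c (1 + π ^ m * p) (π ^ m * q) := by
    rw [e]
    ext
    · simp [← hϖ, QuadraticAlgebra.re_one]
      ring
    · simp [← hϖ, QuadraticAlgebra.im_one]
      ring
  refine ⟨_, q, e', .of_mul_eq_one (quadNorm a b c s t) ?_⟩
  apply algebraMap_integer_injective
  rw [map_mul, ← norm_coordL, ← norm_coordL, ← e', ← hst, ← map_mul, Units.mul_inv, map_one,
    map_one]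

variable [TopologicalSpace F] [IsNonarchimedeanLocalField F]

theorem one_lt_resCard (F : Type*) [Field F] [ValuativeRel F] [TopologicalSpace F]
    [IsNonarchimedeanLocalField F] : 1 < Nat.card 𝓀[F] := Finite.one_lt_card

variable [CharZero F] {a b : 𝒪[F]} {c : 𝒪[F]ˣ} {ψ : AddChar F ℂ}
  {Λ : torus (algebraMap 𝒪[F] F a) (algebraMap 𝒪[F] F b) (algebraMap 𝒪[F] F c) →* ℂˣ}
  {B : GSp4 F → ℂ}

/-- `B(h(l, m₀ - 1)) = 0` if `m₀ > 0`. -/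
theorem apply_hElt_eq_zero
    (H : StandardAssumptions (algebraMap 𝒪[F] F a) (algebraMap 𝒪[F] F b) (algebraMap 𝒪[F] F c))
    (hB : IsBesselFunction _ _ _ ψ Λ B) {π : 𝒪[F]} (hπ : 𝓂[F] = Ideal.span {π}) {ϖ : Fˣ}
    (hϖ : algebraMap 𝒪[F] F π = ϖ) (l m : ℕ) (hm : m < conductorExp _ _ _ ϖ Λ) :
    B (hElt ϖ l m) = 0 := by
  rw [conductorExp_eq] at hm
  have := Nat.notMem_of_lt_sInf hm
  simp only [Set.mem_ofPred_eq, not_forall] at this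
  obtain ⟨z, hz, hne⟩ := this
  obtain ⟨p, q, e, hN⟩ := exists_eq_coordL_of_mem_unitFiltration H hϖ hz
  have h := leviRestrict_diagGL_eq hB hπ hϖ (l + m) m hN z e
  rw [apply_hElt_eq ϖ B l m]
  by_contra h0
  apply hne
  apply Units.ext
  exact mul_right_cancel₀ h0 (by rw [← h, Units.val_one, one_mul])

variable [MeasurableSpace (GSp4 F)] [BorelSpace (GSp4 F)]

/-- The class r = 0 gives the lattice of diag(ϖ^m,1) scaled by ϖ. The other q - 1 classes and `none`
give that of diag(ϖ^(m+2),1). Since n = l + m + 2 is common to all terms, the scaled one is read as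
B(h(l+2,m)). -/
theorem hecke_zero_one_recurrence
    (H : StandardAssumptions (algebraMap 𝒪[F] F a) (algebraMap 𝒪[F] F b) (algebraMap 𝒪[F] F c))
    (hB : IsBesselFunction _ _ _ ψ Λ B) (hψ : ∀ x ∈ 𝒪[F], ψ x = 1) {π : 𝒪[F]}
    (hπ : 𝓂[F] = Ideal.span {π}) {ϖ : Fˣ} (hϖ : algebraMap 𝒪[F] F π = ϖ) (hΛ : Continuous Λ)
    (ν : Measure (GSp4 F)) [ν.IsHaarMeasure] (l m : ℕ)
    (hm : conductorExp _ _ _ ϖ Λ ≤ m + 1) :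
    hecke ν (hElt ϖ 0 1) B (hElt ϖ l (m + 1 : ℕ)) = resCard F ^ 3 *
      (resCard F * B (hElt ϖ l (m + 2 : ℕ)) +
        (charL _ _ _ Λ (scalarL _ _ _ ϖ) : ℂ) * B (hElt ϖ (l + 2 : ℕ) m)) := by
  classical
  have := Fintype.ofFinite 𝓀[F]
  rw [hecke_zero_one_apply_hElt hB hψ hπ hϖ ν c, Fintype.sum_option, diagGL_mul_lineRep_none]
  have h0 : π ∣ (residueLift (0 : 𝓀[F]) : 𝒪[F]) := by
    rw [← residue_eq_zero_iff_dvd hπ, residue_residueLift]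
  rw [sum_eq_card_mul_add _ (leviRestrict ϖ B (l + (m + 1) + 1) (diagGL ϖ (m + 1 + 1)))
    ((charL _ _ _ Λ (scalarL _ _ _ ϖ) : ℂ) * leviRestrict ϖ B (l + (m + 1) + 1) (diagGL ϖ m)) 0]
  · rw [apply_hElt_eq ϖ B l (m + 2), apply_hElt_eq ϖ B (l + 2) m, resCard, Nat.card_eq_fintype_card,
      show l + 2 + m = l + (m + 1) + 1 by ring, show l + (m + 2) = l + (m + 1) + 1 by ring]
    ring
  · exact leviRestrict_lineRep_of_dvd hB hπ hϖ _ _ h0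
  · intro r hr
    have hu : IsUnit (residueLift r : 𝒪[F]) := by
      by_contra hu
      rw [not_isUnit_iff_dvd hπ, ← residue_eq_zero_iff_dvd hπ, residue_residueLift] at hu
      exact hr hu
    obtain ⟨u, hu⟩ := hu
    -- For a unit u lifting r the translating element is 1 + π^(m+1)u⁻¹ω. Its norm is 1 modulo 𝔭,
    -- and Λ is trivial on it because m + 1 ≥ m₀.
    have hN : IsUnit (quadNorm a b (c : 𝒪[F]) (1 + π ^ (m + 1) * 0)
        (π ^ (m + 1) * (u⁻¹ : 𝒪[F]ˣ))) := by
      have := isUnit_add_of_dvd hπ (isUnit_one (M := 𝒪[F]))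
        (y := π * (b * (π ^ m * (u⁻¹ : 𝒪[F]ˣ)) +
          a * c * π * (π ^ m * (u⁻¹ : 𝒪[F]ˣ)) ^ 2)) (dvd_mul_right _ _)
      convert this using 1
      simp only [quadNorm]
      ring
    obtain ⟨z, hz, -⟩ := exists_unit_coordL a b (c : 𝒪[F]) hN
    rw [leviRestrict_lineRep_of_isUnit hB hπ hϖ _ (m + 1) u (by rw [← hu]; ring)
      (by rw [mul_left_comm, Units.mul_inv, mul_one]) hN z hz,
      charL_eq_one_of_mem H hπ hϖ hΛ hm (mem_unitFiltration_of_eq_coordL hϖ hN hz),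
      Units.val_one, one_mul]

/-- The value at `h(l,1)` in the unramified situation `m₀ = 0`. -/
theorem hecke_zero_one_apply_hElt_zero
    (H : StandardAssumptions (algebraMap 𝒪[F] F a) (algebraMap 𝒪[F] F b) (algebraMap 𝒪[F] F c))
    (hB : IsBesselFunction _ _ _ ψ Λ B) (hψ : ∀ x ∈ 𝒪[F], ψ x = 1) {π : 𝒪[F]}
    (hπ : 𝓂[F] = Ideal.span {π}) {ϖ : Fˣ} (hϖ : algebraMap 𝒪[F] F π = ϖ) (hΛ : Continuous Λ)
    (ν : Measure (GSp4 F)) [ν.IsHaarMeasure]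
    (ϖL : (quadO a b (c : 𝒪[F]))ˣ) (hϖL : IsUniformizerL _ _ _ ϖ ϖL) (l : ℕ)
    (h0 : conductorExp _ _ _ ϖ Λ = 0) :
    hecke ν (hElt ϖ 0 1) B (hElt ϖ l 0) = resCard F ^ 3 *
      if legendreL (algebraMap 𝒪[F] F a) (algebraMap 𝒪[F] F b) (algebraMap 𝒪[F] F c) = -1 then
        (resCard F + 1) * B (hElt ϖ l 1)
      else if legendreL (algebraMap 𝒪[F] F a) (algebraMap 𝒪[F] F b) (algebraMap 𝒪[F] F c) = 0 then
        resCard F * B (hElt ϖ l 1) + (charL _ _ _ Λ ϖL : ℂ) * B (hElt ϖ (l + 1) 0)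
      else (resCard F - 1) * B (hElt ϖ l 1) +
        ((charL _ _ _ Λ ϖL : ℂ) + (charL _ _ _ Λ (star ϖL) : ℂ)) * B (hElt ϖ (l + 1) 0) := by
  classical
  have := Fintype.ofFinite 𝓀[F]
  have hπ0 : π ≠ 0 := by
    rintro rfl
    rw [map_zero] at hϖ
    exact ϖ.ne_zero hϖ.symm
  have hsum := hecke_zero_one_apply_hElt hB hψ hπ hϖ ν c l 0
  rw [Fintype.sum_option, diagGL_mul_lineRep_none, Nat.cast_zero] at hsum
  have e1 : B (hElt ϖ l 1) = leviRestrict ϖ B (l + 0 + 1) (diagGL ϖ (0 + 1)) := by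
    simpa using apply_hElt_eq ϖ B l 1
  have e0 : B (hElt ϖ (l + 1) 0) = leviRestrict ϖ B (l + 0 + 1) (diagGL ϖ 0) := by
    have := apply_hElt_eq ϖ B (l + 1) 0
    simpa using this
  have hq : resCard F = Fintype.card 𝓀[F] := by rw [resCard, Nat.card_eq_fintype_card]
  rw [hsum, e1, e0, hq]
  congr 1
  -- If N(r + ω) is a unit, r + ω lies in 𝔬_Lˣ, on which Λ is trivial since m₀ = 0. Only roots of X²
  -- + bX + ac modulo 𝔭 behave differently.
  have hgen : ∀ r : 𝓀[F], IsUnit (quadNorm a b (c : 𝒪[F]) (residueLift r) 1) →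
      leviRestrict ϖ B (l + 0 + 1) (diagGL ϖ 0 *
        Matrix.GeneralLinearGroup.map (algebraMap 𝒪[F] F) (lineRep c (some r)) * diagGL ϖ 1) =
      leviRestrict ϖ B (l + 0 + 1) (diagGL ϖ (0 + 1)) := by
    intro r hN
    obtain ⟨z, hz, -⟩ := exists_unit_coordL a b (c : 𝒪[F]) hN
    have hm : z ∈ unitFiltration _ _ _ ϖ 0 := by
      refine mem_unitFiltration_of_eq_coordL hϖ (p := residueLift r - 1) (q := 1) ?_ ?_
      · convert hN using 2 <;> ring
      · rw [hz]
        congr 1 <;> ring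
    rw [leviRestrict_lineRep_of_isUnit hB hπ hϖ _ 0 1 (by simp) (by simp) hN z hz,
      charL_eq_one_of_mem H hπ hϖ hΛ h0.le hm, Units.val_one, one_mul]
  by_cases hsq : IsSquare
    (disc (algebraMap 𝒪[F] F a) (algebraMap 𝒪[F] F b) (algebraMap 𝒪[F] F c))
  · have hleg : legendreL (algebraMap 𝒪[F] F a) (algebraMap 𝒪[F] F b) (algebraMap 𝒪[F] F c) = 1 := by
      rw [legendreL, if_pos hsq]
    rw [hleg, if_neg (by norm_num), if_neg one_ne_zero]
    obtain ⟨r, hr, hz⟩ := hϖL.2 hsq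
    rw [← hϖ] at hz
    obtain ⟨x, y, hxy, hy, hN, ht⟩ := exists_coordL_of_splitHom H hπ hr hz
    have hN1 : quadNorm a b (c : 𝒪[F]) x y = π * (1 : 𝒪[F]ˣ) := by simpa using hN
    have hN2 : quadNorm a b (c : 𝒪[F]) (x + b * y) (-y) = π * (1 : 𝒪[F]ˣ) := by
      rw [← hN1]; simp only [quadNorm]; ring
    have hstar : (star ϖL).1 = coordL a b (c : 𝒪[F]) (x + b * y) (-y) := by
      rw [Units.coe_star, hxy, coordL_star]
    obtain ⟨r₁, hr₁⟩ := exists_dvd_sub_mul_residueLift hπ x hy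
    obtain ⟨r₂, hr₂⟩ := exists_dvd_sub_mul_residueLift hπ (x + b * y) hy.neg
    -- Equal classes would make π divide the trace 2x + by = π + 1 of ϖ_L, a unit.
    have hne : r₁ ≠ r₂ := by
      rintro rfl
      have := dvd_add hr₁ hr₂
      refine (not_isUnit_iff_dvd hπ).2 ?_ ht
      convert this using 1
      ring
    rw [sum_eq_card_mul_add_add _ (leviRestrict ϖ B (l + 0 + 1) (diagGL ϖ (0 + 1))) _ _ hne
      (leviRestrict_lineRep_of_uniformizer hB hπ hϖ (l + 0 + 1) hy 1 hN1 hr₁ ϖL hxy)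
      (leviRestrict_lineRep_of_uniformizer hB hπ hϖ (l + 0 + 1) hy.neg 1 hN2 hr₂ (star ϖL) hstar)]
    · ring
    · intro k hk1 hk2
      apply hgen
      by_contra hk
      rw [not_isUnit_iff_dvd hπ] at hk
      -- A root k satisfies k ≡ r₁ or k ≡ -r₁ - b, and the latter is r₂.
      rcases dvd_or_dvd_of_dvd_quadNorm hπ hk (dvd_quadNorm_one hy hN1 hr₁) with h | h
      · exact hk1 (residueLift_injective_mod hπ h)
      · apply hk2
        apply residueLift_injective_mod hπ
        have h' : π ∣ -y * (residueLift k - residueLift r₂) := by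
          have := dvd_sub (dvd_sub hr₂ hr₁) (h.mul_left y)
          convert this using 1
          ring
        exact hy.neg.dvd_mul_left.1 h'
  · by_cases hmax : (Ideal.map (algebraMap 𝒪[F] (intL (algebraMap 𝒪[F] F a) (algebraMap 𝒪[F] F b)
      (algebraMap 𝒪[F] F c))) 𝓂[F]).IsMaximal
    · have hleg : legendreL (algebraMap 𝒪[F] F a) (algebraMap 𝒪[F] F b)
          (algebraMap 𝒪[F] F c) = -1 := by
        rw [legendreL, if_neg hsq, if_pos hmax]
      rw [if_pos hleg, Finset.sum_congr rfl fun r _ =>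
        hgen r (isUnit_quadNorm_of_isMaximal H hπ hmax _), Finset.sum_const, Finset.card_univ,
        nsmul_eq_mul]
      ring
    · have hleg : legendreL (algebraMap 𝒪[F] F a) (algebraMap 𝒪[F] F b)
          (algebraMap 𝒪[F] F c) = 0 := by
        rw [legendreL, if_neg hsq, if_neg hmax]
      rw [hleg, if_neg (by norm_num), if_pos rfl]
      obtain ⟨hz, hzmax⟩ := hϖL.1 hsq
      obtain ⟨x, y, v, hxy, hy, hN⟩ := exists_coordL_of_uniformizer H hπ hπ0 hmax hz hzmax
      obtain ⟨r₁, hr₁⟩ := exists_dvd_sub_mul_residueLift hπ x hy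
      rw [sum_eq_card_mul_add _ (leviRestrict ϖ B (l + 0 + 1) (diagGL ϖ (0 + 1))) _ r₁
        (leviRestrict_lineRep_of_uniformizer hB hπ hϖ (l + 0 + 1) hy v hN hr₁ ϖL hxy)]
      · ring
      · intro k hk1
        apply hgen
        by_contra hk
        rw [not_isUnit_iff_dvd hπ] at hk
        exact hk1 (residueLift_injective_mod hπ
          (dvd_sub_of_dvd_quadNorm hπ hsq hk (dvd_quadNorm_one hy hN hr₁)))

end Recurrence

/-! ### Summation of the generating series and the proposition -/

/-- A sequence satisfying a linear recurrence of order two has a rational generating series. -/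
theorem mk_eq_mul_inv_of_recurrence {s : ℕ → ℂ} {k p q : ℂ} (h1 : s 1 = (p - k) * s 0)
    (h2 : ∀ n, s (n + 2) = p * s (n + 1) - q * s n) :
    PowerSeries.mk s = (1 - PowerSeries.C k * PowerSeries.X) *
      (1 - PowerSeries.C p * PowerSeries.X + PowerSeries.C q * PowerSeries.X ^ 2)⁻¹ *
        PowerSeries.C (s 0) := by
  have hD : PowerSeries.constantCoeff
      (1 - PowerSeries.C p * PowerSeries.X + PowerSeries.C q * PowerSeries.X ^ 2) ≠ 0 := by
    simp
  rw [mul_right_comm, PowerSeries.eq_mul_inv_iff_mul_eq hD]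
  ext n
  have e : PowerSeries.mk s *
      (1 - PowerSeries.C p * PowerSeries.X + PowerSeries.C q * PowerSeries.X ^ 2) =
      PowerSeries.mk s - PowerSeries.C p * (PowerSeries.mk s * PowerSeries.X) +
        PowerSeries.C q * (PowerSeries.mk s * PowerSeries.X ^ 2) := by ring
  have e' : (1 - PowerSeries.C k * PowerSeries.X) * PowerSeries.C (s 0) =
      PowerSeries.C (s 0) - PowerSeries.C (k * s 0) * PowerSeries.X := by
    rw [map_mul]; ring
  rw [e, e']
  rcases n with _ | _ | n
  · simp
  · simp [PowerSeries.coeff_succ_mul_X, PowerSeries.coeff_mul_X_pow', PowerSeries.coeff_C,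
      PowerSeries.coeff_succ_C, h1]
    ring
  · simp [PowerSeries.coeff_succ_mul_X, PowerSeries.coeff_mul_X_pow', h2]

end BesselGSp4

theorem proposition6p1
    {F : Type*} [Field F] [CharZero F] [ValuativeRel F] [TopologicalSpace F]
    [IsNonarchimedeanLocalField F]
    (ϖ : Fˣ) (hϖ : IsUniformizer ϖ)
    (ψ : AddChar F ℂ) (hψ : ∀ x ∈ 𝒪[F], ψ x = 1) (hψ' : ∃ x ∈ 𝒪[F], ψ ((ϖ : F)⁻¹ * x) ≠ 1)
    (a b c : F) (habc : StandardAssumptions a b c)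
    (ϖL : (quadL a b c)ˣ) (hϖL : IsUniformizerL a b c ϖ ϖL)
    (Λ : torus a b c →* ℂˣ) (hΛ : Continuous Λ)
    [MeasurableSpace (GSp4 F)] [BorelSpace (GSp4 F)]
    (ν : Measure (GSp4 F)) [ν.IsHaarMeasure]
    (B : GSp4 F → ℂ) (hB : IsBesselFunction a b c ψ Λ B)
    (lam mu : ℂ)
    (hlam : hecke ν (hElt ϖ 1 0) B = lam • B)
    (hmu : hecke ν (hElt ϖ 0 1) B = mu • B) :
    (∀ l m : ℕ, B (hElt ϖ (l + 1) m) = lam * (resCard F) ^ (-3 : ℤ) * B (hElt ϖ l m)) ∧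
    (∀ l : ℕ,
      (PowerSeries.mk fun k : ℕ => B (hElt ϖ l (conductorExp a b c ϖ Λ + k : ℕ))) =
        (1 - PowerSeries.C (kappa a b c ϖ ϖL Λ lam mu * (resCard F) ^ (-4 : ℤ)) * PowerSeries.X) *
        (1 - PowerSeries.C (mu * (resCard F) ^ (-4 : ℤ)) * PowerSeries.X
          + PowerSeries.C (lam ^ 2 * (resCard F) ^ (-7 : ℤ) * (charL a b c Λ (scalarL a b c ϖ) : ℂ))
            * PowerSeries.X ^ 2)⁻¹ *
        PowerSeries.C (B (hElt ϖ l (conductorExp a b c ϖ Λ)))) := by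
  obtain ⟨hϖ', hπ⟩ := hϖ
  obtain ⟨π, hϖ, hπ⟩ : ∃ π : 𝒪[F], algebraMap 𝒪[F] F π = ϖ ∧ 𝓂[F] = Ideal.span {π} :=
    ⟨⟨ϖ, hϖ'⟩, rfl, hπ⟩
  obtain ⟨a, rfl⟩ := exists_algebraMap_eq habc.a_mem
  obtain ⟨b, rfl⟩ := exists_algebraMap_eq habc.b_mem
  obtain ⟨c, rfl⟩ : ∃ c' : 𝒪[F]ˣ, algebraMap 𝒪[F] F c' = c :=
    ⟨⟨⟨c, habc.c_mem⟩, ⟨c⁻¹, habc.c_inv_mem.2⟩, Subtype.ext (mul_inv_cancel₀ habc.c_inv_mem.1),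
      Subtype.ext (inv_mul_cancel₀ habc.c_inv_mem.1)⟩, rfl⟩
  have hcard : (1 : ℝ) < Nat.card 𝓀[F] := by exact_mod_cast one_lt_resCard F
  have hq0 : resCard F ≠ 0 := by
    rw [resCard]
    exact_mod_cast (zero_lt_one.trans hcard).ne'
  have hq1 : resCard F - 1 ≠ 0 := by
    rw [resCard, sub_ne_zero]
    exact_mod_cast hcard.ne'
  have hq2 : resCard F + 1 ≠ 0 := by
    rw [resCard]
    exact_mod_cast (Nat.card 𝓀[F]).succ_ne_zero
  have hl : ∀ l m : ℕ, B (hElt ϖ (l + 1) m) = lam * (resCard F) ^ (-3 : ℤ) * B (hElt ϖ l m) := by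
    intro l m
    have h := congrFun hlam (hElt ϖ l m)
    rw [hecke_one_zero_apply_hElt hB hψ hπ hϖ ν l m, Pi.smul_apply, smul_eq_mul] at h
    rw [mul_right_comm, ← h, zpow_neg, zpow_ofNat, mul_right_comm, mul_inv_cancel₀ (pow_ne_zero 3 hq0),
      one_mul]
  refine ⟨hl, fun l => ?_⟩
  have hl2 : ∀ m : ℕ, B (hElt ϖ (l + 2 : ℕ) m) =
      lam ^ 2 * (resCard F) ^ (-6 : ℤ) * B (hElt ϖ l m) := by
    intro m
    have h := hl (l + 1) m
    rw [Nat.cast_add, Nat.cast_one, add_assoc, one_add_one_eq_two, hl l m] at h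
    rw [Nat.cast_add, Nat.cast_ofNat, h, show (-6 : ℤ) = -3 + -3 by norm_num, zpow_add₀ hq0]
    ring
  have hrec : ∀ m : ℕ, conductorExp _ _ _ ϖ Λ ≤ m + 1 →
      B (hElt ϖ l (m + 2 : ℕ)) = mu * (resCard F) ^ (-4 : ℤ) * B (hElt ϖ l (m + 1 : ℕ)) -
        (resCard F)⁻¹ * (charL _ _ _ Λ (scalarL _ _ _ ϖ) : ℂ) * B (hElt ϖ (l + 2 : ℕ) m) := by
    intro m hm
    have h := congrFun hmu (hElt ϖ l (m + 1 : ℕ))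
    rw [hecke_zero_one_recurrence habc hB hψ hπ hϖ hΛ ν l m hm, Pi.smul_apply, smul_eq_mul] at h
    rw [mul_right_comm, ← h]
    simp only [zpow_neg, zpow_ofNat]
    field_simp
    ring
  refine mk_eq_mul_inv_of_recurrence
    (s := fun k : ℕ => B (hElt ϖ l (conductorExp _ _ _ ϖ Λ + k : ℕ))) ?_ fun n => ?_
  · rw [kappa]
    -- The first step determines κ. For m₀ = 0 it is the evaluation at h(l,0) in the three cases;
    -- for m₀ = m + 1 the term B(h(l+2,m)) vanishes, so κ = 0.
    rcases h0 : conductorExp _ _ _ ϖ Λ with _ | m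
    · have h := congrFun hmu (hElt ϖ l 0)
      rw [hecke_zero_one_apply_hElt_zero habc hB hψ hπ hϖ hΛ ν ϖL hϖL l h0, Pi.smul_apply,
        smul_eq_mul] at h
      have h1 := hl l 0
      rw [Nat.cast_zero] at h1
      rw [h1] at h
      simp only [zpow_neg, zpow_ofNat] at h ⊢
      simp only [lt_self_iff_false, if_false, zero_add, Nat.cast_one, Nat.cast_zero]
      split_ifs at h ⊢
      · field_simp
        linear_combination resCard F * h
      · field_simp at h ⊢
        linear_combination h
      · field_simp at h ⊢
        linear_combination resCard F * h
    · have h := hrec m h0.le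
      rw [apply_hElt_eq_zero habc hB hπ hϖ (l + 2) m (by omega), mul_zero, sub_zero] at h
      simpa [add_assoc] using h
  · have h := hrec (conductorExp _ _ _ ϖ Λ + n) (by omega)
    rw [hl2] at h
    simp only [← add_assoc]
    -- The factor q⁻⁷ combines q⁻¹ from the recurrence in m with q⁻⁶ from lowering l + 2 to l.
    rw [h, show (-7 : ℤ) = -1 + -6 by norm_num, zpow_add₀ hq0, zpow_neg_one]
    ring
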